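/- Let $a>0$, $\mathbf v_1=a(\frac{\sqrt3}{2},\frac12)$, $\mathbf v_2=a(\frac{\sqrt3}{2},-\frac12)$, $\Lambda=\mathbb Z\mathbf v_1\oplus\mathbb Z\mathbf v_2$, $\Gamma=\mathbb R^2/\Lambda$, $\mathbf x_0=\frac23(\mathbf v_1+\mathbf v_2)$, $Y=\{\mathbf y_1,\mathbf y_2\}=\{\mathbf 0,\mathbf x_0\}$. Let $\mathbf k_1,\mathbf k_2$ be the dual basis, $\mathbf k_i\cdot\mathbf v_j=2\pi\delta_{ij}$, $\xi_{\mathbf m}=m_1\mathbf k_1+m_2\mathbf k_2$ for $\mathbf m\in\mathbb Z^2$, and let $\mathcal B$ be the Brillouin zone (a fundamental domain of the dual lattice). Let $\mathbf k\in\mathbb R^2$ and $\alpha\in\mathbb R$. Let $L^2_{\mathbf k}(\Gamma)$ be the Hilbert space of functions in $L^2(\Gamma)$ with $f(\mathbf x+\mathbf v_j)=e^{i\mathbf k\cdot\mathbf v_j}f(\mathbf x)$, $j=1,2$, with $(f,g)=\int_\Gamma\overline f g$, and let $-\Delta(\mathbf k)$ be the Laplacian in it with domain $H^2_{\mathbf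 k}(\Gamma)$, that is, multiplication by $\lambda_{\mathbf m}:=|\xi_{\mathbf m}+\mathbf k|^2$ of the coefficients with respect to the functions $e^{i(\xi_{\mathbf m}+\mathbf k)\cdot\mathbf x}$. For $\lambda\in\mathbb C\setminus\sigma(-\Delta(\mathbf k))$ put $$g_\lambda(\mathbf x,\mathbf k)=\frac1{\mathrm{area}(\Gamma)}\lim_{r\to\infty}\Big[\sum_{|\xi_{\mathbf m}+\mathbf k|\le r}\frac{e^{i(\xi_{\mathbf m}+\mathbf k)\cdot\mathbf x}}{|\xi_{\mathbf m}+\mathbf k|^2-\lambda}-\mathbf 1_{\Lambda}(\mathbf x)\frac{2\pi}{\mathrm{area}(\mathcal B)}\ln r\Big],\qquad [\Gamma_\alpha(\lambda)]_{jj'}=\alpha\delta_{jj'}-g_\lambda(\mathbf y_{j'}-\mathbf y_j,\mathbf k).$$ The honeycomb operator $-\Delta_{\alpha,Y}(\mathbf k)$ is the self-adjoint operator in $L^2_{\mathbf k}(\Gamma)$ with resolvent $$(-\Delta_{\alpha,Y}(\mathbf k)-\lambda)^{-1}f=(-\Delta(\mathbf k)-\lambda)^{-1}f+\sum_{j,j'=1}^2[\Gamma_\alpha(\lambda)^{-1}]_{jj'}\,\big(g_{\overline\lambda}(\cdot-\mathbf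 y_j,\mathbf k),f\big)\,g_\lambda(\cdot-\mathbf y_{j'},\mathbf k)$$ for all $\lambda\notin\sigma(-\Delta(\mathbf k))$ with $\Gamma_\alpha(\lambda)$ invertible. Write $\mathrm{mult}(\lambda,P)$ for the multiplicity of $\lambda$ as an eigenvalue of $P$ (the dimension of the eigenspace). Put $$\tilde g_{2,\lambda}=\frac1{\sqrt2}\Big(g_\lambda(\cdot-\mathbf x_0,\mathbf k)-\frac{\overline{g_\lambda(\mathbf x_0,\mathbf k)}}{|g_\lambda(\mathbf x_0,\mathbf k)|}\,g_\lambda(\cdot,\mathbf k)\Big)\ \text{ if } g_\lambda(\mathbf x_0,\mathbf k)\ne0,\qquad \tilde g_{2,\lambda}=g_\lambda(\cdot-\mathbf x_0,\mathbf k)\ \text{ otherwise.}$$ **Proposition.** Suppose $\lambda'=\lambda_{\mathbf m_1}=\dots=\lambda_{\mathbf m_\mu}$ ($\mathbf m_1,\dots,\mathbf m_\mu$ distinct) is an eigenvalue of $-\Delta(\mathbf k)$ of multiplicity $\mu\ge1$. For $Z\subseteq\mathbb R^2$ let $E_Z$ be the space of functions $f:\mathbf x\mapsto\sum_{j=1}^\mu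 c_je^{i(\xi_{\mathbf m_j}+\mathbf k)\cdot\mathbf x}$, $c_j\in\mathbb C$, with $f=0$ on $Z$. 1. If $\mu\ne\big|\sum_{j=1}^\mu e^{i\xi_{\mathbf m_j}\cdot\mathbf x_0}\big|$, then $\mathrm{mult}(\lambda',-\Delta_{\alpha,Y}(\mathbf k))=\mu-2$, and the eigenspace is $E_{\{\mathbf 0,\mathbf x_0\}}$. If $\mu=\big|\sum_{j=1}^\mu e^{i\xi_{\mathbf m_j}\cdot\mathbf x_0}\big|$, then the limit $C=\lim_{\lambda\nearrow\lambda'}\big(g_\lambda(\mathbf 0,\mathbf k)-|g_\lambda(\mathbf x_0,\mathbf k)|\big)$ exists, is real and finite, and: 2. if $\alpha\ne C$, then $\mathrm{mult}(\lambda',-\Delta_{\alpha,Y}(\mathbf k))=\mu-1$, and the eigenspace is $E_{\{\mathbf 0\}}$; 3. if $\alpha=C$, then $\mathrm{mult}(\lambda',-\Delta_{\alpha,Y}(\mathbf k))=\mu$, the limit $\tilde g_{2,\lambda'_-}=\lim_{\lambda\nearrow\lambda'}\tilde g_{2,\lambda}$ exists in $L^2_{\mathbf k}(\Gamma)$, and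 the eigenspace is $E_{\{\mathbf 0\}}\oplus\mathrm{span}\{\tilde g_{2,\lambda'_-}\}$. Moreover, $\mathrm{mult}(\lambda',-\Delta_{\alpha,Y}(\mathbf k))=0$ if and only if $\lambda'\notin\sigma(-\Delta_{\alpha,Y}(\mathbf k))$. -/

import Mathlib

open Filter Topology MeasureTheory
open scoped ComplexConjugate

noncomputable section

namespace Honeycomb

/-- The Euclidean plane. -/
abbrev Plane : Type := EuclideanSpace ℝ (Fin 2)

/-! ### Lattices -/

/-- First basis vector of the triangular lattice `Λ` with lattice constant `a`. -/
def v₁ (a : ℝ) : Plane := !₂[a * (√3 / 2), a * (1 / 2)]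

/-- Second basis vector of the triangular lattice `Λ`. -/
def v₂ (a : ℝ) : Plane := !₂[a * (√3 / 2), -(a * (1 / 2))]

/-- First basis vector of the dual lattice `Λ*`, so that `k_i ⬝ v_j = 2π δ_ij`. -/
def k₁ (a : ℝ) : Plane :=
  !₂[4 * Real.pi / (a * √3) * (1 / 2), 4 * Real.pi / (a * √3) * (√3 / 2)]

/-- Second basis vector of the dual lattice `Λ*`. -/
def k₂ (a : ℝ) : Plane :=
  !₂[4 * Real.pi / (a * √3) * (1 / 2), -(4 * Real.pi / (a * √3) * (√3 / 2))]

/-- The triangular lattice `Λ = ℤ v₁ ⊕ ℤ v₂`. -/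
def lattice (a : ℝ) : Set Plane :=
  {x | ∃ n₁ n₂ : ℤ, x = (n₁ : ℝ) • v₁ a + (n₂ : ℝ) • v₂ a}

/-- The dual lattice vector `ξ_m = m₁ k₁ + m₂ k₂`. -/
def ξ (a : ℝ) (m : ℤ × ℤ) : Plane := (m.1 : ℝ) • k₁ a + (m.2 : ℝ) • k₂ a

/-- The second scatterer `x₀ = (2/3)(v₁ + v₂)` in the fundamental domain. -/
def x₀ (a : ℝ) : Plane := (2 / 3 : ℝ) • (v₁ a + v₂ a)

/-- The set of scatterers `Y = {0, x₀}`, as an indexed family. -/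
def scatterer (a : ℝ) : Fin 2 → Plane := ![0, x₀ a]

/-- The unit cell of `Λ`, representing the fundamental domain `Γ = ℝ²/Λ`. -/
def cell (a : ℝ) : Set Plane :=
  {x | ∃ s ∈ Set.Ico (0 : ℝ) 1, ∃ t ∈ Set.Ico (0 : ℝ) 1, x = s • v₁ a + t • v₂ a}

/-- Area of a fundamental domain of `Λ`. -/
def areaΓ (a : ℝ) : ℝ := |v₁ a 0 * v₂ a 1 - v₁ a 1 * v₂ a 0|

/-- Area of the Brillouin zone, a fundamental domain of `Λ*`. -/
def areaB (a : ℝ) : ℝ := |k₁ a 0 * k₂ a 1 - k₁ a 1 * k₂ a 0|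

theorem volume_cell_lt_top (a : ℝ) : volume (cell a) < ⊤ := by
  refine lt_of_le_of_lt (measure_mono (t := Metric.closedBall 0 (‖v₁ a‖ + ‖v₂ a‖)) ?_)
    measure_closedBall_lt_top
  rintro x ⟨s, hs, t, ht, rfl⟩
  rw [mem_closedBall_zero_iff]
  refine (norm_add_le _ _).trans (add_le_add ?_ ?_)
  · rw [norm_smul, Real.norm_of_nonneg hs.1]
    exact mul_le_of_le_one_left (norm_nonneg _) hs.2.le
  · rw [norm_smul, Real.norm_of_nonneg ht.1]
    exact mul_le_of_le_one_left (norm_nonneg _) ht.2.le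

/-- The Hilbert space `L²_k(Γ)`. A function on the plane with
`f (x + v_j) = exp (i k ⬝ v_j) f x` is determined by its restriction to the unit cell, and the
restriction is a unitary map of `L²_k(Γ)` onto `L²(cell)`; the dependence on `k` enters through the
quasi-periodic exponentials `planeWave a k m` in which functions are expanded. -/
abbrev L2 (a : ℝ) : Type := Lp ℂ 2 (volume.restrict (cell a))

/-- The quasi-periodic exponential `x ↦ exp (i (ξ_m + k) ⬝ x)`. -/
def planeWave (a : ℝ) (k : Plane) (m : ℤ × ℤ) (x : Plane) : ℂ :=
  Complex.exp (Complex.I * ((inner ℝ (ξ a m + k) x : ℝ) : ℂ))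

theorem memLp_planeWave (a : ℝ) (k : Plane) (m : ℤ × ℤ) :
    MemLp (planeWave a k m) 2 (volume.restrict (cell a)) := by
  have : IsFiniteMeasure (volume.restrict (cell a)) :=
    ⟨by rw [Measure.restrict_apply_univ]; exact volume_cell_lt_top a⟩
  refine MemLp.of_bound (C := 1) ?_ (Eventually.of_forall fun x => ?_)
  · apply Continuous.aestronglyMeasurable
    unfold planeWave
    fun_prop
  · unfold planeWave
    rw [mul_comm, Complex.norm_exp_ofReal_mul_I]

/-- `x ↦ exp (i (ξ_m + k) ⬝ x)` as an element of `L²_k(Γ)`. -/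
def planeWaveL2 (a : ℝ) (k : Plane) (m : ℤ × ℤ) : L2 a := (memLp_planeWave a k m).toLp

/-! ### Unbounded operators, given by their graphs -/

section Operators

variable {H : Type*} [NormedAddCommGroup H] [NormedSpace ℂ H]

/-- The eigenspace `{ψ | T ψ = z ψ}` of the operator with graph `T`. -/
def eigenspace (T : Submodule ℂ (H × H)) (z : ℂ) : Submodule ℂ H where
  carrier := {ψ | (ψ, z • ψ) ∈ T}
  zero_mem' := by
    change ((0 : H), z • (0 : H)) ∈ T
    rw [smul_zero]
    exact T.zero_mem
  add_mem' := by
    intro x y hx hy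
    simpa [smul_add] using T.add_mem hx hy
  smul_mem' := by
    intro c x hx
    simpa [smul_comm c z x] using T.smul_mem c hx

/-- The multiplicity of `z` as an eigenvalue of the operator with graph `T`. -/
def mult (z : ℂ) (T : Submodule ℂ (H × H)) : ℕ := Module.finrank ℂ (eigenspace T z)

/-- The spectrum of the operator with graph `T`: `z` is not in it iff `T - z` has an everywhere
defined bounded inverse `B`, that is, `T ψ = η` iff `B (η - z ψ) = ψ`. -/
def spectrumOf (T : Submodule ℂ (H × H)) : Set ℂ :=
  {z | ¬ ∃ B : H →L[ℂ] H, ∀ ψ η : H, (ψ, η) ∈ T ↔ B (η - z • ψ) = ψ}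

end Operators

/-- The graph of the Floquet Laplacian `-Δ(k)` in `L²_k(Γ)`: multiplication by `|ξ_m + k|²` of the
coefficients with respect to the functions `exp (i (ξ_m + k) ⬝ x)`, on its maximal domain
`H²_k(Γ) = {f | ∑ |ξ_m + k|⁴ |f_m|² < ∞}`. -/
def floquetLaplacian (a : ℝ) (k : Plane) : Submodule ℂ (L2 a × L2 a) where
  carrier := {p | ∀ m : ℤ × ℤ, inner ℂ (planeWaveL2 a k m) p.2 =
    ((‖ξ a m + k‖ ^ 2 : ℝ) : ℂ) * inner ℂ (planeWaveL2 a k m) p.1}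
  zero_mem' := by intro m; simp
  add_mem' := by
    intro p q hp hq m
    simp only [Prod.fst_add, Prod.snd_add, inner_add_right, hp m, hq m, mul_add]
  smul_mem' := by
    intro c p hp m
    simp only [Prod.smul_fst, Prod.smul_snd, inner_smul_right, hp m]
    ring

/-! ### The Green function and the point scatterers -/

open Classical in
/-- The value `g_z(x, k)`: the sum `(1 / area Γ) ∑_m exp (i (ξ_m + k) ⬝ x) / (|ξ_m + k|² - z)`,
taken as the limit of the partial sums over `|ξ_m + k| ≤ r` (it does not converge absolutely), with
the divergence `(2π / area B) log r` subtracted when `x` is a lattice point. -/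
def green (a : ℝ) (k : Plane) (z : ℂ) (x : Plane) : ℂ :=
  limUnder atTop fun r : ℝ =>
    ((1 / areaΓ a : ℝ) : ℂ) *
      ((∑ᶠ (m : ℤ × ℤ) (_ : ‖ξ a m + k‖ ≤ r),
          planeWave a k m x / (((‖ξ a m + k‖ ^ 2 : ℝ) : ℂ) - z)) -
        if x ∈ lattice a then ((2 * Real.pi / areaB a * Real.log r : ℝ) : ℂ) else 0)

/-- The function `x ↦ g_z(x - y, k)` as an element of `L²_k(Γ)`, given by its Fourier series, which
converges unconditionally in `L²_k(Γ)`. -/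
def greenL2 (a : ℝ) (k : Plane) (z : ℂ) (y : Plane) : L2 a :=
  ∑' m : ℤ × ℤ, (((1 / areaΓ a : ℝ) : ℂ) * planeWave a k m (-y) /
    (((‖ξ a m + k‖ ^ 2 : ℝ) : ℂ) - z)) • planeWaveL2 a k m

/-- The matrix `Γ_{α,Y}(z, k)`, with entries `α δ_{jj'} - g_z(y_{j'} - y_j, k)`. -/
def gammaMatrix (a α : ℝ) (k : Plane) (z : ℂ) : Matrix (Fin 2) (Fin 2) ℂ :=
  fun j j' => (if j = j' then (α : ℂ) else 0) - green a k z (scatterer a j' - scatterer a j)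

/-- The finite rank part of the resolvent of the honeycomb point scatterer,
`f ↦ ∑_{j,j'} [Γ_{α,Y}(z, k)⁻¹]_{jj'} (g_{z̄}(· - y_j, k), f) g_z(· - y_{j'}, k)`. -/
def resolventCorrection (a α : ℝ) (k : Plane) (z : ℂ) (f : L2 a) : L2 a :=
  ∑ j : Fin 2, ∑ j' : Fin 2,
    ((gammaMatrix a α k z)⁻¹ j j' * inner ℂ (greenL2 a k (conj z) (scatterer a j)) f) •
      greenL2 a k z (scatterer a j')

/-- `IsResolventAt a α k z f ψ` says that `ψ` is the value at `f` of the resolvent at `z` of the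
honeycomb point scatterer: `ψ = (-Δ(k) - z)⁻¹ f + resolventCorrection f`. Here
`φ = (-Δ(k) - z)⁻¹ f`, that is, `-Δ(k) φ = z φ + f`. -/
def IsResolventAt (a α : ℝ) (k : Plane) (z : ℂ) (f ψ : L2 a) : Prop :=
  ∃ φ : L2 a, (φ, z • φ + f) ∈ floquetLaplacian a k ∧
    ψ = φ + resolventCorrection a α k z f

theorem resolventCorrection_add (a α : ℝ) (k : Plane) (z : ℂ) (f g : L2 a) :
    resolventCorrection a α k z (f + g) =
      resolventCorrection a α k z f + resolventCorrection a α k z g := by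
  simp only [resolventCorrection, inner_add_right, mul_add, add_smul, Finset.sum_add_distrib]

theorem resolventCorrection_smul (a α : ℝ) (k : Plane) (z c : ℂ) (f : L2 a) :
    resolventCorrection a α k z (c • f) = c • resolventCorrection a α k z f := by
  simp only [resolventCorrection, inner_smul_right, Finset.smul_sum, smul_smul]
  refine Finset.sum_congr rfl fun j _ => Finset.sum_congr rfl fun j' _ => ?_
  congr 1
  ring

/-- The graph of the self-adjoint operator `-Δ_{α,{0,x₀}}(k)` in `L²_k(Γ)`: the operator whose
resolvent `(-Δ_{α,{0,x₀}}(k) - z)⁻¹`, at every `z` outside the spectrum of `-Δ(k)` for which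
`Γ_{α,Y}(z, k)` is invertible, is given by Krein's formula. -/
def honeycombOperator (a α : ℝ) (k : Plane) : Submodule ℂ (L2 a × L2 a) where
  carrier := {p | ∀ z : ℂ, (∀ m : ℤ × ℤ, ((‖ξ a m + k‖ ^ 2 : ℝ) : ℂ) ≠ z) →
    IsUnit (gammaMatrix a α k z).det → IsResolventAt a α k z (p.2 - z • p.1) p.1}
  zero_mem' := by
    intro z _ _
    refine ⟨0, ?_, by simp [resolventCorrection]⟩
    simp only [Prod.fst_zero, Prod.snd_zero, smul_zero, sub_zero, add_zero]
    exact (floquetLaplacian a k).zero_mem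
  add_mem' := by
    intro p q hp hq z hz hz'
    obtain ⟨φ, hφ, h1⟩ := hp z hz hz'
    obtain ⟨χ, hχ, h2⟩ := hq z hz hz'
    refine ⟨φ + χ, ?_, ?_⟩
    · have := (floquetLaplacian a k).add_mem hφ hχ
      rw [Prod.mk_add_mk] at this
      convert this using 2
      simp only [Prod.fst_add, Prod.snd_add, smul_add]
      abel
    · have e : (p + q).2 - z • (p + q).1 = (p.2 - z • p.1) + (q.2 - z • q.1) := by
        simp only [Prod.fst_add, Prod.snd_add, smul_add]
        abel
      rw [e, resolventCorrection_add, Prod.fst_add]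
      nth_rewrite 1 [h1, h2]
      abel
  smul_mem' := by
    intro c p hp z hz hz'
    obtain ⟨φ, hφ, h1⟩ := hp z hz hz'
    have e : (c • p).2 - z • (c • p).1 = c • (p.2 - z • p.1) := by
      simp only [Prod.smul_fst, Prod.smul_snd, smul_sub, smul_comm c z]
    refine ⟨c • φ, ?_, ?_⟩
    · have := (floquetLaplacian a k).smul_mem c hφ
      rw [Prod.smul_mk] at this
      rw [e]
      convert this using 2
      rw [smul_add, smul_comm c z]
    · rw [e, resolventCorrection_smul, Prod.smul_fst, ← smul_add, ← h1]

/-! ### Eigenfunctions -/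

/-- The unitary matrix `U_{α,{0,x₀}}(z, k)` that diagonalizes `Γ_{α,{0,x₀}}(z, k)` for real `z`. -/
def unitaryU (a : ℝ) (k : Plane) (z : ℂ) : Matrix (Fin 2) (Fin 2) ℂ :=
  open Classical in
  if green a k z (x₀ a) = 0 then 1
  else ((1 / √2 : ℝ) : ℂ) •
    !![1, -(green a k z (x₀ a) / (‖green a k z (x₀ a)‖ : ℂ));
       conj (green a k z (x₀ a)) / (‖green a k z (x₀ a)‖ : ℂ), 1]

/-- `g̃_{2,z}(·, k)`, the second entry of the vector
`U* (g_z(·, k), g_z(· - x₀, k))ᵀ` with entries in `L²_k(Γ)`. -/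
def gTilde₂ (a : ℝ) (k : Plane) (z : ℂ) : L2 a :=
  ∑ j : Fin 2, (unitaryU a k z).conjTranspose 1 j • greenL2 a k z (scatterer a j)

/-- The function `x ↦ ∑_j c_j exp (i (ξ_{m_j} + k) ⬝ x)`. -/
def trigSum (a : ℝ) (k : Plane) {μ : ℕ} (m : Fin μ → ℤ × ℤ) (c : Fin μ → ℂ) (x : Plane) : ℂ :=
  ∑ j, c j * planeWave a k (m j) x

/-- The subspace of `L²_k(Γ)` of the functions `f : x ↦ ∑_j c_j exp (i (ξ_{m_j} + k) ⬝ x)`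
with `f y = 0` for all `y ∈ Z`. -/
def trigSpace (a : ℝ) (k : Plane) {μ : ℕ} (m : Fin μ → ℤ × ℤ) (Z : Set Plane) :
    Submodule ℂ (L2 a) where
  carrier := {u | ∃ c : Fin μ → ℂ, (∀ y ∈ Z, trigSum a k m c y = 0) ∧
    u =ᵐ[volume.restrict (cell a)] trigSum a k m c}
  zero_mem' := by
    refine ⟨0, fun y _ => by simp [trigSum], ?_⟩
    filter_upwards [Lp.coeFn_zero ℂ 2 (volume.restrict (cell a))] with x hx
    rw [hx]
    simp [trigSum]
  add_mem' := by
    rintro u w ⟨c, hc, hu⟩ ⟨d, hd, hw⟩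
    have e : ∀ x, trigSum a k m (c + d) x = trigSum a k m c x + trigSum a k m d x := by
      intro x
      simp only [trigSum, Pi.add_apply, add_mul, Finset.sum_add_distrib]
    refine ⟨c + d, fun y hy => by rw [e, hc y hy, hd y hy, add_zero], ?_⟩
    filter_upwards [Lp.coeFn_add u w, hu, hw] with x h1 h2 h3
    rw [h1, Pi.add_apply, h2, h3, e]
  smul_mem' := by
    rintro b u ⟨c, hc, hu⟩
    have e : ∀ x, trigSum a k m (b • c) x = b * trigSum a k m c x := by
      intro x
      simp only [trigSum, Pi.smul_apply, smul_eq_mul, Finset.mul_sum, mul_assoc]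
    refine ⟨b • c, fun y hy => by rw [e, hc y hy, mul_zero], ?_⟩
    filter_upwards [Lp.coeFn_smul b u, hu] with x h1 h2
    rw [h1, Pi.smul_apply, h2, e, smul_eq_mul]

end Honeycomb

end

open Honeycomb

noncomputable section

namespace Honeycomb

/-! ### Lattice geometry -/

/-! Krein's formula says that ψ lies in the domain, with image η, exactly when -Δ(k)ψ = η + Σ q_j
δ_{y_j} for some charges q, and the values at the scatterers of what is left after subtracting Σ q_j
g_z(· - y_j) are Γ(z)ᵀq. The second condition does not depend on z
(`WavesTotal.boundaryCondition_iff`). It is therefore legitimate to read it at z = λ' itself, where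
Krein's formula is unavailable. Since `0⁻¹ = 0`, `green` and `greenL2` at λ' are the Green functions
with the resonant terms dropped, that is, the constant terms of the Laurent expansions at λ'.

For an eigenfunction η = λ'ψ, the source equation at a resonant index m_j becomes q₀ + q₁
e^{-i(ξ_{m_j}+k)·x₀} = 0. The modulus condition in the statement is equality in the triangle
inequality, so it decides whether these phases all agree. If two phases differ, then q = 0, and ψ is
a resonant wave sum vanishing at both scatterers. If all phases equal θ, then q = c(-θ̄, 1). The two
boundary equations reduce to c(α - C) = 0 and a prescribed value at 0 of the resonant part, with C =
g_{λ'}(0) - Re(θ̄ g_{λ'}(x₀)) (`WavesTotal.mem_eigenspace_iff_of_phase`). For α ≠ C only c = 0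
survives; for α = C there is one further eigenfunction.

The limits come from θ̄ g_z(x₀) = T + s with T convergent and s = μ/(area Γ (λ' - z)) → +∞. The
poles cancel in g_z(0) - |g_z(x₀)|. In g̃₂ they cancel up to the first-order deviation of the phase
of g_z(x₀), which, multiplied by s, leaves a finite resonant term.

Three supports are needed. Convergence of the disc sums defining g_z follows from lattice point
counts with error O(r) and partial summation. Totality of the plane waves follows from finiteness of
the given multiplicity, because a function orthogonal to all waves would lie in every eigenspace of
the Laplacian graph. The statement on the spectrum is the Fredholm alternative for the compact
resolvent at i. -/

/-- The linear map `x ↦ x₀ u + x₁ v` of the plane. -/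
def frameMap (u v : Plane) : Plane →L[ℝ] Plane :=
  (EuclideanSpace.proj 0 : Plane →L[ℝ] ℝ).smulRight u +
    (EuclideanSpace.proj 1 : Plane →L[ℝ] ℝ).smulRight v

theorem frameMap_apply (u v x : Plane) : frameMap u v x = x 0 • u + x 1 • v := rfl

theorem det_frameMap (u v : Plane) :
    LinearMap.det (frameMap u v : Plane →ₗ[ℝ] Plane) = u 0 * v 1 - u 1 * v 0 := by
  rw [← LinearMap.det_toMatrix (EuclideanSpace.basisFun (Fin 2) ℝ).toBasis, Matrix.det_fin_two]
  simp [LinearMap.toMatrix_apply, frameMap_apply, OrthonormalBasis.coe_toBasis]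
  ring

theorem sqrt_three_sq : √3 * √3 = (3 : ℝ) := Real.mul_self_sqrt (by norm_num)

theorem inner_plane (x y : Plane) : inner ℝ x y = x 0 * y 0 + x 1 * y 1 := by
  simp [PiLp.inner_apply, Fin.sum_univ_two]
  ring

theorem inner_ξ (a : ℝ) (ha : 0 < a) (m : ℤ × ℤ) (s t : ℝ) :
    inner ℝ (ξ a m) (s • v₁ a + t • v₂ a) = 2 * Real.pi * (m.1 * s + m.2 * t) := by
  have h3 : √3 ≠ 0 := by positivity
  rw [inner_plane]
  simp [ξ, k₁, k₂, v₁, v₂]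
  field_simp
  -- The hypothesis enters with coefficient 0: the cleared goal is already a ring identity.
  linear_combination Real.pi * (m.1 * s + m.2 * t + m.1 * t + m.2 * s) * sqrt_three_sq * 0

theorem inner_ξ_x₀ (a : ℝ) (ha : 0 < a) (m : ℤ × ℤ) :
    inner ℝ (ξ a m) (x₀ a) = 2 * Real.pi * (2 * (m.1 + m.2) / 3) := by
  rw [x₀, smul_add, inner_ξ a ha]
  ring

theorem areaΓ_pos (a : ℝ) (ha : 0 < a) : 0 < areaΓ a := by
  have h3 : 0 < √3 := by positivity
  unfold areaΓ
  rw [abs_pos]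
  simp [v₁, v₂]
  have : 0 < a * (√3 / 2) * (a * 2⁻¹) := by positivity
  nlinarith

theorem areaB_pos (a : ℝ) (ha : 0 < a) : 0 < areaB a := by
  have h3 : 0 < √3 := by positivity
  have hp := Real.pi_pos
  unfold areaB
  rw [abs_pos]
  simp [k₁, k₂]
  have : 0 < 4 * Real.pi / (a * √3) * 2⁻¹ * (4 * Real.pi / (a * √3) * (√3 / 2)) := by positivity
  nlinarith

theorem norm_ξ_sq (a : ℝ) (m : ℤ × ℤ) :
    ‖ξ a m‖ ^ 2 = (4 * Real.pi / (a * √3)) ^ 2 / 4 *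
      (((m.1 : ℝ) + m.2) ^ 2 + 3 * ((m.1 : ℝ) - m.2) ^ 2) := by
  rw [← real_inner_self_eq_norm_sq, inner_plane]
  simp [ξ, k₁, k₂]
  generalize 4 * Real.pi / (a * √3) = b
  linear_combination (b ^ 2 * ((m.1 : ℝ) - m.2) ^ 2 / 4) * sqrt_three_sq

/-! ### The levels of the Floquet Laplacian -/

/-- The level `|ξ_m + k|²`. -/
def level (a : ℝ) (k : Plane) (m : ℤ × ℤ) : ℝ := ‖ξ a m + k‖ ^ 2

theorem level_nonneg (a : ℝ) (k : Plane) (m : ℤ × ℤ) : 0 ≤ level a k m := by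
  unfold level; positivity

/-- The quadratic form |ξ_m|² dominates (b²/2)(m₁² + m₂²), so summability over levels can be
borrowed from Eisenstein series. -/
theorem exists_norm_le_level (a : ℝ) (ha : 0 < a) (k : Plane) :
    ∃ C : ℝ, 0 < C ∧ ∀ m : ℤ × ℤ, ‖![m.1, m.2]‖ ^ 2 ≤ C * (1 + level a k m) := by
  set b := 4 * Real.pi / (a * √3) with hb
  have hb0 : 0 < b := by have := Real.pi_pos; positivity
  have hbne : b ≠ 0 := hb0.ne'
  refine ⟨4 / b ^ 2 * (1 + ‖k‖ ^ 2), by positivity, fun m => ?_⟩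
  have h1 : ‖ξ a m‖ ^ 2 ≤ 2 * (level a k m + ‖k‖ ^ 2) := by
    have h : ‖ξ a m‖ ≤ ‖ξ a m + k‖ + ‖k‖ := by
      simpa using norm_sub_le (ξ a m + k) k
    have := norm_nonneg (ξ a m)
    unfold level
    nlinarith [sq_nonneg (‖ξ a m + k‖ - ‖k‖)]
  rw [norm_ξ_sq, ← hb] at h1
  have h0 := level_nonneg a k m
  have h2 : ‖![m.1, m.2]‖ ^ 2 ≤ (m.1 : ℝ) ^ 2 + (m.2 : ℝ) ^ 2 := by
    have : ‖![m.1, m.2]‖ ≤ √((m.1 : ℝ) ^ 2 + (m.2 : ℝ) ^ 2) := by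
      rw [pi_norm_le_iff_of_nonneg (by positivity)]
      intro i
      fin_cases i
      · simp only [Fin.zero_eta, Matrix.cons_val_zero, Int.norm_eq_abs]
        apply Real.abs_le_sqrt; nlinarith [sq_nonneg (m.2 : ℝ)]
      · simp only [Fin.mk_one, Matrix.cons_val_one, Matrix.cons_val_zero, Int.norm_eq_abs]
        apply Real.abs_le_sqrt; nlinarith [sq_nonneg (m.1 : ℝ)]
    calc _ ≤ √((m.1 : ℝ) ^ 2 + (m.2 : ℝ) ^ 2) ^ 2 := by gcongr
      _ = _ := Real.sq_sqrt (by positivity)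
  refine h2.trans ?_
  have h3 : b ^ 2 / 2 * ((m.1 : ℝ) ^ 2 + (m.2 : ℝ) ^ 2) ≤ 2 * (level a k m + ‖k‖ ^ 2) := by
    refine le_trans ?_ h1
    have : 0 ≤ b ^ 2 / 4 := by positivity
    nlinarith [mul_nonneg this (sq_nonneg ((m.1 : ℝ) - m.2))]
  have h4 : 4 / b ^ 2 * (1 + ‖k‖ ^ 2) * (1 + level a k m) * (b ^ 2 / 2) =
      2 * ((1 + ‖k‖ ^ 2) * (1 + level a k m)) := by field_simp; norm_num
  have h5 : 0 < b ^ 2 / 2 := by positivity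
  nlinarith [mul_nonneg (sq_nonneg ‖k‖) h0]

theorem summable_one_add_level_sq (a : ℝ) (ha : 0 < a) (k : Plane) :
    Summable fun m : ℤ × ℤ => ((1 + level a k m) ^ 2)⁻¹ := by
  obtain ⟨C, hC, h⟩ := exists_norm_le_level a ha k
  have hs := EisensteinSeries.summable_one_div_norm_rpow (k := 4) (by norm_num)
  rw [← (finTwoArrowEquiv ℤ).symm.summable_iff] at hs
  refine Summable.of_norm_bounded_eventually (hs.mul_left (C ^ 2)) ?_
  -- At the origin the real power `‖0‖ ^ (-4)` is 0, so the comparison is made off this single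
  -- index.
  have hfin : ({0} : Set (ℤ × ℤ)).Finite := Set.finite_singleton _
  refine Filter.mem_of_superset hfin.compl_mem_cofinite fun m hm => ?_
  have hm' : ![m.1, m.2] ≠ 0 := by
    intro h0
    apply hm
    have h1 := congrFun h0 0
    have h2 := congrFun h0 1
    simp at h1 h2
    exact Prod.ext h1 h2
  have hpos : 0 < ‖![m.1, m.2]‖ := norm_pos_iff.2 hm'
  have hl := level_nonneg a k m
  change ‖((1 + level a k m) ^ 2)⁻¹‖ ≤ C ^ 2 * ‖![m.1, m.2]‖ ^ (-4 : ℝ)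
  rw [Real.rpow_neg hpos.le, Real.norm_of_nonneg (by positivity), ← div_eq_mul_inv,
    inv_le_comm₀ (by positivity) (by positivity), inv_div, div_le_iff₀ (by positivity)]
  have := h m
  norm_cast
  calc ‖![m.1, m.2]‖ ^ 4 = (‖![m.1, m.2]‖ ^ 2) ^ 2 := by ring
    _ ≤ (C * (1 + level a k m)) ^ 2 := by gcongr
    _ = _ := by ring

theorem finite_level_le (a : ℝ) (ha : 0 < a) (k : Plane) (R : ℝ) :
    {m : ℤ × ℤ | level a k m ≤ R}.Finite := by
  have h := (summable_one_add_level_sq a ha k).tendsto_cofinite_zero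
  by_cases hR : 0 ≤ R
  · have := h.eventually
      (Iio_mem_nhds (show (0 : ℝ) < ((1 + R) ^ 2)⁻¹ by positivity))
    refine Set.Finite.subset this fun m hm => ?_
    change level a k m ≤ R at hm
    change ¬ ((1 + level a k m) ^ 2)⁻¹ < ((1 + R) ^ 2)⁻¹
    rw [not_lt]
    have := level_nonneg a k m
    gcongr
  · convert Set.finite_empty
    ext m
    simp only [Set.mem_ofPred_eq, Set.mem_empty_iff_false, iff_false]
    have := level_nonneg a k m
    linarith

/-! ### Plane waves -/

theorem planeWave_neg (a : ℝ) (k : Plane) (m : ℤ × ℤ) (x : Plane) :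
    planeWave a k m (-x) = conj (planeWave a k m x) := by
  simp [planeWave, ← Complex.exp_conj, inner_neg_right]

theorem planeWave_add (a : ℝ) (k : Plane) (m : ℤ × ℤ) (x y : Plane) :
    planeWave a k m (x + y) = planeWave a k m x * planeWave a k m y := by
  simp [planeWave, ← Complex.exp_add, inner_add_right, mul_add]

theorem planeWave_sub (a : ℝ) (k : Plane) (m : ℤ × ℤ) (x y : Plane) :
    planeWave a k m (x - y) = planeWave a k m x * planeWave a k m (-y) := by
  rw [sub_eq_add_neg, planeWave_add]

@[simp] theorem planeWave_zero (a : ℝ) (k : Plane) (m : ℤ × ℤ) : planeWave a k m 0 = 1 := by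
  simp [planeWave]

@[simp] theorem norm_planeWave (a : ℝ) (k : Plane) (m : ℤ × ℤ) (x : Plane) :
    ‖planeWave a k m x‖ = 1 := by
  rw [planeWave, mul_comm, Complex.norm_exp_ofReal_mul_I]

theorem planeWave_ne_zero (a : ℝ) (k : Plane) (m : ℤ × ℤ) (x : Plane) :
    planeWave a k m x ≠ 0 := Complex.exp_ne_zero _

/-! ### Orthogonality of the plane waves on the cell -/

/-- The unit square in the plane. -/
def unitSquare : Set Plane := {x | ∀ i, x i ∈ Set.Ico (0 : ℝ) 1}

theorem unitSquare_eq : unitSquare =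
    (WithLp.ofLp : Plane → Fin 2 → ℝ) ⁻¹' (Set.univ.pi fun _ => Set.Ico (0 : ℝ) 1) := by
  ext x; simp [unitSquare]

theorem measurableSet_unitSquare : MeasurableSet unitSquare := by
  rw [unitSquare_eq]
  exact (PiLp.volume_preserving_ofLp (Fin 2)).measurable
    (MeasurableSet.univ_pi fun _ => measurableSet_Ico)

theorem volume_unitSquare : volume unitSquare = 1 := by
  rw [unitSquare_eq, (PiLp.volume_preserving_ofLp (Fin 2)).measure_preimage
    (MeasurableSet.univ_pi fun _ => measurableSet_Ico).nullMeasurableSet, volume_pi_pi]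
  simp

theorem cell_eq_image (a : ℝ) : cell a = frameMap (v₁ a) (v₂ a) '' unitSquare := by
  ext x
  constructor
  · rintro ⟨s, hs, t, ht, rfl⟩
    refine ⟨!₂[s, t], fun i => ?_, by simp [frameMap_apply]⟩
    fin_cases i
    · exact hs
    · exact ht
  · rintro ⟨y, hy, rfl⟩
    exact ⟨y 0, hy 0, y 1, hy 1, rfl⟩

theorem injective_frameMap {u v : Plane} (h : u 0 * v 1 - u 1 * v 0 ≠ 0) :
    Function.Injective (frameMap u v) := by
  rw [← det_frameMap] at h
  exact (LinearMap.equivOfDetNeZero _ h).injective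

theorem setIntegral_cell (a : ℝ) (ha : 0 < a) (g : Plane → ℂ) :
    ∫ x in cell a, g x = areaΓ a * ∫ x in unitSquare, g (x 0 • v₁ a + x 1 • v₂ a) := by
  have hd : (v₁ a) 0 * (v₂ a) 1 - (v₁ a) 1 * (v₂ a) 0 ≠ 0 :=
    abs_pos.1 (areaΓ_pos a ha)
  rw [cell_eq_image, integral_image_eq_integral_abs_det_fderiv_smul volume
    measurableSet_unitSquare (fun x _ => (frameMap (v₁ a) (v₂ a)).hasFDerivAt.hasFDerivWithinAt)
    (injective_frameMap hd).injOn]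
  rw [integral_smul]
  have : |(frameMap (v₁ a) (v₂ a)).det| = areaΓ a := by
    rw [areaΓ, ← det_frameMap, ContinuousLinearMap.det]
  rw [this, Complex.real_smul]
  rfl

theorem integral_exp_Ico (n : ℤ) :
    ∫ x in Set.Ico (0 : ℝ) 1, Complex.exp (Complex.I * ((2 * Real.pi * (n * x) : ℝ) : ℂ)) =
      if n = 0 then 1 else 0 := by
  rw [integral_Ico_eq_integral_Ioc, ← intervalIntegral.integral_of_le zero_le_one]
  split_ifs with h
  · simp [h]
  · have hc : (2 * Real.pi * n * Complex.I : ℂ) ≠ 0 := by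
      simp [Real.pi_ne_zero, h]
    have := integral_exp_mul_complex (a := 0) (b := 1) hc
    simp only [Complex.ofReal_one, mul_one, Complex.ofReal_zero, mul_zero, Complex.exp_zero] at this
    have e : Complex.exp (2 * Real.pi * n * Complex.I) = 1 := by
      rw [Complex.exp_eq_one_iff]
      exact ⟨n, by ring⟩
    rw [e, sub_self, zero_div] at this
    rw [← this]
    congr 1
    ext x
    push_cast
    congr 1
    ring

theorem integral_unitSquare_exp (n : ℤ × ℤ) :
    ∫ x in unitSquare, Complex.exp (Complex.I *
      ((2 * Real.pi * (n.1 * x 0 + n.2 * x 1) : ℝ) : ℂ)) = if n = 0 then 1 else 0 := by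
  have h := (PiLp.volume_preserving_ofLp (Fin 2)).setIntegral_preimage_emb
    (MeasurableEquiv.toLp 2 (Fin 2 → ℝ)).symm.measurableEmbedding
    (fun y : Fin 2 → ℝ => Complex.exp (Complex.I *
      ((2 * Real.pi * (n.1 * y 0 + n.2 * y 1) : ℝ) : ℂ))) (Set.univ.pi fun _ => Set.Ico (0 : ℝ) 1)
  rw [← unitSquare_eq] at h
  rw [h, volume_pi, Measure.restrict_pi_pi]
  have e : ∀ y : Fin 2 → ℝ, Complex.exp (Complex.I *
      ((2 * Real.pi * (n.1 * y 0 + n.2 * y 1) : ℝ) : ℂ)) =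
      ∏ i, (fun x : ℝ => Complex.exp (Complex.I *
        ((2 * Real.pi * ((![n.1, n.2] i : ℤ) * x) : ℝ) : ℂ))) (y i) := by
    intro y
    rw [Fin.prod_univ_two, ← Complex.exp_add]
    congr 1
    simp
    ring
  simp_rw [e]
  rw [integral_fintype_prod_eq_prod (fun i => fun x : ℝ => Complex.exp (Complex.I *
        ((2 * Real.pi * ((![n.1, n.2] i : ℤ) * x) : ℝ) : ℂ)))]
  simp only [integral_exp_Ico, Fin.prod_univ_two]
  by_cases h1 : n.1 = 0 <;> by_cases h2 : n.2 = 0 <;> simp [h1, h2, Prod.ext_iff]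

theorem inner_planeWaveL2 (a : ℝ) (ha : 0 < a) (k : Plane) (m n : ℤ × ℤ) :
    inner ℂ (planeWaveL2 a k m) (planeWaveL2 a k n) = if m = n then (areaΓ a : ℂ) else 0 := by
  rw [L2.inner_def]
  have h1 : ∫ x in cell a, inner ℂ (planeWaveL2 a k m x) (planeWaveL2 a k n x) =
      ∫ x in cell a, Complex.exp (Complex.I * ((inner ℝ (ξ a n - ξ a m) x : ℝ) : ℂ)) := by
    refine integral_congr_ae ?_
    filter_upwards [(memLp_planeWave a k m).coeFn_toLp, (memLp_planeWave a k n).coeFn_toLp]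
      with x hx hy
    rw [planeWaveL2, planeWaveL2, hx, hy, RCLike.inner_apply, ← planeWave_neg, planeWave, planeWave,
      ← Complex.exp_add, ← mul_add, ← Complex.ofReal_add]
    congr 3
    simp only [inner_neg_right, inner_add_left, inner_sub_left]
    ring
  rw [h1, setIntegral_cell a ha]
  have h2 : ∀ x : Plane, inner ℝ (ξ a n - ξ a m) (x 0 • v₁ a + x 1 • v₂ a) =
      2 * Real.pi * (((n - m).1 : ℤ) * x 0 + ((n - m).2 : ℤ) * x 1) := by
    intro x
    rw [inner_sub_left, inner_ξ a ha, inner_ξ a ha]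
    simp only [Prod.fst_sub, Prod.snd_sub, Int.cast_sub]
    ring
  simp_rw [h2]
  rw [integral_unitSquare_exp]
  simp only [sub_eq_zero, eq_comm (a := n)]
  split_ifs <;> simp

/-! ### Counting dual lattice points in discs -/

/-- The finite set of dual lattice points with level at most `R`. -/
def levelLE (a : ℝ) (ha : 0 < a) (k : Plane) (R : ℝ) : Finset (ℤ × ℤ) :=
  (finite_level_le a ha k R).toFinset

@[simp] theorem mem_levelLE {a : ℝ} {ha : 0 < a} {k : Plane} {R : ℝ} {m : ℤ × ℤ} :
    m ∈ levelLE a ha k R ↔ level a k m ≤ R := by simp [levelLE]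

theorem level_le_sq {a : ℝ} {k : Plane} {m : ℤ × ℤ} {r : ℝ} (hr : 0 ≤ r) :
    level a k m ≤ r ^ 2 ↔ ‖ξ a m + k‖ ≤ r := by
  rw [level, sq_le_sq₀ (norm_nonneg _) hr]

/-- The unit square with lower left corner `m`. -/
def latticeSquare (m : ℤ × ℤ) : Set Plane := {x | ⌊x 0⌋ = m.1 ∧ ⌊x 1⌋ = m.2}

theorem latticeSquare_eq (m : ℤ × ℤ) :
    latticeSquare m = (fun x : Plane => x + !₂[-(m.1 : ℝ), -(m.2 : ℝ)]) ⁻¹' unitSquare := by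
  ext x
  simp only [latticeSquare, unitSquare, Set.mem_preimage, Set.mem_ofPred_eq, Fin.forall_fin_two,
    Set.mem_Ico, Int.floor_eq_iff]
  simp
  constructor <;> rintro ⟨⟨h1, h2⟩, h3, h4⟩ <;> refine ⟨⟨?_, ?_⟩, ?_, ?_⟩ <;> linarith

theorem measurableSet_latticeSquare (m : ℤ × ℤ) : MeasurableSet (latticeSquare m) := by
  rw [latticeSquare_eq]
  exact (measurable_add_const _) measurableSet_unitSquare

theorem volume_latticeSquare (m : ℤ × ℤ) : volume (latticeSquare m) = 1 := by
  rw [latticeSquare_eq, measure_preimage_add_right, volume_unitSquare]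

/-- Gauss's device: lattice points are counted by the area of the disjoint unit squares attached to
them. -/
theorem volume_biUnion_latticeSquare (s : Finset (ℤ × ℤ)) :
    volume (⋃ m ∈ s, latticeSquare m) = s.card := by
  rw [measure_biUnion_finset _ fun m _ => measurableSet_latticeSquare m]
  · simp [volume_latticeSquare]
  · intro m _ n _ hmn
    refine Set.disjoint_left.2 fun x hx hy => hmn ?_
    exact Prod.ext (hx.1.symm.trans hy.1) (hx.2.symm.trans hy.2)

theorem frameMap_floor (a : ℝ) (x : Plane) :
    ‖frameMap (k₁ a) (k₂ a) x - ξ a (⌊x 0⌋, ⌊x 1⌋)‖ ≤ ‖k₁ a‖ + ‖k₂ a‖ := by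
  have : frameMap (k₁ a) (k₂ a) x - ξ a (⌊x 0⌋, ⌊x 1⌋) =
      Int.fract (x 0) • k₁ a + Int.fract (x 1) • k₂ a := by
    rw [frameMap_apply, ξ, Int.fract, Int.fract]
    module
  rw [this]
  refine (norm_add_le _ _).trans (add_le_add ?_ ?_) <;>
  · rw [norm_smul, Real.norm_of_nonneg (Int.fract_nonneg _)]
    exact mul_le_of_le_one_left (norm_nonneg _) (Int.fract_lt_one _).le

theorem volume_ellipse (a : ℝ) (ha : 0 < a) (k : Plane) (r : ℝ) (hr : 0 ≤ r) :
    volume {x : Plane | ‖frameMap (k₁ a) (k₂ a) x + k‖ ≤ r} =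
      ENNReal.ofReal (Real.pi * r ^ 2 / areaB a) := by
  have hB := areaB_pos a ha
  have hd := det_frameMap (k₁ a) (k₂ a)
  have hd0 : LinearMap.det (frameMap (k₁ a) (k₂ a) : Plane →ₗ[ℝ] Plane) ≠ 0 := by
    rw [hd]; exact abs_pos.1 hB
  have : {x : Plane | ‖frameMap (k₁ a) (k₂ a) x + k‖ ≤ r} =
      (frameMap (k₁ a) (k₂ a) : Plane →ₗ[ℝ] Plane) ⁻¹' Metric.closedBall (-k) r := by
    ext x; simp [dist_eq_norm]
  rw [this, Measure.addHaar_preimage_linearMap _ hd0, EuclideanSpace.volume_closedBall_fin_two,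
    abs_inv, hd, ← areaB, ← ENNReal.ofReal_pow hr,
    ← ENNReal.ofReal_mul (by positivity), ← ENNReal.ofReal_mul (by positivity)]
  congr 1
  field_simp

theorem card_levelLE_le (a : ℝ) (ha : 0 < a) (k : Plane) (r : ℝ) (hr : 0 ≤ r) :
    ((levelLE a ha k (r ^ 2)).card : ℝ) ≤
      Real.pi * (r + (‖k₁ a‖ + ‖k₂ a‖)) ^ 2 / areaB a := by
  have hB := areaB_pos a ha
  have hp := Real.pi_pos
  have h := volume_ellipse a ha k (r + (‖k₁ a‖ + ‖k₂ a‖)) (by positivity)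
  have h2 : volume (⋃ m ∈ levelLE a ha k (r ^ 2), latticeSquare m) ≤
      volume {x : Plane | ‖frameMap (k₁ a) (k₂ a) x + k‖ ≤ r + (‖k₁ a‖ + ‖k₂ a‖)} := by
    refine measure_mono fun x hx => ?_
    simp only [Set.mem_iUnion, mem_levelLE, level_le_sq hr] at hx
    obtain ⟨m, hm, hx⟩ := hx
    have := frameMap_floor a x
    rw [hx.1, hx.2] at this
    change ‖frameMap (k₁ a) (k₂ a) x + k‖ ≤ _
    calc _ = ‖(ξ a m + k) + (frameMap (k₁ a) (k₂ a) x - ξ a (m.1, m.2))‖ := by congr 1; abel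
      _ ≤ _ := (norm_add_le _ _).trans (add_le_add hm this)
  rw [h, volume_biUnion_latticeSquare] at h2
  rw [← ENNReal.ofReal_natCast] at h2
  exact (ENNReal.ofReal_le_ofReal_iff (by positivity)).1 h2

theorem le_card_levelLE (a : ℝ) (ha : 0 < a) (k : Plane) (r : ℝ) (hr : ‖k₁ a‖ + ‖k₂ a‖ ≤ r) :
    Real.pi * (r - (‖k₁ a‖ + ‖k₂ a‖)) ^ 2 / areaB a ≤ ((levelLE a ha k (r ^ 2)).card : ℝ) := by
  have hr0 : 0 ≤ r := le_trans (by positivity) hr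
  have h := volume_ellipse a ha k (r - (‖k₁ a‖ + ‖k₂ a‖)) (by linarith)
  have h2 : volume {x : Plane | ‖frameMap (k₁ a) (k₂ a) x + k‖ ≤ r - (‖k₁ a‖ + ‖k₂ a‖)} ≤
      volume (⋃ m ∈ levelLE a ha k (r ^ 2), latticeSquare m) := by
    refine measure_mono fun x hx => ?_
    change ‖frameMap (k₁ a) (k₂ a) x + k‖ ≤ _ at hx
    simp only [Set.mem_iUnion, mem_levelLE, level_le_sq hr0]
    refine ⟨(⌊x 0⌋, ⌊x 1⌋), ?_, rfl, rfl⟩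
    have := frameMap_floor a x
    rw [← norm_sub_rev] at this
    calc _ = ‖(frameMap (k₁ a) (k₂ a) x + k) +
          (ξ a (⌊x 0⌋, ⌊x 1⌋) - frameMap (k₁ a) (k₂ a) x)‖ := by congr 1; abel
      _ ≤ _ := norm_add_le _ _
      _ ≤ _ := by linarith
  rw [h, volume_biUnion_latticeSquare] at h2
  rw [← ENNReal.ofReal_natCast] at h2
  exact (ENNReal.ofReal_le_ofReal_iff (by positivity)).1 h2

/-- The union of the squares at the points of a disc lies between the images of the discs of radii r
± d, with d = |k₁| + |k₂|; the areas differ from the main term by O(r + 1). -/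
theorem exists_abs_card_sub_le (a : ℝ) (ha : 0 < a) (k : Plane) :
    ∃ K : ℝ, 0 ≤ K ∧ ∀ r : ℝ, 0 ≤ r →
      |((levelLE a ha k (r ^ 2)).card : ℝ) - Real.pi / areaB a * r ^ 2| ≤ K * (r + 1) := by
  have hB := areaB_pos a ha
  have hp := Real.pi_pos
  set d := ‖k₁ a‖ + ‖k₂ a‖ with hd
  have hd0 : 0 ≤ d := by positivity
  have hc : 0 < Real.pi / areaB a := by positivity
  refine ⟨Real.pi / areaB a * (2 * d + d ^ 2), by positivity, fun r hr => ?_⟩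
  have h1 := card_levelLE_le a ha k r hr
  rw [← hd, mul_div_right_comm] at h1
  rw [abs_le]
  constructor
  · by_cases h : d ≤ r
    · have h2 := le_card_levelLE a ha k r h
      rw [← hd, mul_div_right_comm] at h2
      have : -(2 * d + d ^ 2) * (r + 1) + r ^ 2 ≤ (r - d) ^ 2 := by
        nlinarith [mul_nonneg hd0 hr, mul_nonneg (sq_nonneg d) hr]
      nlinarith [mul_le_mul_of_nonneg_left this hc.le]
    -- For r < d there is no inner disc; the main term itself is then below the error bound.
    · have h2 : (0 : ℝ) ≤ ((levelLE a ha k (r ^ 2)).card : ℝ) := Nat.cast_nonneg _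
      have : -(2 * d + d ^ 2) * (r + 1) + r ^ 2 ≤ 0 := by
        nlinarith [mul_nonneg hd0 hr, mul_nonneg (sq_nonneg d) hr]
      nlinarith [mul_le_mul_of_nonneg_left this hc.le]
  · have : (r + d) ^ 2 - r ^ 2 ≤ (2 * d + d ^ 2) * (r + 1) := by
      nlinarith [mul_nonneg hd0 hr, mul_nonneg (sq_nonneg d) hr]
    nlinarith [mul_le_mul_of_nonneg_left this hc.le]

/-- An annulus of fixed width contains O(r) lattice points. -/
theorem exists_card_levelLE_sub_le (a : ℝ) (ha : 0 < a) (k : Plane) (d : ℝ) (hd : 0 ≤ d) :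
    ∃ K : ℝ, 0 ≤ K ∧ ∀ r : ℝ, d ≤ r →
      ((levelLE a ha k (r ^ 2)).card : ℝ) - (levelLE a ha k ((r - d) ^ 2)).card ≤
        K * (r + 1) := by
  obtain ⟨K, hK, h⟩ := exists_abs_card_sub_le a ha k
  have hB := areaB_pos a ha
  have hp := Real.pi_pos
  have hc : 0 < Real.pi / areaB a := by positivity
  refine ⟨2 * K + Real.pi / areaB a * (2 * d), by positivity, fun r hr => ?_⟩
  have h1 := (abs_le.1 (h r (hd.trans hr))).2
  have h2 := (abs_le.1 (h (r - d) (by linarith))).1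
  have h3 : r ^ 2 - (r - d) ^ 2 ≤ 2 * d * (r + 1) := by nlinarith
  nlinarith [mul_le_mul_of_nonneg_left h3 hc.le, mul_nonneg hK hd]

/-- The sum over discs of a character that is not invariant under a shift grows linearly. -/
theorem exists_norm_sum_shift_le (a : ℝ) (ha : 0 < a) (k : Plane) (e : ℤ × ℤ) (w : ℤ × ℤ → ℂ)
    (ζ : ℂ) (hζ : ζ ≠ 1) (hw : ∀ m, ‖w m‖ ≤ 1) (hs : ∀ m, w (m + e) = ζ * w m) :
    ∃ K : ℝ, 0 ≤ K ∧ ∀ r : ℝ, 0 ≤ r →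
      ‖∑ m ∈ levelLE a ha k (r ^ 2), w m‖ ≤ K * (r + 1) := by
  classical
  set d := ‖ξ a e‖ with hd
  obtain ⟨K, hK, h⟩ := exists_card_levelLE_sub_le a ha k d (norm_nonneg _)
  have hz : 0 < ‖ζ - 1‖ := norm_pos_iff.2 (sub_ne_zero.2 hζ)
  set M := ((levelLE a ha k (d ^ 2)).card : ℝ) with hM
  refine ⟨2 * K / ‖ζ - 1‖ + M, by positivity, fun r hr => ?_⟩
  have hξ : ∀ m, ξ a (m + e) = ξ a m + ξ a e := by
    intro m; simp only [ξ, Prod.fst_add, Prod.snd_add, Int.cast_add]; module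
  have hbound : ∀ s : Finset (ℤ × ℤ), ‖∑ m ∈ s, w m‖ ≤ s.card := by
    intro s
    refine (norm_sum_le _ _).trans ((Finset.sum_le_sum fun m _ => hw m).trans ?_)
    simp
  by_cases hdr : d ≤ r
  · set D := levelLE a ha k (r ^ 2) with hD
    set D' := D.map (addRightEmbedding e) with hD'
    -- Shifting the disc by e multiplies the sum by ζ, so (ζ - 1) times the sum lives on the
    -- symmetric difference of the disc and its shift. Its two halves have equal size, and `D \ D'`
    -- lies in an annulus of width d.
    have e1 : (ζ - 1) * ∑ m ∈ D, w m = ∑ m ∈ D', w m - ∑ m ∈ D, w m := by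
      rw [hD', Finset.sum_map]
      simp only [addRightEmbedding_apply, hs]
      rw [← Finset.mul_sum]
      ring
    have e2 : ∑ m ∈ D', w m - ∑ m ∈ D, w m = ∑ m ∈ D' \ D, w m - ∑ m ∈ D \ D', w m :=
      (Finset.sum_sdiff_sub_sum_sdiff).symm
    have e3 : (D' \ D).card = (D \ D').card := by
      have : D'.card = D.card := Finset.card_map _
      have h1 := Finset.card_sdiff_add_card_inter D' D
      have h2 := Finset.card_sdiff_add_card_inter D D'
      rw [Finset.inter_comm] at h2
      omega
    have hsub : levelLE a ha k ((r - d) ^ 2) ⊆ D := by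
      intro m hm
      rw [mem_levelLE] at hm ⊢
      refine hm.trans ?_
      have : 0 ≤ d := norm_nonneg _
      gcongr
      linarith
    have e4 : D \ D' ⊆ D \ levelLE a ha k ((r - d) ^ 2) := by
      refine Finset.sdiff_subset_sdiff le_rfl fun m hm => ?_
      rw [mem_levelLE, level_le_sq (by linarith)] at hm
      rw [hD', Finset.mem_map]
      refine ⟨m - e, ?_, by simp⟩
      rw [mem_levelLE, level_le_sq hr]
      have := hξ (m - e)
      rw [sub_add_cancel] at this
      calc ‖ξ a (m - e) + k‖ = ‖(ξ a m + k) - ξ a e‖ := by rw [this]; congr 1; abel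
        _ ≤ _ := norm_sub_le _ _
        _ ≤ r := by linarith
    have e5 : ((D \ D').card : ℝ) ≤ K * (r + 1) := by
      refine le_trans ?_ (h r hdr)
      have := Finset.card_le_card e4
      rw [Finset.card_sdiff_of_subset hsub] at this
      have h' := Finset.card_le_card hsub
      have : (D \ D').card + (levelLE a ha k ((r - d) ^ 2)).card ≤ D.card := by omega
      have : ((D \ D').card : ℝ) + (levelLE a ha k ((r - d) ^ 2)).card ≤ D.card := by
        exact_mod_cast this
      linarith
    have e6 : ‖ζ - 1‖ * ‖∑ m ∈ D, w m‖ ≤ 2 * K * (r + 1) := by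
      rw [← norm_mul, e1, e2]
      refine (norm_sub_le _ _).trans ?_
      have h1 := hbound (D' \ D)
      have h2 := hbound (D \ D')
      rw [e3] at h1
      linarith
    have e7 : ‖∑ m ∈ D, w m‖ ≤ 2 * K / ‖ζ - 1‖ * (r + 1) := by
      rw [div_mul_eq_mul_div, le_div_iff₀ hz]
      linarith
    have : 0 ≤ M * (r + 1) := by positivity
    linarith
  · have h1 : levelLE a ha k (r ^ 2) ⊆ levelLE a ha k (d ^ 2) := by
      intro m hm
      rw [mem_levelLE] at hm ⊢
      refine hm.trans ?_
      gcongr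
      linarith
    have h2 : ((levelLE a ha k (r ^ 2)).card : ℝ) ≤ M := by
      rw [hM]
      exact_mod_cast Finset.card_le_card h1
    have h3 : 0 ≤ 2 * K / ‖ζ - 1‖ * (r + 1) := by positivity
    have h4 : 0 ≤ M * r := by positivity
    have := hbound (levelLE a ha k (r ^ 2))
    linarith

/-! ### Convergence of sums from counting estimates -/

/-- The building block of partial summation in differential form. The truncated term has a kink at t
= l, hence only a right derivative. -/
theorem hasDerivWithinAt_inv_max (l x : ℝ) (hx : 0 ≤ x) :
    HasDerivWithinAt (fun t : ℝ => (((max t l + 1)⁻¹ : ℝ) : ℂ))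
      (if l ≤ x then -((((x + 1) ^ 2)⁻¹ : ℝ) : ℂ) else 0) (Set.Ici x) x := by
  split_ifs with h
  · have h1 : HasDerivAt (fun t : ℝ => (((t + 1)⁻¹ : ℝ) : ℂ))
        ((-(((x + 1) ^ 2)⁻¹) : ℝ) : ℂ) x := by
      have := ((hasDerivAt_id x).add_const 1).inv (by simp; linarith)
      refine HasDerivAt.ofReal_comp ?_
      refine HasDerivAt.congr_deriv this ?_
      simp only [id_eq]
      rw [neg_div, one_div]
    rw [Complex.ofReal_neg] at h1
    refine h1.hasDerivWithinAt.congr (fun t ht => ?_) (by rw [max_eq_left h])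
    rw [max_eq_left (h.trans ht)]
  · push Not at h
    refine HasDerivAt.hasDerivWithinAt ?_
    refine (hasDerivAt_const x ((((l + 1)⁻¹ : ℝ) : ℂ))).congr_of_eventuallyEq ?_
    filter_upwards [Iio_mem_nhds h] with t ht
    rw [max_eq_right (le_of_lt ht)]

/-- Partial summation phrased as a mean value inequality: up to boundary terms, the increment of the
partial sums is that of a function Φ whose right derivative at t is -(t+1)⁻² (Σ_{l ≤ t} w - c(t+1)).
This is O((t+1)^{-3/2}), so the partial sums are Cauchy. -/
theorem exists_tendsto_sum_div (ι : Type*) (l : ι → ℝ) (hl : ∀ m, 0 ≤ l m) (w : ι → ℂ)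
    (s : ℝ → Finset ι) (hs : ∀ R m, m ∈ s R ↔ l m ≤ R) (c : ℝ) (K : ℝ) (hK : 0 ≤ K)
    (h : ∀ R, 0 ≤ R → ‖∑ m ∈ s R, w m - c * (R + 1)‖ ≤ K * √(R + 1)) :
    ∃ L : ℂ, Tendsto (fun R : ℝ => ∑ m ∈ s R, w m * (((l m + 1)⁻¹ : ℝ) : ℂ) -
      ((c * Real.log (R + 1) : ℝ) : ℂ)) atTop (𝓝 L) := by
  classical
  set T : ℝ → ℂ := fun R => ∑ m ∈ s R, w m * (((l m + 1)⁻¹ : ℝ) : ℂ) -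
      ((c * Real.log (R + 1) : ℝ) : ℂ) with hT
  -- Of the constant 4, the variation of Φ takes 2 and the boundary terms at R and R' take 1 each.
  have key : ∀ R R' : ℝ, 0 ≤ R → R ≤ R' → ‖T R' - T R‖ ≤ 4 * K / √(R + 1) := by
    intro R R' hR hRR
    set Φ : ℝ → ℂ := fun t => ∑ m ∈ s R', w m * (((max t (l m) + 1)⁻¹ : ℝ) : ℂ) +
      ((c * Real.log (t + 1) : ℝ) : ℂ) with hΦ
    have hder : ∀ x, 0 ≤ x → HasDerivWithinAt Φ
        (∑ m ∈ s R', w m * (if l m ≤ x then -((((x + 1) ^ 2)⁻¹ : ℝ) : ℂ) else 0) +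
          ((c * (x + 1)⁻¹ : ℝ) : ℂ)) (Set.Ici x) x := by
      intro x hx
      refine HasDerivWithinAt.add (HasDerivWithinAt.fun_sum fun m _ =>
        (hasDerivWithinAt_inv_max (l m) x hx).const_mul _) ?_
      have h1 := (((hasDerivAt_id x).add_const 1).log (by simp; linarith)).const_mul c
      rw [one_div] at h1
      exact h1.ofReal_comp.hasDerivWithinAt
    -- The antiderivative of K(t+1)^{-3/2} that vanishes at t = R.
    have hB : ∀ x, 0 ≤ x → HasDerivAt (fun t : ℝ => 2 * K / √(R + 1) - 2 * K / √(t + 1))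
        (K / ((x + 1) * √(x + 1))) x := by
      intro x hx
      have hx1 : 0 < x + 1 := by linarith
      have hsq : 0 < √(x + 1) := Real.sqrt_pos.2 hx1
      have h1 := ((((hasDerivAt_id x).add_const 1).sqrt (by simp; linarith)).inv
        (by simp; exact hsq.ne')).const_mul (2 * K)
      have h2 := h1.const_sub (2 * K / √(R + 1))
      refine HasDerivAt.congr_deriv h2 ?_
      simp only [id_eq]
      rw [Real.sq_sqrt hx1.le]
      field_simp
    have hmain : ‖Φ R' - Φ R‖ ≤ 2 * K / √(R + 1) - 2 * K / √(R' + 1) := by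
      refine image_norm_le_of_norm_deriv_right_le_deriv_boundary' (a := R) (b := R')
        (f := fun t => Φ t - Φ R) (B := fun t => 2 * K / √(R + 1) - 2 * K / √(t + 1))
        (B' := fun x => K / ((x + 1) * √(x + 1)))
        (f' := fun x => ∑ m ∈ s R', w m * (if l m ≤ x then -((((x + 1) ^ 2)⁻¹ : ℝ) : ℂ) else 0) +
          ((c * (x + 1)⁻¹ : ℝ) : ℂ)) ?_ ?_ ?_ ?_ ?_ ?_ ⟨hRR, le_rfl⟩
      · refine ContinuousOn.sub (ContinuousOn.add (continuousOn_finsetSum _ fun m _ =>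
          continuousOn_const.mul ?_) ?_) continuousOn_const
        · refine Complex.continuous_ofReal.comp_continuousOn ?_
          refine ContinuousOn.inv₀ (by fun_prop) fun x hx => ?_
          have : l m ≤ max x (l m) := le_max_right _ _
          have := hl m
          linarith
        · refine Complex.continuous_ofReal.comp_continuousOn ?_
          refine continuousOn_const.mul (ContinuousOn.log (by fun_prop) fun x hx => ?_)
          have := hx.1
          linarith
      · intro x hx
        exact (hder x (hR.trans hx.1)).sub_const _
      · simp
      · exact fun x hx => (hB x (hR.trans hx.1)).continuousAt.continuousWithinAt
      · exact fun x hx => (hB x (hR.trans hx.1)).hasDerivWithinAt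
      · intro x hx
        have hx0 : 0 ≤ x := hR.trans hx.1
        have hx1 : 0 < x + 1 := by linarith
        have hsum : ∑ m ∈ s R', w m * (if l m ≤ x then -((((x + 1) ^ 2)⁻¹ : ℝ) : ℂ) else 0) =
            -((((x + 1) ^ 2)⁻¹ : ℝ) : ℂ) * ∑ m ∈ s x, w m := by
          have hfil : s x = (s R').filter fun m => l m ≤ x := by
            ext m
            rw [Finset.mem_filter, hs, hs]
            exact ⟨fun hm => ⟨hm.trans hx.2.le, hm⟩, fun hm => hm.2⟩
          rw [hfil, Finset.sum_filter, Finset.mul_sum]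
          refine Finset.sum_congr rfl fun m _ => ?_
          split_ifs <;> ring
        have e : ∑ m ∈ s R', w m * (if l m ≤ x then -((((x + 1) ^ 2)⁻¹ : ℝ) : ℂ) else 0) +
            ((c * (x + 1)⁻¹ : ℝ) : ℂ) =
            -((((x + 1) ^ 2)⁻¹ : ℝ) : ℂ) * (∑ m ∈ s x, w m - c * (x + 1)) := by
          rw [hsum]
          have : (x + 1 : ℂ) ≠ 0 := by exact_mod_cast hx1.ne'
          push_cast
          field_simp
          ring
        simp only [e]
        rw [norm_mul, norm_neg, Complex.norm_real, Real.norm_of_nonneg (by positivity)]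
        refine (mul_le_mul_of_nonneg_left (h x hx0) (by positivity)).trans (le_of_eq ?_)
        have hsq : 0 < √(x + 1) := Real.sqrt_pos.2 hx1
        have : √(x + 1) * √(x + 1) = x + 1 := Real.mul_self_sqrt hx1.le
        field_simp
        nlinarith
    have hR' : 0 ≤ R' := hR.trans hRR
    -- At t = R' every term is truncated; at t = R only those with l ≤ R are, and the others already
    -- have their true weight 1/(l+1).
    have e1 : Φ R' = (((R' + 1)⁻¹ : ℝ) : ℂ) * ∑ m ∈ s R', w m +
        ((c * Real.log (R' + 1) : ℝ) : ℂ) := by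
      simp only [hΦ]
      congr 1
      rw [Finset.mul_sum]
      refine Finset.sum_congr rfl fun m hm => ?_
      rw [max_eq_left ((hs _ _).1 hm), mul_comm]
    have hsub : s R ⊆ s R' := fun m hm => (hs _ _).2 (((hs _ _).1 hm).trans hRR)
    have e2 : Φ R = (((R + 1)⁻¹ : ℝ) : ℂ) * ∑ m ∈ s R, w m +
        (∑ m ∈ s R', w m * (((l m + 1)⁻¹ : ℝ) : ℂ) - ∑ m ∈ s R, w m * (((l m + 1)⁻¹ : ℝ) : ℂ)) +
        ((c * Real.log (R + 1) : ℝ) : ℂ) := by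
      simp only [hΦ]
      congr 1
      rw [← Finset.sum_sdiff hsub, ← Finset.sum_sdiff hsub, add_sub_cancel_right, add_comm,
        Finset.mul_sum]
      congr 1
      · refine Finset.sum_congr rfl fun m hm => ?_
        rw [max_eq_left ((hs _ _).1 hm), mul_comm]
      · refine Finset.sum_congr rfl fun m hm => ?_
        have : ¬ l m ≤ R := fun h' => (Finset.mem_sdiff.1 hm).2 ((hs _ _).2 h')
        rw [max_eq_right (not_le.1 this).le]
    have hE : ∀ x, 0 ≤ x → ‖(((x + 1)⁻¹ : ℝ) : ℂ) * ∑ m ∈ s x, w m - c‖ ≤ K / √(x + 1) := by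
      intro x hx
      have hx1 : 0 < x + 1 := by linarith
      have : (((x + 1)⁻¹ : ℝ) : ℂ) * ∑ m ∈ s x, w m - c =
          (((x + 1)⁻¹ : ℝ) : ℂ) * (∑ m ∈ s x, w m - c * (x + 1)) := by
        have : (x + 1 : ℂ) ≠ 0 := by exact_mod_cast hx1.ne'
        push_cast
        field_simp
      rw [this, norm_mul, Complex.norm_real, Real.norm_of_nonneg (by positivity)]
      refine (mul_le_mul_of_nonneg_left (h x hx) (by positivity)).trans (le_of_eq ?_)
      have hsq : 0 < √(x + 1) := Real.sqrt_pos.2 hx1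
      have : √(x + 1) * √(x + 1) = x + 1 := Real.mul_self_sqrt hx1.le
      field_simp
      nlinarith
    have e3 : T R' - T R = ((((R' + 1)⁻¹ : ℝ) : ℂ) * ∑ m ∈ s R', w m - c) -
        ((((R + 1)⁻¹ : ℝ) : ℂ) * ∑ m ∈ s R, w m - c) - (Φ R' - Φ R) := by
      rw [e1, e2]
      simp only [hT]
      ring
    rw [e3]
    refine (norm_sub_le _ _).trans ((add_le_add (norm_sub_le _ _) le_rfl).trans ?_)
    have h1 := hE R' hR'
    have h2 := hE R hR
    have h3 : K / √(R' + 1) ≤ K / √(R + 1) := by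
      have : 0 < √(R + 1) := Real.sqrt_pos.2 (by linarith)
      gcongr
    have h4 : 0 ≤ 2 * K / √(R' + 1) := by positivity
    have h5 : 2 * K / √(R + 1) = 2 * (K / √(R + 1)) := by ring
    have h6 : 4 * K / √(R + 1) = 4 * (K / √(R + 1)) := by ring
    linarith
  refine cauchySeq_tendsto_of_complete (Metric.cauchySeq_iff'.2 fun ε hε => ?_)
  have hlim : Tendsto (fun R : ℝ => 4 * K / √(R + 1)) atTop (𝓝 0) :=
    tendsto_const_nhds.div_atTop
      (Real.tendsto_sqrt_atTop.comp (tendsto_atTop_add_const_right _ _ tendsto_id))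
  obtain ⟨N, hN0, hN⟩ := ((eventually_ge_atTop (0 : ℝ)).and
    (hlim.eventually (Iio_mem_nhds hε))).exists
  refine ⟨N, fun n hn => ?_⟩
  rw [dist_eq_norm]
  exact (key N n hN0 hn).trans_lt hN

/-! ### The resolvent coefficients -/

/-- The coefficient `1 / (|ξ_m + k|² - z)`, with value `0` at the resonant indices. -/
def resCoeff (a : ℝ) (k : Plane) (z : ℂ) (m : ℤ × ℤ) : ℂ := ((level a k m : ℂ) - z)⁻¹

theorem exists_norm_resCoeff_le (a : ℝ) (ha : 0 < a) (k : Plane) (z : ℂ) :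
    ∃ C : ℝ, 0 ≤ C ∧ ∀ m, ‖resCoeff a k z m‖ ≤ C * (1 + level a k m)⁻¹ := by
  have hnn : ∀ m, 0 ≤ (1 + level a k m) * ‖resCoeff a k z m‖ := fun m => by
    have := level_nonneg a k m
    positivity
  set F := levelLE a ha k (2 * ‖z‖ + 1) with hF
  -- For levels above 2|z| + 1 one has |level - z| ≥ (1 + level)/2, so 2 suffices there; the
  -- finitely many remaining indices are absorbed by the sum.
  refine ⟨2 + ∑ m ∈ F, (1 + level a k m) * ‖resCoeff a k z m‖,
    add_nonneg (by norm_num) (Finset.sum_nonneg fun m _ => hnn m), fun m => ?_⟩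
  have hl := level_nonneg a k m
  have hl1 : 0 < 1 + level a k m := by linarith
  rw [← div_eq_mul_inv, le_div_iff₀ hl1, mul_comm]
  by_cases hm : m ∈ F
  · have := Finset.single_le_sum (f := fun m => (1 + level a k m) * ‖resCoeff a k z m‖)
      (fun m _ => hnn m) hm
    linarith
  · rw [hF, mem_levelLE, not_le] at hm
    have h0 : 0 ≤ ∑ m ∈ F, (1 + level a k m) * ‖resCoeff a k z m‖ :=
      Finset.sum_nonneg fun m _ => hnn m
    have h1 : (1 + level a k m) / 2 ≤ ‖(level a k m : ℂ) - z‖ := by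
      have := norm_sub_norm_le (level a k m : ℂ) z
      rw [Complex.norm_real, Real.norm_of_nonneg hl] at this
      linarith
    have h2 : (1 + level a k m) * ‖resCoeff a k z m‖ ≤ 2 := by
      rw [resCoeff, norm_inv, ← div_eq_mul_inv, div_le_iff₀ (by linarith)]
      linarith
    linarith

theorem summable_norm_resCoeff_sq (a : ℝ) (ha : 0 < a) (k : Plane) (z : ℂ) :
    Summable fun m => ‖resCoeff a k z m‖ ^ 2 := by
  obtain ⟨C, hC, h⟩ := exists_norm_resCoeff_le a ha k z
  refine Summable.of_nonneg_of_le (fun m => by positivity) (fun m => ?_)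
    ((summable_one_add_level_sq a ha k).mul_left (C ^ 2))
  calc _ ≤ (C * (1 + level a k m)⁻¹) ^ 2 := by gcongr; exact h m
    _ = _ := by rw [mul_pow, inv_pow]

theorem tendsto_resCoeff (a : ℝ) (ha : 0 < a) (k : Plane) (z : ℂ) :
    Tendsto (resCoeff a k z) cofinite (𝓝 0) := by
  rw [tendsto_zero_iff_norm_tendsto_zero]
  have := (summable_norm_resCoeff_sq a ha k z).tendsto_cofinite_zero.sqrt
  simpa [Real.sqrt_sq] using this

/-- By the resolvent identity the difference is a product of two coefficients, hence of order
level⁻², off finitely many indices. -/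
theorem summable_norm_resCoeff_sub (a : ℝ) (ha : 0 < a) (k : Plane) (z w : ℂ) :
    Summable fun m => ‖resCoeff a k z m - resCoeff a k w m‖ := by
  have h1 := summable_norm_resCoeff_sq a ha k z
  have h2 := summable_norm_resCoeff_sq a ha k w
  refine Summable.of_norm_bounded_eventually ((h1.add h2).mul_left ‖z - w‖) ?_
  refine Filter.mem_of_superset (finite_level_le a ha k (‖z‖ + ‖w‖)).compl_mem_cofinite
    fun m hm => ?_
  have hm : ‖z‖ + ‖w‖ < level a k m := not_le.1 hm
  have hne : ∀ u : ℂ, ‖u‖ < level a k m → (level a k m : ℂ) - u ≠ 0 := by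
    intro u hu h
    rw [sub_eq_zero] at h
    rw [← h, Complex.norm_real, Real.norm_of_nonneg (level_nonneg a k m)] at hu
    exact lt_irrefl _ hu
  have hz := hne z (by linarith [norm_nonneg w])
  have hw := hne w (by linarith [norm_nonneg z])
  have e : resCoeff a k z m - resCoeff a k w m =
      (z - w) * (resCoeff a k z m * resCoeff a k w m) := by
    simp only [resCoeff]
    field_simp
    ring
  change ‖‖resCoeff a k z m - resCoeff a k w m‖‖ ≤
    ‖z - w‖ * (‖resCoeff a k z m‖ ^ 2 + ‖resCoeff a k w m‖ ^ 2)
  rw [norm_norm, e, norm_mul, norm_mul]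
  gcongr
  nlinarith [sq_nonneg (‖resCoeff a k z m‖ - ‖resCoeff a k w m‖),
    mul_nonneg (norm_nonneg (resCoeff a k z m)) (norm_nonneg (resCoeff a k w m))]

theorem summable_planeWave_mul (a : ℝ) (k : Plane) (x : Plane) {f : ℤ × ℤ → ℂ}
    (hf : Summable fun m => ‖f m‖) : Summable fun m => planeWave a k m x * f m :=
  Summable.of_norm (by simpa using hf)

theorem tendsto_sum_levelLE (a : ℝ) (ha : 0 < a) (k : Plane) {f : ℤ × ℤ → ℂ} (hf : Summable f) :
    Tendsto (fun r : ℝ => ∑ m ∈ levelLE a ha k (r ^ 2), f m) atTop (𝓝 (∑' m, f m)) := by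
  have h1 : Tendsto (levelLE a ha k) atTop atTop := by
    refine tendsto_atTop_finset_of_monotone (fun R R' h m hm => ?_) fun m =>
      ⟨level a k m, by simp⟩
    rw [mem_levelLE] at hm ⊢
    exact hm.trans h
  exact hf.hasSum.comp (h1.comp (tendsto_pow_atTop two_ne_zero))

/-! ### Scatterer differences -/

theorem zero_mem_lattice (a : ℝ) : (0 : Plane) ∈ lattice a := ⟨0, 0, by simp⟩

theorem neg_mem_lattice {a : ℝ} {x : Plane} : -x ∈ lattice a ↔ x ∈ lattice a := by
  constructor <;> rintro ⟨p, q, h⟩ <;> refine ⟨-p, -q, ?_⟩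
  · rw [← neg_neg x, h]; push_cast; module
  · rw [h]; push_cast; module

theorem exp_shift_ne_one :
    Complex.exp (Complex.I * ((2 * Real.pi * (2 / 3) : ℝ) : ℂ)) ≠ 1 := by
  rw [Ne, Complex.exp_eq_one_iff]
  rintro ⟨n, hn⟩
  have h2 : (2 * Real.pi * Complex.I : ℂ) ≠ 0 := Complex.two_pi_I_ne_zero
  have h : ((2 * Real.pi * Complex.I) * (2 : ℂ)) = (2 * Real.pi * Complex.I) * ((3 * n : ℤ) : ℂ) := by
    push_cast at hn ⊢
    linear_combination 3 * hn
  have h' := mul_left_cancel₀ h2 h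
  have : (2 : ℤ) = 3 * n := by exact_mod_cast h'
  omega

/-- A step by k₁ turns the phase at x₀ by a primitive cube root of unity. This produces the
cancellation in sums at x₀, and also two plane waves with different phases there. -/
theorem planeWave_shift (a : ℝ) (ha : 0 < a) (k : Plane) (m : ℤ × ℤ) :
    planeWave a k (m + (1, 0)) (x₀ a) =
      Complex.exp (Complex.I * ((2 * Real.pi * (2 / 3) : ℝ) : ℂ)) * planeWave a k m (x₀ a) := by
  rw [planeWave, planeWave, ← Complex.exp_add, ← mul_add, ← Complex.ofReal_add]
  congr 3
  rw [inner_add_left, inner_add_left, inner_ξ_x₀ a ha, inner_ξ_x₀ a ha]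
  simp only [Prod.fst_add, Prod.snd_add, Int.cast_add, Int.cast_one, add_zero]
  ring

theorem x₀_notMem_lattice (a : ℝ) (ha : 0 < a) : x₀ a ∉ lattice a := by
  rintro ⟨p, q, h⟩
  have h1 := inner_ξ_x₀ a ha (1, 0)
  rw [h, inner_ξ a ha] at h1
  have h2 := mul_left_cancel₀ (by have := Real.pi_pos; positivity) h1
  simp only [Int.cast_one, Int.cast_zero, one_mul, zero_mul, add_zero, mul_one] at h2
  have : (3 * p : ℝ) = 2 := by linarith
  have : 3 * p = 2 := by exact_mod_cast this
  omega

-- A difference of scatterers is 0, where the sum counts points, or ±x₀, where it oscillates and has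
-- no main term. Here R stands for r², so the error O(r) becomes √(R+1).
open Classical in
theorem exists_norm_sum_planeWave_sub_le (a : ℝ) (ha : 0 < a) (k : Plane) (i j : Fin 2) :
    ∃ K : ℝ, 0 ≤ K ∧ ∀ R : ℝ, 0 ≤ R →
      ‖∑ m ∈ levelLE a ha k R, planeWave a k m (scatterer a i - scatterer a j) -
        ((if scatterer a i - scatterer a j ∈ lattice a then Real.pi / areaB a else 0 : ℝ) : ℂ) *
          (R + 1)‖ ≤ K * √(R + 1) := by
  have hsq : ∀ R : ℝ, 0 ≤ R → √R + 1 ≤ 2 * √(R + 1) ∧ 1 ≤ √(R + 1) := by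
    intro R hR
    have h1 : √R ≤ √(R + 1) := Real.sqrt_le_sqrt (by linarith)
    have h2 : 1 ≤ √(R + 1) := by rw [Real.one_le_sqrt]; linarith
    exact ⟨by linarith, h2⟩
  have hdiag : ∃ K : ℝ, 0 ≤ K ∧ ∀ R : ℝ, 0 ≤ R →
      ‖∑ m ∈ levelLE a ha k R, planeWave a k m 0 - ((Real.pi / areaB a : ℝ) : ℂ) * (R + 1)‖ ≤
        K * √(R + 1) := by
    obtain ⟨K, hK, h⟩ := exists_abs_card_sub_le a ha k
    have hc : 0 < Real.pi / areaB a := div_pos Real.pi_pos (areaB_pos a ha)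
    refine ⟨2 * K + Real.pi / areaB a, by positivity, fun R hR => ?_⟩
    have h1 := h (√R) (Real.sqrt_nonneg _)
    rw [Real.sq_sqrt hR] at h1
    have e : ∑ m ∈ levelLE a ha k R, planeWave a k m 0 - ((Real.pi / areaB a : ℝ) : ℂ) * (R + 1) =
        (((levelLE a ha k R).card - Real.pi / areaB a * R - Real.pi / areaB a : ℝ) : ℂ) := by
      simp
      ring
    rw [e, Complex.norm_real, Real.norm_eq_abs]
    obtain ⟨h3, h4⟩ := hsq R hR
    refine (abs_sub _ _).trans ?_
    rw [abs_of_pos hc]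
    nlinarith [mul_le_mul_of_nonneg_left h3 hK, mul_le_mul_of_nonneg_left h4 hc.le]
  have hoff : ∃ K : ℝ, 0 ≤ K ∧ ∀ R : ℝ, 0 ≤ R →
      ‖∑ m ∈ levelLE a ha k R, planeWave a k m (x₀ a)‖ ≤ K * √(R + 1) := by
    obtain ⟨K, hK, h⟩ := exists_norm_sum_shift_le a ha k (1, 0) (fun m => planeWave a k m (x₀ a)) _
      exp_shift_ne_one (fun m => by simp) (planeWave_shift a ha k)
    refine ⟨2 * K, by positivity, fun R hR => ?_⟩
    have h1 := h (√R) (Real.sqrt_nonneg _)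
    rw [Real.sq_sqrt hR] at h1
    obtain ⟨h3, h4⟩ := hsq R hR
    nlinarith [mul_le_mul_of_nonneg_left h3 hK]
  have hx := x₀_notMem_lattice a ha
  fin_cases i <;> fin_cases j
  · simpa [scatterer, zero_mem_lattice] using hdiag
  · simp only [scatterer, Fin.zero_eta, Fin.mk_one, Matrix.cons_val_zero, Matrix.cons_val_one,
      zero_sub, neg_mem_lattice, hx, if_false, Complex.ofReal_zero, zero_mul, sub_zero,
      planeWave_neg, ← map_sum, RCLike.norm_conj]
    exact hoff
  · simpa [scatterer, hx] using hoff
  · simpa [scatterer, zero_mem_lattice] using hdiag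

/-! ### The Green function -/

open Classical in
/-- The partial sums over discs whose limit is the Green function. -/
def greenPartial (a : ℝ) (k : Plane) (z : ℂ) (x : Plane) (r : ℝ) : ℂ :=
  ((1 / areaΓ a : ℝ) : ℂ) *
      ((∑ᶠ (m : ℤ × ℤ) (_ : ‖ξ a m + k‖ ≤ r),
          planeWave a k m x / (((‖ξ a m + k‖ ^ 2 : ℝ) : ℂ) - z)) -
        if x ∈ lattice a then ((2 * Real.pi / areaB a * Real.log r : ℝ) : ℂ) else 0)

theorem green_eq_limUnder (a : ℝ) (k : Plane) (z : ℂ) (x : Plane) :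
    green a k z x = limUnder atTop (greenPartial a k z x) := rfl

open Classical in
theorem greenPartial_eq (a : ℝ) (ha : 0 < a) (k : Plane) (z : ℂ) (x : Plane) {r : ℝ} (hr : 0 ≤ r) :
    greenPartial a k z x r = ((1 / areaΓ a : ℝ) : ℂ) *
      (∑ m ∈ levelLE a ha k (r ^ 2), planeWave a k m x * resCoeff a k z m -
        if x ∈ lattice a then ((2 * Real.pi / areaB a * Real.log r : ℝ) : ℂ) else 0) := by
  rw [greenPartial]
  congr 2
  have : ∀ m : ℤ × ℤ, ‖ξ a m + k‖ ≤ r ↔ m ∈ (levelLE a ha k (r ^ 2) : Set (ℤ × ℤ)) := by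
    intro m
    rw [Finset.mem_coe, mem_levelLE, level_le_sq hr]
  simp only [this]
  rw [finsum_mem_coe_finset]
  rfl

/-- Partial summation at R = r² subtracts a multiple of log(r² + 1), the Green function the same
multiple of 2 log r. -/
theorem tendsto_log_sq_add_one :
    Tendsto (fun r : ℝ => Real.log (r ^ 2 + 1) - 2 * Real.log r) atTop (𝓝 0) := by
  have h : Tendsto (fun r : ℝ => Real.log (1 + (r ^ 2)⁻¹)) atTop (𝓝 (Real.log (1 + 0))) := by
    refine Tendsto.log ?_ (by norm_num)
    exact tendsto_const_nhds.add (tendsto_inv_atTop_zero.comp (tendsto_pow_atTop two_ne_zero))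
  rw [add_zero, Real.log_one] at h
  refine h.congr' ?_
  filter_upwards [eventually_gt_atTop (0 : ℝ)] with r hr
  have : 1 + (r ^ 2)⁻¹ = (r ^ 2 + 1) / r ^ 2 := by field_simp
  rw [this, Real.log_div (by positivity) (by positivity), Real.log_pow]
  norm_num

theorem resCoeff_neg_one (a : ℝ) (k : Plane) (m : ℤ × ℤ) :
    resCoeff a k (-1) m = (((level a k m + 1)⁻¹ : ℝ) : ℂ) := by
  simp [resCoeff]

/-- At z = -1 the coefficients are exactly 1/(level + 1), so partial summation applies; passing to
another z adds an absolutely convergent series. L is common to all z, resonant ones included, and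
cancels in `green_sub_green`. -/
theorem exists_tendsto_greenPartial (a : ℝ) (ha : 0 < a) (k : Plane) (i j : Fin 2) :
    ∃ L : ℂ, ∀ z : ℂ, Tendsto (greenPartial a k z (scatterer a i - scatterer a j)) atTop
      (𝓝 (((1 / areaΓ a : ℝ) : ℂ) * (L + ∑' m, planeWave a k m (scatterer a i - scatterer a j) *
        (resCoeff a k z m - resCoeff a k (-1) m)))) := by
  classical
  obtain ⟨K, hK, h⟩ := exists_norm_sum_planeWave_sub_le a ha k i j
  set x := scatterer a i - scatterer a j with hx
  obtain ⟨L, hL⟩ := exists_tendsto_sum_div (ℤ × ℤ) (level a k) (level_nonneg a k)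
    (fun m => planeWave a k m x) (levelLE a ha k) (fun R m => mem_levelLE)
    (if x ∈ lattice a then Real.pi / areaB a else 0) K hK h
  refine ⟨L, fun z => ?_⟩
  have h1 := hL.comp (tendsto_pow_atTop (α := ℝ) two_ne_zero)
  have h2 := tendsto_sum_levelLE a ha k
    (summable_planeWave_mul a k x (summable_norm_resCoeff_sub a ha k z (-1)))
  have h3 : Tendsto (fun r : ℝ => (((if x ∈ lattice a then Real.pi / areaB a else 0) *
      (Real.log (r ^ 2 + 1) - 2 * Real.log r) : ℝ) : ℂ)) atTop (𝓝 0) := by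
    have := (tendsto_log_sq_add_one.const_mul
      (if x ∈ lattice a then Real.pi / areaB a else 0)).ofReal
    simpa using this
  have h4 := ((h1.add h3).add h2).const_mul ((1 / areaΓ a : ℝ) : ℂ)
  rw [add_zero] at h4
  refine h4.congr' ?_
  filter_upwards [eventually_ge_atTop (0 : ℝ)] with r hr
  rw [greenPartial_eq a ha k z x hr]
  congr 1
  simp only [Function.comp_apply, mul_sub, Finset.sum_sub_distrib, resCoeff_neg_one]
  split_ifs
  · push_cast
    ring
  · push_cast
    ring

theorem tendsto_greenPartial (a : ℝ) (ha : 0 < a) (k : Plane) (i j : Fin 2) (z : ℂ) :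
    Tendsto (greenPartial a k z (scatterer a i - scatterer a j)) atTop
      (𝓝 (green a k z (scatterer a i - scatterer a j))) := by
  obtain ⟨L, hL⟩ := exists_tendsto_greenPartial a ha k i j
  exact tendsto_nhds_limUnder ⟨_, hL z⟩

theorem green_sub_green (a : ℝ) (ha : 0 < a) (k : Plane) (i j : Fin 2) (z w : ℂ) :
    green a k z (scatterer a i - scatterer a j) - green a k w (scatterer a i - scatterer a j) =
      ((1 / areaΓ a : ℝ) : ℂ) * ∑' m, planeWave a k m (scatterer a i - scatterer a j) *
        (resCoeff a k z m - resCoeff a k w m) := by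
  obtain ⟨L, hL⟩ := exists_tendsto_greenPartial a ha k i j
  rw [green_eq_limUnder, green_eq_limUnder, (hL z).limUnder_eq, (hL w).limUnder_eq, ← mul_sub,
    add_sub_add_left_eq_sub, ← Summable.tsum_sub]
  · simp only [← mul_sub, sub_sub_sub_cancel_right]
  · exact summable_planeWave_mul a k _ (summable_norm_resCoeff_sub a ha k z (-1))
  · exact summable_planeWave_mul a k _ (summable_norm_resCoeff_sub a ha k w (-1))

theorem resCoeff_conj (a : ℝ) (k : Plane) (z : ℂ) (m : ℤ × ℤ) :
    resCoeff a k (conj z) m = conj (resCoeff a k z m) := by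
  simp [resCoeff]

theorem green_conj (a : ℝ) (ha : 0 < a) (k : Plane) (i j : Fin 2) (z : ℂ) :
    green a k (conj z) (scatterer a j - scatterer a i) =
      conj (green a k z (scatterer a i - scatterer a j)) := by
  classical
  have h1 := (Complex.continuous_conj.tendsto _).comp (tendsto_greenPartial a ha k i j z)
  refine tendsto_nhds_unique (tendsto_greenPartial a ha k j i (conj z)) (h1.congr' ?_)
  filter_upwards [eventually_ge_atTop (0 : ℝ)] with r hr
  rw [Function.comp_apply, greenPartial_eq a ha k _ _ hr, greenPartial_eq a ha k _ _ hr,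
    ← neg_sub (scatterer a i), map_mul, Complex.conj_ofReal, map_sub, map_sum]
  simp only [neg_mem_lattice, planeWave_neg, resCoeff_conj, map_mul, apply_ite conj,
    Complex.conj_ofReal, map_zero]

/-! ### Expansion in plane waves -/

/-- The (unnormalized) Fourier coefficient `(e^{i(ξ_m + k)·x}, f)`. -/
def waveCoeff (a : ℝ) (k : Plane) (f : L2 a) (m : ℤ × ℤ) : ℂ := inner ℂ (planeWaveL2 a k m) f

@[simp] theorem waveCoeff_add (a : ℝ) (k : Plane) (f g : L2 a) (m : ℤ × ℤ) :
    waveCoeff a k (f + g) m = waveCoeff a k f m + waveCoeff a k g m := inner_add_right _ _ _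

@[simp] theorem waveCoeff_sub (a : ℝ) (k : Plane) (f g : L2 a) (m : ℤ × ℤ) :
    waveCoeff a k (f - g) m = waveCoeff a k f m - waveCoeff a k g m := inner_sub_right _ _ _

@[simp] theorem waveCoeff_smul (a : ℝ) (k : Plane) (c : ℂ) (f : L2 a) (m : ℤ × ℤ) :
    waveCoeff a k (c • f) m = c * waveCoeff a k f m := inner_smul_right _ _ _

@[simp] theorem waveCoeff_sum (a : ℝ) (k : Plane) {ι : Type*} (s : Finset ι) (f : ι → L2 a)
    (m : ℤ × ℤ) : waveCoeff a k (∑ i ∈ s, f i) m = ∑ i ∈ s, waveCoeff a k (f i) m :=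
  inner_sum _ _ _

theorem waveCoeff_planeWaveL2 (a : ℝ) (ha : 0 < a) (k : Plane) (m n : ℤ × ℤ) :
    waveCoeff a k (planeWaveL2 a k n) m = if m = n then (areaΓ a : ℂ) else 0 :=
  inner_planeWaveL2 a ha k m n

theorem mem_floquetLaplacian {a : ℝ} {k : Plane} {φ χ : L2 a} :
    (φ, χ) ∈ floquetLaplacian a k ↔
      ∀ m, waveCoeff a k χ m = (level a k m : ℂ) * waveCoeff a k φ m := Iff.rfl

/-- The plane waves are total in `L²_k(Γ)`. -/
def WavesTotal (a : ℝ) (k : Plane) : Prop := ∀ f : L2 a, (∀ m, waveCoeff a k f m = 0) → f = 0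

theorem norm_planeWaveL2 (a : ℝ) (ha : 0 < a) (k : Plane) (m : ℤ × ℤ) :
    ‖planeWaveL2 a k m‖ = √(areaΓ a) := by
  rw [norm_eq_sqrt_re_inner (𝕜 := ℂ), inner_planeWaveL2 a ha]
  simp

section

variable {a : ℝ} {k : Plane}

theorem WavesTotal.ext (hT : WavesTotal a k) {f g : L2 a}
    (h : ∀ m, waveCoeff a k f m = waveCoeff a k g m) : f = g := by
  rw [← sub_eq_zero]
  exact hT _ fun m => by rw [waveCoeff_sub, h m, sub_self]

theorem WavesTotal.exists_hilbertBasis (hT : WavesTotal a k) (ha : 0 < a) :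
    ∃ b : HilbertBasis (ℤ × ℤ) ℂ (L2 a),
      ∀ m, b m = ((√(areaΓ a))⁻¹ : ℂ) • planeWaveL2 a k m := by
  have hA := areaΓ_pos a ha
  have hs : 0 < √(areaΓ a) := Real.sqrt_pos.2 hA
  have hon : Orthonormal ℂ fun m => ((√(areaΓ a))⁻¹ : ℂ) • planeWaveL2 a k m := by
    classical
    rw [orthonormal_iff_ite]
    intro m n
    rw [inner_smul_left, inner_smul_right, inner_planeWaveL2 a ha]
    split_ifs
    · rw [map_inv₀, Complex.conj_ofReal]
      have h1 : (√(areaΓ a) : ℂ) * √(areaΓ a) = areaΓ a := by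
        exact_mod_cast Real.mul_self_sqrt hA.le
      have h2 : (√(areaΓ a) : ℂ) ≠ 0 := by exact_mod_cast hs.ne'
      rw [← h1]
      field_simp
    · simp
  refine ⟨HilbertBasis.mkOfOrthogonalEqBot hon ?_, fun m => by
    rw [HilbertBasis.coe_mkOfOrthogonalEqBot]⟩
  rw [Submodule.eq_bot_iff]
  intro f hf
  refine hT f fun m => ?_
  have h1 := (Submodule.mem_orthogonal _ _).1 hf _ (Submodule.subset_span ⟨m, rfl⟩)
  simp only [inner_smul_left] at h1
  refine (mul_eq_zero.1 h1).resolve_left ?_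
  simp [hs.ne']

theorem WavesTotal.hasSum_conj_mul (hT : WavesTotal a k) (ha : 0 < a) (f g : L2 a) :
    HasSum (fun m => conj (waveCoeff a k f m) * waveCoeff a k g m) (areaΓ a * inner ℂ f g) := by
  obtain ⟨b, hb⟩ := hT.exists_hilbertBasis ha
  have hA := areaΓ_pos a ha
  have hs : (√(areaΓ a) : ℂ) ≠ 0 := by exact_mod_cast (Real.sqrt_pos.2 hA).ne'
  have h2 : (√(areaΓ a) : ℂ) * √(areaΓ a) = areaΓ a := by
    exact_mod_cast Real.mul_self_sqrt hA.le
  refine ((b.hasSum_inner_mul_inner f g).mul_left (areaΓ a : ℂ)).congr_fun fun m => ?_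
  rw [hb, inner_smul_left, inner_smul_right, waveCoeff, waveCoeff, inner_conj_symm, map_inv₀,
    Complex.conj_ofReal, ← h2]
  field_simp

theorem WavesTotal.hasSum_norm_sq (hT : WavesTotal a k) (ha : 0 < a) (f : L2 a) :
    HasSum (fun m => ‖waveCoeff a k f m‖ ^ 2) (areaΓ a * ‖f‖ ^ 2) := by
  have h := hT.hasSum_conj_mul ha f f
  rw [inner_self_eq_norm_sq_to_K] at h
  rw [← Complex.hasSum_ofReal]
  simp only [Complex.ofReal_mul, Complex.ofReal_pow]
  refine h.congr_fun fun m => ?_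
  rw [Complex.conj_mul']

theorem WavesTotal.summable_smul (hT : WavesTotal a k) (ha : 0 < a) {c : ℤ × ℤ → ℂ}
    (hc : Summable fun m => ‖c m‖ ^ 2) : Summable fun m => c m • planeWaveL2 a k m := by
  obtain ⟨b, hb⟩ := hT.exists_hilbertBasis ha
  have hA := areaΓ_pos a ha
  have hs : (√(areaΓ a) : ℂ) ≠ 0 := by exact_mod_cast (Real.sqrt_pos.2 hA).ne'
  have hmem : Memℓp (fun m => (√(areaΓ a) : ℂ) * c m) 2 := by
    rw [memℓp_gen_iff (by norm_num)]
    simp only [ENNReal.toReal_ofNat, Real.rpow_ofNat, norm_mul, mul_pow]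
    exact hc.mul_left _
  refine (b.hasSum_repr_symm ⟨_, hmem⟩).summable.congr fun m => ?_
  rw [hb, smul_smul]
  congr 1
  change (√(areaΓ a) : ℂ) * c m * _ = _
  field_simp

theorem waveCoeff_tsum (ha : 0 < a) {c : ℤ × ℤ → ℂ}
    (hc : Summable fun m => c m • planeWaveL2 a k m) (n : ℤ × ℤ) :
    waveCoeff a k (∑' m, c m • planeWaveL2 a k m) n = areaΓ a * c n := by
  have h := (hc.hasSum.mapL (innerSL ℂ (planeWaveL2 a k n)))
  refine h.unique ?_
  have := hasSum_ite_eq n ((areaΓ a : ℂ) * c n)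
  refine this.congr_fun fun m => ?_
  rw [innerSL_apply_apply, inner_smul_right, inner_planeWaveL2 a ha]
  split_ifs with h1 h2 h2
  · subst h1; ring
  · exact absurd h1.symm h2
  · exact absurd h2.symm h1
  · simp

theorem WavesTotal.waveCoeff_greenL2 (hT : WavesTotal a k) (ha : 0 < a) (z : ℂ) (y : Plane)
    (m : ℤ × ℤ) :
    waveCoeff a k (greenL2 a k z y) m = planeWave a k m (-y) * resCoeff a k z m := by
  have hA : (areaΓ a : ℂ) ≠ 0 := by exact_mod_cast (areaΓ_pos a ha).ne'
  rw [greenL2, waveCoeff_tsum ha (hT.summable_smul ha ?_)]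
  · rw [resCoeff, level]
    push_cast
    field_simp
  · refine ((summable_norm_resCoeff_sq a ha k z).mul_left (‖((1 / areaΓ a : ℝ) : ℂ)‖ ^ 2)).congr
      fun m => ?_
    simp only [norm_div, norm_mul, norm_planeWave, mul_one, resCoeff, level, norm_inv]
    ring

/-- Pairing with g_{z̄}(· - y) is evaluation at y of the free resolvent applied to f, as a Fourier
series. -/
theorem WavesTotal.hasSum_inner_greenL2 (hT : WavesTotal a k) (ha : 0 < a) (z : ℂ) (y : Plane)
    (f : L2 a) :
    HasSum (fun m => planeWave a k m y * (resCoeff a k z m * waveCoeff a k f m))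
      (areaΓ a * inner ℂ (greenL2 a k (conj z) y) f) := by
  refine (hT.hasSum_conj_mul ha _ f).congr_fun fun m => ?_
  rw [hT.waveCoeff_greenL2 ha, map_mul, ← planeWave_neg, neg_neg, resCoeff_conj, Complex.conj_conj,
    mul_assoc]

/-! ### Diagonal operators -/

theorem WavesTotal.norm_le_of_waveCoeff (hT : WavesTotal a k) (ha : 0 < a) {f g : L2 a} {C : ℝ}
    (hC : 0 ≤ C) (h : ∀ m, ‖waveCoeff a k g m‖ ≤ C * ‖waveCoeff a k f m‖) : ‖g‖ ≤ C * ‖f‖ := by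
  have hA := areaΓ_pos a ha
  have h1 : areaΓ a * ‖g‖ ^ 2 ≤ C ^ 2 * (areaΓ a * ‖f‖ ^ 2) := by
    refine hasSum_le (fun m => ?_) (hT.hasSum_norm_sq ha g) ((hT.hasSum_norm_sq ha f).mul_left _)
    rw [← mul_pow]
    gcongr
    exact h m
  have h2 : ‖g‖ ^ 2 ≤ (C * ‖f‖) ^ 2 := by
    rw [mul_pow]
    refine le_of_mul_le_mul_left ?_ hA
    linarith
  exact (sq_le_sq₀ (norm_nonneg _) (by positivity)).1 h2

theorem WavesTotal.exists_diagonal (hT : WavesTotal a k) (ha : 0 < a) {d : ℤ × ℤ → ℂ} {C : ℝ}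
    (hd : ∀ m, ‖d m‖ ≤ C) :
    ∃ T : L2 a →L[ℂ] L2 a, (∀ f m, waveCoeff a k (T f) m = d m * waveCoeff a k f m) ∧
      ‖T‖ ≤ C := by
  have hA : (areaΓ a : ℂ) ≠ 0 := by exact_mod_cast (areaΓ_pos a ha).ne'
  have hC : 0 ≤ C := (norm_nonneg _).trans (hd 0)
  have hsum : ∀ f : L2 a, Summable fun m =>
      ‖(areaΓ a : ℂ)⁻¹ * (d m * waveCoeff a k f m)‖ ^ 2 := by
    intro f
    refine Summable.of_nonneg_of_le (fun m => by positivity) (fun m => ?_)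
      ((hT.hasSum_norm_sq ha f).summable.mul_left (‖(areaΓ a : ℂ)⁻¹‖ ^ 2 * C ^ 2))
    rw [norm_mul, norm_mul, mul_pow, mul_pow, mul_assoc]
    gcongr
    exact hd m
  have hco : ∀ (f : L2 a) m, waveCoeff a k
      (∑' m, ((areaΓ a : ℂ)⁻¹ * (d m * waveCoeff a k f m)) • planeWaveL2 a k m) m =
      d m * waveCoeff a k f m := by
    intro f m
    rw [waveCoeff_tsum ha (hT.summable_smul ha (hsum f)), mul_inv_cancel_left₀ hA]
  let T₀ : L2 a →ₗ[ℂ] L2 a :=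
    { toFun := fun f => ∑' m, ((areaΓ a : ℂ)⁻¹ * (d m * waveCoeff a k f m)) • planeWaveL2 a k m
      map_add' := fun f g => hT.ext fun m => by
        rw [waveCoeff_add, hco, hco, hco, waveCoeff_add, mul_add]
      map_smul' := fun c f => hT.ext fun m => by
        rw [RingHom.id_apply, waveCoeff_smul, hco, hco, waveCoeff_smul]; ring }
  have hbound : ∀ f, ‖T₀ f‖ ≤ C * ‖f‖ := by
    intro f
    refine hT.norm_le_of_waveCoeff ha hC fun m => ?_
    have : waveCoeff a k (T₀ f) m = d m * waveCoeff a k f m := hco f m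
    rw [this, norm_mul]
    gcongr
    exact hd m
  exact ⟨T₀.mkContinuous C hbound, fun f m => hco f m, LinearMap.mkContinuous_norm_le _ hC _⟩

theorem isCompactOperator_smulRight {E F : Type*} [NormedAddCommGroup E] [NormedSpace ℂ E]
    [NormedAddCommGroup F] [NormedSpace ℂ F] (φ : E →L[ℂ] ℂ) (v : F) :
    IsCompactOperator (φ.smulRight v) := by
  have h := (isCompactOperator_id (E := ℂ)).comp_clm φ
  have h' := h.clm_comp ((ContinuousLinearMap.id ℂ ℂ).smulRight v)
  exact h'

theorem isCompactOperator_finset_sum {ι E F : Type*} [NormedAddCommGroup E] [NormedSpace ℂ E]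
    [NormedAddCommGroup F] [NormedSpace ℂ F] (s : Finset ι) (T : ι → E →L[ℂ] F)
    (h : ∀ i ∈ s, IsCompactOperator (T i)) : IsCompactOperator (∑ i ∈ s, T i : E →L[ℂ] F) := by
  classical
  induction s using Finset.induction_on with
  | empty => simpa using isCompactOperator_zero
  | insert i s hi ih =>
    rw [Finset.sum_insert hi]
    exact (h i (Finset.mem_insert_self _ _)).add
      (ih fun j hj => h j (Finset.mem_insert_of_mem hj))

/-- The operator is the norm limit of its finite truncations, which have finite rank. -/
theorem WavesTotal.isCompactOperator_of_diagonal (hT : WavesTotal a k) (ha : 0 < a)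
    {d : ℤ × ℤ → ℂ} (hd : Tendsto d cofinite (𝓝 0)) (T : L2 a →L[ℂ] L2 a)
    (hdT : ∀ f m, waveCoeff a k (T f) m = d m * waveCoeff a k f m) : IsCompactOperator T := by
  classical
  have hA : (areaΓ a : ℂ) ≠ 0 := by exact_mod_cast (areaΓ_pos a ha).ne'
  let S : Finset (ℤ × ℤ) → L2 a →L[ℂ] L2 a := fun s =>
    ∑ n ∈ s, (innerSL ℂ (planeWaveL2 a k n)).smulRight
      (((areaΓ a : ℂ)⁻¹ * d n) • planeWaveL2 a k n)
  have hS : ∀ s f m, waveCoeff a k (S s f) m = (if m ∈ s then d m else 0) * waveCoeff a k f m := by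
    intro s f m
    simp only [S, sum_apply, waveCoeff_sum,
      ContinuousLinearMap.smulRight_apply, waveCoeff_smul, waveCoeff_planeWaveL2 a ha,
      innerSL_apply_apply, mul_ite, mul_zero, Finset.sum_ite_eq, ite_mul, zero_mul]
    split_ifs
    · rw [← waveCoeff]
      field_simp
    · rfl
  refine isCompactOperator_of_tendsto (l := atTop) (F := S) ?_ (Eventually.of_forall fun s =>
    isCompactOperator_finset_sum _ _ fun n _ => isCompactOperator_smulRight _ _)
  rw [Metric.tendsto_atTop]
  intro ε hε
  have hfin : {m | ¬ ‖d m‖ < ε / 2}.Finite := by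
    have := (tendsto_zero_iff_norm_tendsto_zero.1 hd).eventually
      (Iio_mem_nhds (show (0 : ℝ) < ε / 2 by linarith))
    exact this
  refine ⟨hfin.toFinset, fun s hs => ?_⟩
  rw [dist_eq_norm]
  refine lt_of_le_of_lt (ContinuousLinearMap.opNorm_le_bound _ (by linarith : 0 ≤ ε / 2) fun f => ?_)
    (half_lt_self hε)
  refine hT.norm_le_of_waveCoeff ha (by linarith) fun m => ?_
  rw [sub_apply, waveCoeff_sub, hS, hdT, ← sub_mul, norm_mul]
  gcongr
  split_ifs with hm
  · rw [sub_self, norm_zero]; linarith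
  · rw [zero_sub, norm_neg]
    by_contra hcon
    refine hm (hs ?_)
    rw [Set.Finite.mem_toFinset]
    intro hlt
    exact hcon hlt.le

/-! ### Invertibility of the matrix `Γ` off the real axis -/

theorem hasSum_green_sub {a : ℝ} (ha : 0 < a) (k : Plane) (i j : Fin 2) (z w : ℂ) :
    HasSum (fun m => planeWave a k m (scatterer a i - scatterer a j) *
        (resCoeff a k z m - resCoeff a k w m))
      (areaΓ a * (green a k z (scatterer a i - scatterer a j) -
        green a k w (scatterer a i - scatterer a j))) := by
  have hA : (areaΓ a : ℂ) ≠ 0 := by exact_mod_cast (areaΓ_pos a ha).ne'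
  have h := (summable_planeWave_mul a k (scatterer a i - scatterer a j)
    (summable_norm_resCoeff_sub a ha k z w)).hasSum
  convert h using 1
  rw [green_sub_green a ha]
  push_cast
  field_simp

theorem planeWave_zero_ne_shift {a : ℝ} (ha : 0 < a) (k : Plane) :
    planeWave a k (0 + (1, 0)) (x₀ a) ≠ planeWave a k 0 (x₀ a) := by
  rw [planeWave_shift a ha]
  intro h
  exact exp_shift_ne_one (mul_right_cancel₀ (planeWave_ne_zero a k 0 (x₀ a)) (by rw [h, one_mul]))

theorem eq_zero_of_two_phases {u v p q : ℂ} (hpq : p ≠ q) (h1 : u + v * p = 0)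
    (h2 : u + v * q = 0) : u = 0 ∧ v = 0 := by
  have hv : v = 0 := by
    have : v * (p - q) = 0 := by linear_combination h1 - h2
    exact (mul_eq_zero.1 this).resolve_right (sub_ne_zero.2 hpq)
  exact ⟨by simpa [hv] using h1, hv⟩

/-- If Γ(z)v = 0, the form Q(z) = Σ v̄_j v_{j'} g_z(y_{j'} - y_j) equals α|v|² and is real. Up to a
positive factor its imaginary part is Im z times Σ_m |level - z|⁻² |Σ_j v_j e^{i(ξ_m+k)·y_j}|², so
every inner sum vanishes; two different phases at x₀ then give v = 0. -/
theorem isUnit_det_gammaMatrix {a : ℝ} (ha : 0 < a) (α : ℝ) (k : Plane) {z : ℂ}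
    (hz : z.im ≠ 0) : IsUnit (gammaMatrix a α k z).det := by
  rw [isUnit_iff_ne_zero]
  intro hdet
  obtain ⟨v, hv0, hv⟩ := Matrix.exists_mulVec_eq_zero_iff.2 hdet
  refine hv0 ?_
  have hrow : ∀ j, ∑ j', green a k z (scatterer a j' - scatterer a j) * v j' = α * v j := by
    intro j
    have := congrFun hv j
    simp only [Matrix.mulVec, dotProduct, gammaMatrix, Pi.zero_apply, sub_mul,
      Finset.sum_sub_distrib, ite_mul, zero_mul, Finset.sum_ite_eq, Finset.mem_univ, if_true] at this
    exact (sub_eq_zero.1 this).symm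
  set Q : ℂ → ℂ := fun z => ∑ j, ∑ j', conj (v j) * v j' *
    green a k z (scatterer a j' - scatterer a j) with hQ
  have hQ1 : Q z = ∑ j, α * (conj (v j) * v j) := by
    simp only [hQ]
    refine Finset.sum_congr rfl fun j _ => ?_
    rw [show α * (conj (v j) * v j) = conj (v j) * (α * v j) by ring, ← hrow j, Finset.mul_sum]
    exact Finset.sum_congr rfl fun j' _ => by ring
  have hQ2 : conj (Q z) = Q z := by
    rw [hQ1, map_sum]
    refine Finset.sum_congr rfl fun j _ => ?_
    simp only [map_mul, Complex.conj_ofReal, Complex.conj_conj]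
    ring
  have hQ3 : conj (Q z) = Q (conj z) := by
    simp only [hQ, map_sum]
    rw [Finset.sum_comm]
    refine Finset.sum_congr rfl fun j _ => Finset.sum_congr rfl fun j' _ => ?_
    rw [map_mul, map_mul, Complex.conj_conj, green_conj a ha]
    ring
  have hsum : HasSum (fun m => (resCoeff a k z m - resCoeff a k (conj z) m) *
      (conj (∑ j, v j * planeWave a k m (scatterer a j)) *
        ∑ j, v j * planeWave a k m (scatterer a j))) (areaΓ a * (Q z - Q (conj z))) := by
    have h := hasSum_sum (s := Finset.univ) fun (j : Fin 2) _ => hasSum_sum (s := Finset.univ)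
      fun (j' : Fin 2) _ => (hasSum_green_sub ha k j' j z (conj z)).mul_left (conj (v j) * v j')
    have e : areaΓ a * (Q z - Q (conj z)) = ∑ j : Fin 2, ∑ j' : Fin 2, conj (v j) * v j' *
        (areaΓ a * (green a k z (scatterer a j' - scatterer a j) -
          green a k (conj z) (scatterer a j' - scatterer a j))) := by
      simp only [hQ, Fin.sum_univ_two]
      ring
    rw [e]
    refine h.congr_fun fun m => ?_
    simp only [planeWave_sub, planeWave_neg, Fin.sum_univ_two, map_add, map_mul]
    ring
  rw [← hQ3, hQ2, sub_self, mul_zero] at hsum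
  have hzne : ∀ m, (level a k m : ℂ) - z ≠ 0 := by
    intro m h
    have := congrArg Complex.im h
    simp at this
    exact hz this
  have hsum2 : HasSum (fun m => (Complex.normSq (resCoeff a k z m) : ℝ) *
      Complex.normSq (∑ j, v j * planeWave a k m (scatterer a j))) 0 := by
    rw [← Complex.hasSum_ofReal]
    have hzz : z - conj z ≠ 0 := by
      intro h
      have := congrArg Complex.im h
      simp at this
      exact hz this
    have h := hsum.mul_left (z - conj z)⁻¹
    rw [mul_zero] at h
    refine h.congr_fun fun m => ?_
    push_cast
    rw [Complex.normSq_eq_conj_mul_self, Complex.normSq_eq_conj_mul_self, ← mul_assoc _ (_ - _)]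
    congr 1
    rw [← resCoeff_conj]
    simp only [resCoeff]
    have h1 := hzne m
    have h2 : (level a k m : ℂ) - conj z ≠ 0 := by
      intro h
      apply h1
      have := congrArg conj h
      simpa using this
    field_simp
    ring
  have hall := (hasSum_zero_iff_of_nonneg
    (fun m => mul_nonneg (Complex.normSq_nonneg _) (Complex.normSq_nonneg _))).1 hsum2
  have hs : ∀ m, v 0 + v 1 * planeWave a k m (x₀ a) = 0 := by
    intro m
    have h1 := congrFun hall m
    simp only [Pi.zero_apply, mul_eq_zero, Complex.normSq_eq_zero] at h1
    rcases h1 with h1 | h1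
    · exact absurd h1 (inv_ne_zero (hzne m))
    · simpa [Fin.sum_univ_two, scatterer] using h1
  obtain ⟨h0, h1⟩ := eq_zero_of_two_phases (planeWave_zero_ne_shift ha k) (hs _) (hs _)
  ext j
  fin_cases j
  · exact h0
  · exact h1

/-! ### The domain of the honeycomb operator in terms of sources -/

/-- The coefficient `∑_j q_j e^{-i(ξ_m + k)·y_j}` of point sources of strength `q_j` at `y_j`. -/
def sourceCoeff (a : ℝ) (k : Plane) (q : Fin 2 → ℂ) (m : ℤ × ℤ) : ℂ :=
  ∑ j, q j * planeWave a k m (-(scatterer a j))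

/-- `-Δ(k) ψ = η + ∑_j q_j δ_{y_j}` in terms of coefficients. -/
def HasSources (a : ℝ) (k : Plane) (ψ η : L2 a) (q : Fin 2 → ℂ) : Prop :=
  ∀ m, waveCoeff a k η m = level a k m * waveCoeff a k ψ m - sourceCoeff a k q m

/-- The boundary condition at the scatterers: `Γ(z)ᵀ q` is the vector of the values at the scatterers
of the part of `ψ` that is left after subtraction of `∑_j q_j g_z(· - y_j)`. -/
def BoundaryCondition (a α : ℝ) (k : Plane) (z : ℂ) (ψ : L2 a) (q : Fin 2 → ℂ) : Prop :=
  ∀ j, areaΓ a * (α * q j - ∑ j', green a k z (scatterer a j - scatterer a j') * q j') =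
    ∑' m, planeWave a k m (scatterer a j) *
      (waveCoeff a k ψ m - sourceCoeff a k q m * resCoeff a k z m)

end

section

variable {a : ℝ} {k : Plane}

/-- Off finitely many indices the summand is that of `hasSum_inner_greenL2` for f = η - zψ. Resonant
z is allowed. -/
theorem WavesTotal.summable_regular (hT : WavesTotal a k) (ha : 0 < a) {ψ η : L2 a}
    {q : Fin 2 → ℂ} (h : HasSources a k ψ η q) (z : ℂ) (y : Plane) :
    Summable fun m => planeWave a k m y *
      (waveCoeff a k ψ m - sourceCoeff a k q m * resCoeff a k z m) := by
  have h1 := (hT.hasSum_inner_greenL2 ha z y (η - z • ψ)).summable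
  have hfin : {m | level a k m = z.re}.Finite :=
    (finite_level_le a ha k z.re).subset fun m hm => le_of_eq hm
  refine (summable_congr_cofinite ?_).1 h1
  filter_upwards [hfin.compl_mem_cofinite] with m hm
  have hm' : (level a k m : ℂ) - z ≠ 0 := by
    intro h'
    apply hm
    have := congrArg Complex.re h'
    simp at this
    change level a k m = z.re
    linarith
  congr 1
  rw [waveCoeff_sub, waveCoeff_smul, h m, resCoeff]
  field_simp
  ring

/-- Passing from z to w changes the regular part of ψ by Σ q_j (g_z - g_w), which is also the change
of Γᵀq. This gives access to resonant z. -/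
theorem WavesTotal.boundaryCondition_iff (hT : WavesTotal a k) (ha : 0 < a) (α : ℝ) {ψ η : L2 a}
    {q : Fin 2 → ℂ} (h : HasSources a k ψ η q) (z w : ℂ) :
    BoundaryCondition a α k z ψ q ↔ BoundaryCondition a α k w ψ q := by
  refine forall_congr' fun j => ?_
  have key : ∑' m, planeWave a k m (scatterer a j) *
      (waveCoeff a k ψ m - sourceCoeff a k q m * resCoeff a k z m) -
      ∑' m, planeWave a k m (scatterer a j) *
      (waveCoeff a k ψ m - sourceCoeff a k q m * resCoeff a k w m) =
      -∑ j', q j' * (areaΓ a * (green a k z (scatterer a j - scatterer a j') -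
        green a k w (scatterer a j - scatterer a j'))) := by
    rw [← (hT.summable_regular ha h z _).tsum_sub (hT.summable_regular ha h w _)]
    refine HasSum.tsum_eq ?_
    refine (hasSum_sum (s := Finset.univ) fun (j' : Fin 2) _ =>
      (hasSum_green_sub ha k j j' z w).mul_left (q j')).neg.congr_fun fun m => ?_
    simp only [sourceCoeff, planeWave_sub, Fin.sum_univ_two]
    ring
  have e : ∀ u, areaΓ a * (α * q j - ∑ j', green a k u (scatterer a j - scatterer a j') * q j') =
      areaΓ a * (α * q j) - ∑ j', q j' * (areaΓ a * green a k u (scatterer a j - scatterer a j')) := by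
    intro u
    simp only [Fin.sum_univ_two]
    ring
  rw [e, e]
  simp only [mul_sub, Finset.sum_sub_distrib] at key ⊢
  constructor <;> intro h'
  · linear_combination h' + key
  · linear_combination h' - key

theorem sum_smul_gammaMatrix (α : ℝ) (z : ℂ) (q : Fin 2 → ℂ) (j : Fin 2) :
    ((gammaMatrix a α k z).transpose.mulVec q) j =
      α * q j - ∑ j', green a k z (scatterer a j - scatterer a j') * q j' := by
  simp [Matrix.mulVec, dotProduct, gammaMatrix, Matrix.transpose_apply, sub_mul,
    Finset.sum_sub_distrib]

theorem resolventCorrection_eq (α : ℝ) (z : ℂ) (f : L2 a) :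
    resolventCorrection a α k z f =
      ∑ j', ((gammaMatrix a α k z).transpose⁻¹.mulVec
        fun j => inner ℂ (greenL2 a k (conj z) (scatterer a j)) f) j' •
          greenL2 a k z (scatterer a j') := by
  rw [resolventCorrection, Finset.sum_comm]
  refine Finset.sum_congr rfl fun j' _ => ?_
  rw [← Finset.sum_smul, ← Matrix.transpose_nonsing_inv]
  rfl

theorem WavesTotal.waveCoeff_sum_greenL2 (hT : WavesTotal a k) (ha : 0 < a) (z : ℂ)
    (q : Fin 2 → ℂ) (m : ℤ × ℤ) :
    waveCoeff a k (∑ j, q j • greenL2 a k z (scatterer a j)) m =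
      sourceCoeff a k q m * resCoeff a k z m := by
  simp only [waveCoeff_sum, waveCoeff_smul, hT.waveCoeff_greenL2 ha, sourceCoeff, Finset.sum_mul,
    mul_assoc]

/-- With p_j = (g_{z̄}(· - y_j), f), Krein's correction is Σ q_j g_z(· - y_j) for q = (Γᵀ)⁻¹p. The
source equation is the coefficientwise form of ψ = φ + Σ q_j g_z(· - y_j), and the boundary
condition is Γᵀq = p. -/
theorem WavesTotal.isResolventAt_iff (hT : WavesTotal a k) (ha : 0 < a) (α : ℝ) {z : ℂ}
    (hz : ∀ m, (level a k m : ℂ) ≠ z) (hΓ : IsUnit (gammaMatrix a α k z).det) (ψ η : L2 a) :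
    IsResolventAt a α k z (η - z • ψ) ψ ↔
      ∃ q, HasSources a k ψ η q ∧ BoundaryCondition a α k z ψ q := by
  have hA : (areaΓ a : ℂ) ≠ 0 := by exact_mod_cast (areaΓ_pos a ha).ne'
  have hΓ' : IsUnit (gammaMatrix a α k z).transpose.det := by rwa [Matrix.det_transpose]
  set f := η - z • ψ with hf
  set p : Fin 2 → ℂ := fun j => inner ℂ (greenL2 a k (conj z) (scatterer a j)) f with hp
  have hz' : ∀ m, (level a k m : ℂ) - z ≠ 0 := fun m => sub_ne_zero.2 (hz m)
  have hreg : ∀ q, HasSources a k ψ η q → ∀ m,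
      waveCoeff a k ψ m - sourceCoeff a k q m * resCoeff a k z m =
        resCoeff a k z m * waveCoeff a k f m := by
    intro q hq m
    have := hz' m
    rw [hf, waveCoeff_sub, waveCoeff_smul, hq m, resCoeff]
    field_simp
    ring
  have hBC : ∀ q, HasSources a k ψ η q →
      (BoundaryCondition a α k z ψ q ↔ (gammaMatrix a α k z).transpose.mulVec q = p) := by
    intro q hq
    rw [BoundaryCondition, funext_iff]
    refine forall_congr' fun j => ?_
    simp only [hreg q hq]
    rw [(hT.hasSum_inner_greenL2 ha z (scatterer a j) f).tsum_eq, sum_smul_gammaMatrix]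
    exact mul_right_inj' hA
  constructor
  · rintro ⟨φ, hφ, hψ⟩
    rw [resolventCorrection_eq] at hψ
    set q := (gammaMatrix a α k z).transpose⁻¹.mulVec p with hq
    have hs : HasSources a k ψ η q := by
      intro m
      have h1 := mem_floquetLaplacian.1 hφ m
      rw [waveCoeff_add, waveCoeff_smul, hf, waveCoeff_sub, waveCoeff_smul] at h1
      have h2 : waveCoeff a k ψ m =
          waveCoeff a k φ m + sourceCoeff a k q m * resCoeff a k z m := by
        rw [← hT.waveCoeff_sum_greenL2 ha, ← waveCoeff_add, ← hψ]
      have h3 : ((level a k m : ℂ) - z) * resCoeff a k z m = 1 := mul_inv_cancel₀ (hz' m)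
      linear_combination h1 - ((level a k m : ℂ) - z) * h2 - sourceCoeff a k q m * h3
    refine ⟨q, hs, (hBC q hs).2 ?_⟩
    rw [hq, Matrix.mulVec_mulVec, Matrix.mul_nonsing_inv _ hΓ', Matrix.one_mulVec]
  · rintro ⟨q, hs, hbc⟩
    have hq : (gammaMatrix a α k z).transpose⁻¹.mulVec p = q := by
      rw [← (hBC q hs).1 hbc, Matrix.mulVec_mulVec, Matrix.nonsing_inv_mul _ hΓ', Matrix.one_mulVec]
    refine ⟨ψ - ∑ j, q j • greenL2 a k z (scatterer a j), ?_, ?_⟩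
    · rw [mem_floquetLaplacian]
      intro m
      rw [waveCoeff_add, waveCoeff_smul, waveCoeff_sub, hT.waveCoeff_sum_greenL2 ha, hreg q hs]
      have h3 : ((level a k m : ℂ) - z) * resCoeff a k z m = 1 := mul_inv_cancel₀ (hz' m)
      linear_combination -waveCoeff a k f m * h3
    · rw [resolventCorrection_eq, ← hp, hq, sub_add_cancel]

theorem level_ne_I (m : ℤ × ℤ) : (level a k m : ℂ) ≠ Complex.I := by
  intro h
  have := congrArg Complex.im h
  simp at this

/-- Γ is invertible at i, so this single point supplies the charges; the boundary condition then
moves to any w. -/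
theorem WavesTotal.mem_honeycombOperator_iff (hT : WavesTotal a k) (ha : 0 < a) (α : ℝ) (w : ℂ)
    (ψ η : L2 a) :
    (ψ, η) ∈ honeycombOperator a α k ↔
      ∃ q, HasSources a k ψ η q ∧ BoundaryCondition a α k w ψ q := by
  constructor
  · intro h
    have hΓ := isUnit_det_gammaMatrix ha α k (z := Complex.I) (by simp)
    obtain ⟨q, hq, hbc⟩ := (hT.isResolventAt_iff ha α level_ne_I hΓ ψ η).1 (h _ level_ne_I hΓ)
    exact ⟨q, hq, (hT.boundaryCondition_iff ha α hq _ _).1 hbc⟩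
  · rintro ⟨q, hq, hbc⟩ z hz hΓ
    exact (hT.isResolventAt_iff ha α hz hΓ ψ η).2 ⟨q, hq, (hT.boundaryCondition_iff ha α hq _ _).1 hbc⟩

/-! ### The eigenspace of the Floquet Laplacian -/

end

section

variable {a : ℝ} {k : Plane} {μ : ℕ}

/-- The element `∑_j c_j e^{i(ξ_{m_j} + k)·x}` of `L²_k(Γ)`, depending linearly on `c`. -/
def waveSum (a : ℝ) (k : Plane) (m : Fin μ → ℤ × ℤ) : (Fin μ → ℂ) →ₗ[ℂ] L2 a :=
  Fintype.linearCombination ℂ fun j => planeWaveL2 a k (m j)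

theorem waveSum_apply (m : Fin μ → ℤ × ℤ) (c : Fin μ → ℂ) :
    waveSum a k m c = ∑ j, c j • planeWaveL2 a k (m j) := Fintype.linearCombination_apply _ _ _

theorem waveCoeff_waveSum (ha : 0 < a) {m : Fin μ → ℤ × ℤ} (hm : Function.Injective m)
    (c : Fin μ → ℂ) (j : Fin μ) : waveCoeff a k (waveSum a k m c) (m j) = areaΓ a * c j := by
  classical
  simp [waveSum_apply, waveCoeff_planeWaveL2 a ha, hm.eq_iff, mul_comm]

theorem waveCoeff_waveSum_of_forall_ne (ha : 0 < a) {m : Fin μ → ℤ × ℤ}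
    (c : Fin μ → ℂ) {n : ℤ × ℤ} (hn : ∀ j, m j ≠ n) :
    waveCoeff a k (waveSum a k m c) n = 0 := by
  simp [waveSum_apply, waveCoeff_planeWaveL2 a ha, fun j => (hn j).symm]

theorem injective_waveSum (ha : 0 < a) {m : Fin μ → ℤ × ℤ} (hm : Function.Injective m) :
    Function.Injective (waveSum a k m) := by
  intro c d h
  ext j
  have hA : (areaΓ a : ℂ) ≠ 0 := by exact_mod_cast (areaΓ_pos a ha).ne'
  have := congrArg (fun f => waveCoeff a k f (m j)) h
  simp only [waveCoeff_waveSum ha hm] at this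
  exact mul_left_cancel₀ hA this

theorem mem_eigenspace_floquetLaplacian {lam : ℝ} {ψ : L2 a} :
    ψ ∈ eigenspace (floquetLaplacian a k) (lam : ℂ) ↔
      ∀ n, level a k n ≠ lam → waveCoeff a k ψ n = 0 := by
  change (ψ, (lam : ℂ) • ψ) ∈ floquetLaplacian a k ↔ _
  rw [mem_floquetLaplacian]
  refine forall_congr' fun n => ?_
  rw [waveCoeff_smul]
  constructor
  · intro h hn
    have h1 : ((level a k n : ℂ) - lam) * waveCoeff a k ψ n = 0 := by linear_combination -h
    refine (mul_eq_zero.1 h1).resolve_left (sub_ne_zero.2 ?_)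
    exact_mod_cast hn
  · intro h
    by_cases hn : level a k n = lam
    · rw [hn]
    · rw [h hn, mul_zero, mul_zero]

/-- A dimension count: a positive `finrank` forces the eigenspace to be finite-dimensional, and the
μ independent waves fill it. -/
theorem range_waveSum (ha : 0 < a) {lam : ℝ} (hμ : 0 < μ)
    (hmult : mult (lam : ℂ) (floquetLaplacian a k) = μ) {m : Fin μ → ℤ × ℤ}
    (hm : Function.Injective m) (hlam : ∀ j, level a k (m j) = lam) :
    LinearMap.range (waveSum a k m) = eigenspace (floquetLaplacian a k) (lam : ℂ) := by
  have hfin : Module.Finite ℂ (eigenspace (floquetLaplacian a k) (lam : ℂ)) := by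
    refine Module.finite_of_finrank_pos ?_
    rw [← mult, hmult]
    exact hμ
  refine Submodule.eq_of_le_of_finrank_eq ?_ ?_
  · rintro _ ⟨c, rfl⟩
    rw [mem_eigenspace_floquetLaplacian]
    intro n hn
    refine waveCoeff_waveSum_of_forall_ne ha c fun j hj => hn ?_
    rw [← hj, hlam]
  · rw [LinearMap.finrank_range_of_inj (injective_waveSum ha hm), ← mult, hmult]
    simp

theorem level_eq_iff_of_mult (ha : 0 < a) {lam : ℝ} (hμ : 0 < μ)
    (hmult : mult (lam : ℂ) (floquetLaplacian a k) = μ) {m : Fin μ → ℤ × ℤ}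
    (hm : Function.Injective m) (hlam : ∀ j, level a k (m j) = lam) (n : ℤ × ℤ) :
    level a k n = lam ↔ ∃ j, m j = n := by
  refine ⟨fun hn => ?_, fun ⟨j, hj⟩ => hj ▸ hlam j⟩
  by_contra! hne
  have h1 : planeWaveL2 a k n ∈ LinearMap.range (waveSum a k m) := by
    rw [range_waveSum ha hμ hmult hm hlam, mem_eigenspace_floquetLaplacian]
    intro l hl
    rw [waveCoeff_planeWaveL2 a ha, if_neg]
    rintro rfl
    exact hl hn
  obtain ⟨c, hc⟩ := h1
  have h2 := waveCoeff_waveSum_of_forall_ne (k := k) ha c hne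
  rw [hc, waveCoeff_planeWaveL2 a ha, if_pos rfl] at h2
  exact (areaΓ_pos a ha).ne' (by exact_mod_cast h2)

/-- A finite-dimensional eigenspace of the Floquet Laplacian leaves no room for functions that are
orthogonal to all plane waves. -/
theorem wavesTotal_of_mult (ha : 0 < a) {lam : ℝ} (hμ : 0 < μ)
    (hmult : mult (lam : ℂ) (floquetLaplacian a k) = μ) {m : Fin μ → ℤ × ℤ}
    (hm : Function.Injective m) (hlam : ∀ j, level a k (m j) = lam) : WavesTotal a k := by
  intro f hf
  have h1 : f ∈ LinearMap.range (waveSum a k m) := by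
    rw [range_waveSum ha hμ hmult hm hlam, mem_eigenspace_floquetLaplacian]
    exact fun n _ => hf n
  obtain ⟨c, rfl⟩ := h1
  have hc : c = 0 := by
    ext j
    have h2 := hf (m j)
    rw [waveCoeff_waveSum ha hm] at h2
    have hA : (areaΓ a : ℂ) ≠ 0 := by exact_mod_cast (areaΓ_pos a ha).ne'
    exact (mul_eq_zero.1 h2).resolve_left hA
  rw [hc, map_zero]

/-! ### Trigonometric sums with prescribed zeros -/

/-- The value of `∑_j c_j e^{i(ξ_{m_j} + k)·x}` at a point, as a linear functional of `c`. -/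
def trigEval (a : ℝ) (k : Plane) (m : Fin μ → ℤ × ℤ) (y : Plane) : (Fin μ → ℂ) →ₗ[ℂ] ℂ :=
  Fintype.linearCombination ℂ fun j => planeWave a k (m j) y

theorem trigEval_apply (m : Fin μ → ℤ × ℤ) (y : Plane) (c : Fin μ → ℂ) :
    trigEval a k m y c = trigSum a k m c y := Fintype.linearCombination_apply _ _ _

theorem coeFn_waveSum (m : Fin μ → ℤ × ℤ) (c : Fin μ → ℂ) :
    waveSum a k m c =ᵐ[volume.restrict (cell a)] trigSum a k m c := by
  rw [waveSum_apply]
  have h1 : ∀ j, (c j • planeWaveL2 a k (m j) : L2 a) =ᵐ[volume.restrict (cell a)]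
      fun x => c j * planeWave a k (m j) x := by
    intro j
    filter_upwards [Lp.coeFn_smul (c j) (planeWaveL2 a k (m j)),
      (memLp_planeWave a k (m j)).coeFn_toLp] with x hx hy
    rw [hx, Pi.smul_apply, planeWaveL2, hy, smul_eq_mul]
  filter_upwards [Lp.coeFn_fun_finsetSum Finset.univ fun j => c j • planeWaveL2 a k (m j),
    ae_all_iff.2 h1] with x hx hy
  rw [hx, trigSum]
  exact Finset.sum_congr rfl fun j _ => hy j

theorem mem_trigSpace {m : Fin μ → ℤ × ℤ} {Z : Set Plane} {u : L2 a} :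
    u ∈ trigSpace a k m Z ↔ ∃ c, (∀ y ∈ Z, trigSum a k m c y = 0) ∧ u = waveSum a k m c := by
  constructor
  · rintro ⟨c, hc, hu⟩
    exact ⟨c, hc, Lp.ext (hu.trans (coeFn_waveSum m c).symm)⟩
  · rintro ⟨c, hc, rfl⟩
    exact ⟨c, hc, coeFn_waveSum m c⟩

/-- The value at `y` of the resonant part of a function. -/
def resonantValue (a : ℝ) (k : Plane) (m : Fin μ → ℤ × ℤ) (ψ : L2 a) (y : Plane) : ℂ :=
  ∑ j, planeWave a k (m j) y * waveCoeff a k ψ (m j)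

theorem resonantValue_waveSum (ha : 0 < a) {m : Fin μ → ℤ × ℤ} (hm : Function.Injective m)
    (c : Fin μ → ℂ) (y : Plane) :
    resonantValue a k m (waveSum a k m c) y = areaΓ a * trigSum a k m c y := by
  simp only [resonantValue, waveCoeff_waveSum ha hm, trigSum, Finset.mul_sum]
  exact Finset.sum_congr rfl fun j _ => by ring

theorem WavesTotal.mem_trigSpace_iff (hT : WavesTotal a k) (ha : 0 < a) {m : Fin μ → ℤ × ℤ}
    (hm : Function.Injective m) {Z : Set Plane} {u : L2 a} :
    u ∈ trigSpace a k m Z ↔ (∀ n, (∀ j, m j ≠ n) → waveCoeff a k u n = 0) ∧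
      ∀ y ∈ Z, resonantValue a k m u y = 0 := by
  have hA : (areaΓ a : ℂ) ≠ 0 := by exact_mod_cast (areaΓ_pos a ha).ne'
  rw [mem_trigSpace]
  constructor
  · rintro ⟨c, hc, rfl⟩
    refine ⟨fun n hn => waveCoeff_waveSum_of_forall_ne ha c hn, fun y hy => ?_⟩
    rw [resonantValue_waveSum ha hm, hc y hy, mul_zero]
  · rintro ⟨h1, h2⟩
    have hu : u = waveSum a k m fun j => (areaΓ a : ℂ)⁻¹ * waveCoeff a k u (m j) := by
      refine hT.ext fun n => ?_
      by_cases hn : ∃ j, m j = n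
      · obtain ⟨j, rfl⟩ := hn
        rw [waveCoeff_waveSum ha hm, mul_inv_cancel_left₀ hA]
      · push Not at hn
        rw [h1 n hn, waveCoeff_waveSum_of_forall_ne ha _ hn]
    refine ⟨_, fun y hy => ?_, hu⟩
    have h3 := h2 y hy
    rw [hu, resonantValue_waveSum ha hm] at h3
    exact (mul_eq_zero.1 h3).resolve_left hA

theorem trigSpace_le_range (m : Fin μ → ℤ × ℤ) (Z : Set Plane) :
    trigSpace a k m Z ≤ LinearMap.range (waveSum a k m) := by
  intro u hu
  obtain ⟨c, -, rfl⟩ := mem_trigSpace.1 hu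
  exact ⟨c, rfl⟩

instance finite_trigSpace (m : Fin μ → ℤ × ℤ) (Z : Set Plane) :
    Module.Finite ℂ (trigSpace a k m Z) :=
  Submodule.finiteDimensional_of_le (trigSpace_le_range m Z)

theorem finrank_trigSpace_zero (ha : 0 < a) (hμ : 0 < μ) {m : Fin μ → ℤ × ℤ}
    (hm : Function.Injective m) : Module.finrank ℂ (trigSpace a k m {0}) + 1 = μ := by
  have h1 : trigSpace a k m {0} = (LinearMap.ker (trigEval a k m 0)).map (waveSum a k m) := by
    ext u
    rw [mem_trigSpace, Submodule.mem_map]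
    simp only [Set.mem_singleton_iff, forall_eq, LinearMap.mem_ker, trigEval_apply, eq_comm (a := u)]
  rw [h1, (LinearEquiv.finrank_eq (Submodule.equivMapOfInjective _ (injective_waveSum ha hm) _)).symm]
  have h2 := (trigEval a k m 0).finrank_range_add_finrank_ker
  have h3 : LinearMap.range (trigEval a k m 0) = ⊤ := by
    rw [LinearMap.range_eq_top]
    intro t
    refine ⟨Pi.single ⟨0, hμ⟩ t, ?_⟩
    simp [trigEval]
  rw [h3] at h2
  simp at h2
  omega

/-- Two waves with different phases already make joint evaluation at 0 and x₀ onto ℂ². -/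
theorem finrank_trigSpace_pair (ha : 0 < a) {m : Fin μ → ℤ × ℤ}
    (hm : Function.Injective m) {i j : Fin μ}
    (hij : planeWave a k (m i) (x₀ a) ≠ planeWave a k (m j) (x₀ a)) :
    Module.finrank ℂ (trigSpace a k m {0, x₀ a}) + 2 = μ := by
  set ev := (trigEval a k m 0).prod (trigEval a k m (x₀ a)) with hev
  have h1 : trigSpace a k m {0, x₀ a} = (LinearMap.ker ev).map (waveSum a k m) := by
    ext u
    rw [mem_trigSpace, Submodule.mem_map]
    simp only [Set.mem_insert_iff, Set.mem_singleton_iff, forall_eq_or_imp, forall_eq, hev,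
      LinearMap.mem_ker, LinearMap.prod_apply, Function.prod_apply, Prod.mk_eq_zero, trigEval_apply,
      eq_comm (a := u)]
  rw [h1, (LinearEquiv.finrank_eq (Submodule.equivMapOfInjective _ (injective_waveSum ha hm) _)).symm]
  have h2 := ev.finrank_range_add_finrank_ker
  have h3 : LinearMap.range ev = ⊤ := by
    rw [LinearMap.range_eq_top]
    rintro ⟨s, t⟩
    set p := planeWave a k (m i) (x₀ a)
    set q := planeWave a k (m j) (x₀ a)
    have hpq : p - q ≠ 0 := sub_ne_zero.2 hij
    -- Cramer's rule for c_i + c_j = s, p c_i + q c_j = t.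
    refine ⟨Pi.single i ((t - q * s) / (p - q)) + Pi.single j ((p * s - t) / (p - q)), ?_⟩
    have e0 : ev (Pi.single i ((t - q * s) / (p - q)) + Pi.single j ((p * s - t) / (p - q))) =
        ((t - q * s) / (p - q) + (p * s - t) / (p - q),
          (t - q * s) / (p - q) * p + (p * s - t) / (p - q) * q) := by
      rw [map_add]
      simp [hev, trigEval, p, q]
    rw [e0]
    refine Prod.ext ?_ ?_
    · simp only
      field_simp
      ring
    · simp only
      field_simp
      ring
  rw [h3] at h2
  simp at h2
  omega

/-! ### Resonant phases -/

theorem exp_ξ_eq (n : ℤ × ℤ) (x : Plane) :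
    planeWave a k n x = Complex.exp (Complex.I * ((inner ℝ k x : ℝ) : ℂ)) *
      Complex.exp (Complex.I * ((inner ℝ (ξ a n) x : ℝ) : ℂ)) := by
  rw [planeWave, ← Complex.exp_add, ← mul_add, ← Complex.ofReal_add, inner_add_left, add_comm]

/-- Equality in the triangle inequality for unit numbers, from the variance identity Σ_l |S - μu_l|²
= μ(μ² - |S|²). -/
theorem card_eq_norm_sum_iff (u : Fin μ → ℂ) (hu : ∀ j, ‖u j‖ = 1) :
    (μ : ℝ) = ‖∑ j, u j‖ ↔ ∀ i j, u i = u j := by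
  constructor
  · intro h i j
    have hμ : (0 : ℝ) < μ := by exact_mod_cast i.pos
    set S := ∑ j, u j with hS
    have hS0 : (∑ l, ‖S - μ * u l‖ ^ 2) = 0 := by
      have e : ∀ l, ‖S - μ * u l‖ ^ 2 = ‖S‖ ^ 2 + μ ^ 2 - 2 * μ * (conj S * u l).re := by
        intro l
        have h1 : ‖u l‖ ^ 2 = 1 := by rw [hu, one_pow]
        rw [Complex.sq_norm, Complex.normSq_apply] at h1
        rw [Complex.sq_norm, Complex.sq_norm, Complex.normSq_apply, Complex.normSq_apply]
        simp only [Complex.sub_re, Complex.sub_im, Complex.mul_re, Complex.mul_im,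
          Complex.natCast_re, Complex.natCast_im, Complex.conj_re, Complex.conj_im]
        linear_combination (μ : ℝ) ^ 2 * h1
      simp only [e, Finset.sum_sub_distrib, Finset.sum_const, ← Finset.mul_sum, Finset.card_univ,
        Fintype.card_fin, nsmul_eq_mul, ← Complex.re_sum]
      rw [← hS, ← Complex.normSq_eq_conj_mul_self, Complex.ofReal_re, ← Complex.sq_norm, ← h]
      ring
    have h2 : ∀ l, S = μ * u l := by
      intro l
      have := (Finset.sum_eq_zero_iff_of_nonneg fun l _ => by positivity).1 hS0 l (Finset.mem_univ _)
      simpa [sub_eq_zero] using this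
    have hμ' : (μ : ℂ) ≠ 0 := by exact_mod_cast hμ.ne'
    exact mul_left_cancel₀ hμ' ((h2 i).symm.trans (h2 j))
  · intro h
    rcases Nat.eq_zero_or_pos μ with rfl | hμ
    · simp
    · have : ∑ j, u j = ∑ _j : Fin μ, u ⟨0, hμ⟩ := Finset.sum_congr rfl fun j _ => h j _
      rw [this]
      simp [hu]

theorem card_eq_norm_sum_exp_iff (m : Fin μ → ℤ × ℤ) :
    (μ : ℝ) = ‖∑ j, Complex.exp (Complex.I * ((inner ℝ (ξ a (m j)) (x₀ a) : ℝ) : ℂ))‖ ↔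
      ∀ i j, planeWave a k (m i) (x₀ a) = planeWave a k (m j) (x₀ a) := by
  rw [card_eq_norm_sum_iff _ fun j => by rw [mul_comm, Complex.norm_exp_ofReal_mul_I]]
  simp only [exp_ξ_eq (k := k)]
  refine forall_congr' fun i => forall_congr' fun j => ?_
  exact (mul_right_inj' (Complex.exp_ne_zero _)).symm

/-! ### The eigenvalue equation of the honeycomb operator at a resonant level -/

/-- The boundary condition is read at z = λ'. Off resonance the source equation annihilates the
regular part; at resonance `resCoeff` is 0. The series thus collapses to the resonant part of ψ. -/
theorem WavesTotal.mem_eigenspace_iff (hT : WavesTotal a k) (ha : 0 < a) (α : ℝ) {lam : ℝ}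
    {m : Fin μ → ℤ × ℤ} (hm : Function.Injective m)
    (hlev : ∀ n, level a k n = lam ↔ ∃ j, m j = n) (ψ : L2 a) :
    ψ ∈ eigenspace (honeycombOperator a α k) (lam : ℂ) ↔
      ∃ q, (∀ n, ((level a k n : ℂ) - lam) * waveCoeff a k ψ n = sourceCoeff a k q n) ∧
        ∀ j, areaΓ a * (α * q j - ∑ j', green a k lam (scatterer a j - scatterer a j') * q j') =
          resonantValue a k m ψ (scatterer a j) := by
  classical
  change (ψ, (lam : ℂ) • ψ) ∈ honeycombOperator a α k ↔ _
  rw [hT.mem_honeycombOperator_iff ha α (lam : ℂ)]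
  refine exists_congr fun q => ?_
  have h1 : HasSources a k ψ ((lam : ℂ) • ψ) q ↔
      ∀ n, ((level a k n : ℂ) - lam) * waveCoeff a k ψ n = sourceCoeff a k q n := by
    refine forall_congr' fun n => ?_
    rw [waveCoeff_smul]
    constructor <;> intro h <;> linear_combination -h
  rw [h1]
  refine and_congr_right fun hq => forall_congr' fun j => ?_
  have h2 : ∑' n, planeWave a k n (scatterer a j) *
      (waveCoeff a k ψ n - sourceCoeff a k q n * resCoeff a k lam n) =
      resonantValue a k m ψ (scatterer a j) := by
    have h3 : ∀ n ∉ Finset.univ.map ⟨m, hm⟩, planeWave a k n (scatterer a j) *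
        (waveCoeff a k ψ n - sourceCoeff a k q n * resCoeff a k lam n) = 0 := by
      intro n hn
      have hne : level a k n ≠ lam := by
        rw [Ne, hlev]
        simpa using hn
      have hne' : (level a k n : ℂ) - lam ≠ 0 := sub_ne_zero.2 (by exact_mod_cast hne)
      rw [← hq n, resCoeff]
      field_simp
      ring
    rw [tsum_eq_sum h3, Finset.sum_map, resonantValue]
    refine Finset.sum_congr rfl fun i _ => ?_
    have : level a k (m i) = lam := (hlev _).2 ⟨i, rfl⟩
    simp [resCoeff, this]
  rw [h2]

theorem sourceCoeff_eq (q : Fin 2 → ℂ) (n : ℤ × ℤ) :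
    sourceCoeff a k q n = q 0 + q 1 * planeWave a k n (-x₀ a) := by
  simp [sourceCoeff, Fin.sum_univ_two, scatterer]

theorem planeWave_neg_inj {n n' : ℤ × ℤ} {x : Plane} :
    planeWave a k n (-x) = planeWave a k n' (-x) ↔ planeWave a k n x = planeWave a k n' x := by
  rw [planeWave_neg, planeWave_neg]
  exact (starRingEnd ℂ).injective.eq_iff

/-- The source equation at two resonant indices with different phases leaves no charges. -/
theorem WavesTotal.eigenspace_eq_of_ne (hT : WavesTotal a k) (ha : 0 < a) (α : ℝ) {lam : ℝ}
    {m : Fin μ → ℤ × ℤ} (hm : Function.Injective m)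
    (hlev : ∀ n, level a k n = lam ↔ ∃ j, m j = n) {i j : Fin μ}
    (hij : planeWave a k (m i) (x₀ a) ≠ planeWave a k (m j) (x₀ a)) :
    eigenspace (honeycombOperator a α k) (lam : ℂ) = trigSpace a k m {0, x₀ a} := by
  ext ψ
  rw [hT.mem_eigenspace_iff ha α hm hlev, hT.mem_trigSpace_iff ha hm]
  have hl : ∀ i, (level a k (m i) : ℂ) - lam = 0 := fun i => by
    rw [(hlev _).2 ⟨i, rfl⟩, sub_self]
  constructor
  · rintro ⟨q, hq, hbc⟩
    have h0 : ∀ i, q 0 + q 1 * planeWave a k (m i) (-x₀ a) = 0 := fun i => by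
      rw [← sourceCoeff_eq, ← hq, hl, zero_mul]
    obtain ⟨hq0, hq1⟩ := eq_zero_of_two_phases (planeWave_neg_inj.not.2 hij) (h0 i) (h0 j)
    refine ⟨fun n hn => ?_, ?_⟩
    · have h1 := hq n
      rw [sourceCoeff_eq, hq0, hq1, zero_mul, zero_add] at h1
      refine (mul_eq_zero.1 h1).resolve_left (sub_ne_zero.2 ?_)
      have : level a k n ≠ lam := by
        rw [Ne, hlev]; push Not; exact hn
      exact_mod_cast this
    · have hb0 := hbc 0
      have hb1 := hbc 1
      simp [Fin.sum_univ_two, hq0, hq1, scatterer] at hb0 hb1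
      simp [← hb0, ← hb1]
  · rintro ⟨h1, h2⟩
    refine ⟨0, fun n => ?_, fun j => ?_⟩
    · rw [sourceCoeff_eq]
      by_cases hn : ∃ i, m i = n
      · obtain ⟨i, rfl⟩ := hn
        rw [hl]; simp
      · push Not at hn
        rw [h1 n hn]; simp
    · have hb0 := h2 0 (by simp)
      have hb1 := h2 (x₀ a) (by simp)
      fin_cases j <;> simp [scatterer, hb0, hb1]

/-! ### Asymptotics of a bounded perturbation of a large real number -/

section Asymptotics

variable {ι : Type*} {F : Filter ι} {T : ι → ℂ} {s : ι → ℝ} {t : ℂ}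

/-- |T + s| - s = Re T + (Im T)² / (|T + s| + Re T + s), and the denominator tends to infinity. -/
theorem tendsto_norm_add_ofReal_sub (hT : Tendsto T F (𝓝 t)) (hs : Tendsto s F atTop) :
    Tendsto (fun x => ‖T x + s x‖ - s x) F (𝓝 t.re) := by
  have hre := (Complex.continuous_re.tendsto t).comp hT
  have him := (Complex.continuous_im.tendsto t).comp hT
  have hw : Tendsto (fun x => (T x).re + s x) F atTop := hre.add_atTop hs
  have hden : Tendsto (fun x => ‖T x + s x‖ + ((T x).re + s x)) F atTop :=
    tendsto_atTop_mono (fun x => le_add_of_nonneg_left (norm_nonneg _)) hw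
  have h := hre.add ((him.pow 2).div_atTop hden)
  rw [add_zero] at h
  refine h.congr' ?_
  filter_upwards [hden.eventually_gt_atTop 0] with x hx
  have h1 : ‖T x + s x‖ ^ 2 = ((T x).re + s x) ^ 2 + (T x).im ^ 2 := by
    rw [Complex.sq_norm, Complex.normSq_apply]
    simp
    ring
  simp only [Function.comp_apply]
  field_simp
  linear_combination -h1

theorem tendsto_ofReal_div_norm_add (hT : Tendsto T F (𝓝 t)) (hs : Tendsto s F atTop) :
    Tendsto (fun x => s x / ‖T x + s x‖) F (𝓝 1) := by
  have h := (((tendsto_norm_add_ofReal_sub hT hs).div_atTop hs).const_add 1).inv₀ (by norm_num)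
  rw [add_zero, inv_one] at h
  refine h.congr' ?_
  filter_upwards [hs.eventually_gt_atTop 0] with x hx
  rw [← inv_div]
  field_simp
  ring

theorem eventually_add_ofReal_ne_zero (hT : Tendsto T F (𝓝 t)) (hs : Tendsto s F atTop) :
    ∀ᶠ x in F, T x + s x ≠ 0 := by
  have hre := (Complex.continuous_re.tendsto t).comp hT
  filter_upwards [(hre.add_atTop hs).eventually_gt_atTop 0] with x hx h0
  have := congrArg Complex.re h0
  simp only [Complex.add_re, Complex.ofReal_re, Complex.zero_re] at this
  simp only [Function.comp_apply] at hx
  linarith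

/-- The expression equals (|T + s| - s - T̄) · s/|T + s|, with limit Re t - t̄ = i Im t. This is the
first-order term that survives in the limit of g̃₂. -/
theorem tendsto_one_sub_phase_mul (hT : Tendsto T F (𝓝 t)) (hs : Tendsto s F atTop) :
    Tendsto (fun x => (1 - conj (T x + s x) / (‖T x + s x‖ : ℂ)) * s x) F
      (𝓝 (Complex.I * t.im)) := by
  have h1 := (tendsto_norm_add_ofReal_sub hT hs).ofReal
  have h2 := (tendsto_ofReal_div_norm_add hT hs).ofReal
  have h3 := (Complex.continuous_conj.tendsto t).comp hT
  have h := (h1.sub h3).mul h2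
  have e : ((t.re : ℂ) - conj t) * ((1 : ℝ) : ℂ) = Complex.I * t.im := by
    apply Complex.ext <;> simp
  rw [e] at h
  refine h.congr' ?_
  filter_upwards [eventually_add_ofReal_ne_zero hT hs] with x hx
  have hn : (‖T x + s x‖ : ℂ) ≠ 0 := by exact_mod_cast norm_ne_zero_iff.2 hx
  simp only [Function.comp_apply, map_add, Complex.conj_ofReal, Complex.ofReal_sub,
    Complex.ofReal_div]
  field_simp
  ring

theorem tendsto_conj_phase (hT : Tendsto T F (𝓝 t)) (hs : Tendsto s F atTop) :
    Tendsto (fun x => conj (T x + s x) / (‖T x + s x‖ : ℂ)) F (𝓝 1) := by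
  have h1 := (tendsto_inv_atTop_zero.comp hs).ofReal
  have h := ((tendsto_one_sub_phase_mul hT hs).mul h1).const_sub 1
  simp only [Complex.ofReal_zero, mul_zero, sub_zero] at h
  refine h.congr' ?_
  filter_upwards [hs.eventually_gt_atTop 0] with x hx
  have : (s x : ℂ) ≠ 0 := by exact_mod_cast hx.ne'
  simp only [Function.comp_apply, Complex.ofReal_inv]
  field_simp
  ring

end Asymptotics

/-! ### The Green function near a resonant level -/

end

section

variable {a : ℝ} {k : Plane} {μ : ℕ}

/-- A bound uniform in n: once the pole is removed the difference is (z - λ') times a product of two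
coefficients, and the one at z is at most twice the one at λ'. -/
theorem exists_resCoeff_near_bound (ha : 0 < a) (k : Plane) (lam : ℝ) :
    ∃ D : ℤ × ℤ → ℝ, Summable D ∧ ∀ᶠ z : ℝ in 𝓝[<] lam, ∀ n,
      ‖resCoeff a k z n - resCoeff a k lam n -
        (if level a k n = lam then ((lam : ℂ) - z)⁻¹ else 0)‖ ≤ (lam - z) * D n := by
  obtain ⟨C, hC, hb⟩ := exists_norm_resCoeff_le a ha k lam
  refine ⟨fun n => 2 * ‖resCoeff a k lam n‖ ^ 2,
    (summable_norm_resCoeff_sq a ha k lam).mul_left 2, ?_⟩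
  -- Nonresonant levels stay at distance at least 1/(C + 1) from λ'; z is kept within half of that.
  have hlt : lam - 1 / (2 * (C + 1)) < lam := by
    have : 0 < 1 / (2 * (C + 1)) := by positivity
    linarith
  filter_upwards [Ioo_mem_nhdsLT hlt] with z hz n
  have hz0 : 0 < lam - z := sub_pos.2 hz.2
  split_ifs with hn
  · have : resCoeff a k z n - resCoeff a k lam n - ((lam : ℂ) - z)⁻¹ = 0 := by
      simp [resCoeff, hn]
    rw [this, norm_zero]
    positivity
  · have hd0 : 0 < |level a k n - lam| := abs_pos.2 (sub_ne_zero.2 hn)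
    have hκ : ‖resCoeff a k lam n‖ = |level a k n - lam|⁻¹ := by
      rw [resCoeff, norm_inv, ← Complex.ofReal_sub, Complex.norm_real, Real.norm_eq_abs]
    have hgap : |level a k n - lam|⁻¹ ≤ C + 1 := by
      rw [← hκ]
      refine (hb n).trans ?_
      have h1 := level_nonneg a k n
      have : (1 + level a k n)⁻¹ ≤ 1 := inv_le_one_of_one_le₀ (by linarith)
      nlinarith
    have hC1 : 0 < C + 1 := by linarith
    have h1 : 2 * (lam - z) ≤ |level a k n - lam| := by
      have h2 : (C + 1)⁻¹ ≤ |level a k n - lam| := by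
        rw [inv_le_comm₀ hC1 hd0]; exact hgap
      have h3 : lam - z < 1 / (2 * (C + 1)) := by linarith [hz.1]
      have h4 : 1 / (2 * (C + 1)) = (C + 1)⁻¹ / 2 := by field_simp
      linarith
    have h2 : |level a k n - lam| / 2 ≤ |level a k n - z| := by
      have := abs_sub_abs_le_abs_sub (level a k n - lam) (z - lam)
      rw [abs_sub_comm z lam, abs_of_pos hz0, sub_sub_sub_cancel_right] at this
      linarith
    have hne : (level a k n : ℂ) - lam ≠ 0 := sub_ne_zero.2 (by exact_mod_cast hn)
    have hne' : (level a k n : ℂ) - z ≠ 0 := by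
      rw [← Complex.ofReal_sub, Complex.ofReal_ne_zero]
      exact abs_pos.1 (by linarith)
    have e : resCoeff a k z n - resCoeff a k lam n - 0 =
        -((lam - z : ℝ) : ℂ) * (resCoeff a k z n * resCoeff a k lam n) := by
      simp only [resCoeff]
      push_cast
      field_simp
      ring
    rw [e, norm_mul, norm_neg, Complex.norm_real, Real.norm_of_nonneg hz0.le, norm_mul]
    refine mul_le_mul_of_nonneg_left ?_ hz0.le
    have h3 : ‖resCoeff a k z n‖ ≤ 2 * ‖resCoeff a k lam n‖ := by
      rw [hκ, resCoeff, norm_inv, ← Complex.ofReal_sub, Complex.norm_real, Real.norm_eq_abs,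
        inv_le_comm₀ (by linarith) (by positivity), mul_inv, inv_inv]
      linarith
    nlinarith [norm_nonneg (resCoeff a k lam n)]

theorem hasSum_resonant {lam : ℝ} {m : Fin μ → ℤ × ℤ} (hm : Function.Injective m)
    (hlev : ∀ n, level a k n = lam ↔ ∃ j, m j = n) {E : Type*} [AddCommMonoid E]
    [TopologicalSpace E] (f : ℤ × ℤ → E) :
    HasSum (fun n => if level a k n = lam then f n else 0) (∑ j, f (m j)) := by
  classical
  have h := hasSum_sum_of_ne_finset_zero (L := SummationFilter.unconditional _) (f := fun n => if level a k n = lam then f n else 0)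
    (s := Finset.univ.map ⟨m, hm⟩) fun n hn => by
      rw [if_neg]
      rw [hlev]
      simpa using hn
  rw [Finset.sum_map] at h
  convert h using 1
  refine Finset.sum_congr rfl fun j _ => ?_
  exact (if_pos ((hlev _).2 ⟨j, rfl⟩)).symm

theorem tendsto_sub_nhdsLT (lam : ℝ) (c : ℝ) :
    Tendsto (fun z : ℝ => c * (lam - z)) (𝓝[<] lam) (𝓝 0) := by
  have : Tendsto (fun z : ℝ => c * (lam - z)) (𝓝 lam) (𝓝 (c * (lam - lam))) :=
    Continuous.tendsto (by fun_prop) _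
  rw [sub_self, mul_zero] at this
  exact this.mono_left nhdsWithin_le_nhds

/-- The Laurent expansion at a resonant level: the residue carries the resonant phases, and the
constant term is `green` at the level itself. -/
theorem tendsto_green_sub (ha : 0 < a) {lam : ℝ} {m : Fin μ → ℤ × ℤ}
    (hm : Function.Injective m) (hlev : ∀ n, level a k n = lam ↔ ∃ j, m j = n) (i j : Fin 2) :
    Tendsto (fun z : ℝ => green a k z (scatterer a i - scatterer a j) -
      green a k lam (scatterer a i - scatterer a j) -
      (areaΓ a : ℂ)⁻¹ * ((∑ l, planeWave a k (m l) (scatterer a i - scatterer a j)) *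
        ((lam : ℂ) - z)⁻¹)) (𝓝[<] lam) (𝓝 0) := by
  have hA : (areaΓ a : ℂ) ≠ 0 := by exact_mod_cast (areaΓ_pos a ha).ne'
  obtain ⟨D, hD, hb⟩ := exists_resCoeff_near_bound ha k lam
  refine squeeze_zero_norm' ?_ (tendsto_sub_nhdsLT lam ((areaΓ a)⁻¹ * ∑' n, D n))
  filter_upwards [hb] with z hz
  set x := scatterer a i - scatterer a j
  have h1 := (hasSum_green_sub ha k i j z lam).sub (hasSum_resonant hm hlev
    fun n => planeWave a k n x * ((lam : ℂ) - z)⁻¹)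
  have h2 := h1.norm_le_of_bounded (hD.hasSum.mul_left (lam - z)) fun n => by
    refine le_trans (le_of_eq ?_) (hz n)
    have : planeWave a k n x * (resCoeff a k z n - resCoeff a k lam n) -
        (if level a k n = lam then planeWave a k n x * ((lam : ℂ) - z)⁻¹ else 0) =
        planeWave a k n x * (resCoeff a k z n - resCoeff a k lam n -
          (if level a k n = lam then ((lam : ℂ) - z)⁻¹ else 0)) := by
      split_ifs <;> ring
    rw [this, norm_mul, norm_planeWave, one_mul]
  have e : green a k z x - green a k lam x -
      (areaΓ a : ℂ)⁻¹ * ((∑ l, planeWave a k (m l) x) * ((lam : ℂ) - z)⁻¹) =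
      (areaΓ a : ℂ)⁻¹ * (areaΓ a * (green a k z x - green a k lam x) -
        ∑ l, planeWave a k (m l) x * ((lam : ℂ) - z)⁻¹) := by
    rw [← Finset.sum_mul]
    generalize ((lam : ℂ) - z)⁻¹ = w
    field_simp
  rw [e, norm_mul, norm_inv, Complex.norm_real, Real.norm_of_nonneg (areaΓ_pos a ha).le, mul_assoc,
    mul_comm (∑' n, D n)]
  exact mul_le_mul_of_nonneg_left h2 (inv_nonneg.2 (areaΓ_pos a ha).le)

theorem WavesTotal.hasSum_greenL2 (hT : WavesTotal a k) (ha : 0 < a) (z : ℂ) (y : Plane) :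
    HasSum (fun n => ((areaΓ a : ℂ)⁻¹ * (planeWave a k n (-y) * resCoeff a k z n)) •
      planeWaveL2 a k n) (greenL2 a k z y) := by
  have h : Summable fun n => ((areaΓ a : ℂ)⁻¹ * (planeWave a k n (-y) * resCoeff a k z n)) •
      planeWaveL2 a k n := by
    refine hT.summable_smul ha ?_
    simp only [norm_mul, norm_planeWave, one_mul, mul_pow]
    exact (summable_norm_resCoeff_sq a ha k z).mul_left _
  convert h.hasSum using 1
  rw [greenL2]
  congr 1
  ext1 n
  rw [resCoeff, level]
  push_cast
  congr 1
  rw [one_div, div_eq_mul_inv, mul_assoc]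

theorem WavesTotal.tendsto_greenL2_sub (hT : WavesTotal a k) (ha : 0 < a) {lam : ℝ}
    {m : Fin μ → ℤ × ℤ} (hm : Function.Injective m)
    (hlev : ∀ n, level a k n = lam ↔ ∃ j, m j = n) (y : Plane) :
    Tendsto (fun z : ℝ => greenL2 a k z y - greenL2 a k lam y -
      ∑ l, ((areaΓ a : ℂ)⁻¹ * (planeWave a k (m l) (-y) * ((lam : ℂ) - z)⁻¹)) •
        planeWaveL2 a k (m l)) (𝓝[<] lam) (𝓝 0) := by
  obtain ⟨D, hD, hb⟩ := exists_resCoeff_near_bound ha k lam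
  refine squeeze_zero_norm' ?_ (tendsto_sub_nhdsLT lam ((areaΓ a)⁻¹ * √(areaΓ a) * ∑' n, D n))
  filter_upwards [hb] with z hz
  have h1 := ((hT.hasSum_greenL2 ha z y).sub (hT.hasSum_greenL2 ha lam y)).sub
    (hasSum_resonant hm hlev fun n =>
      ((areaΓ a : ℂ)⁻¹ * (planeWave a k n (-y) * ((lam : ℂ) - z)⁻¹)) • planeWaveL2 a k n)
  refine (h1.norm_le_of_bounded (hD.hasSum.mul_left ((areaΓ a)⁻¹ * √(areaΓ a) * (lam - z)))
    fun n => ?_).trans (le_of_eq (by ring))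
  have : ((areaΓ a : ℂ)⁻¹ * (planeWave a k n (-y) * resCoeff a k z n)) • planeWaveL2 a k n -
      ((areaΓ a : ℂ)⁻¹ * (planeWave a k n (-y) * resCoeff a k lam n)) • planeWaveL2 a k n -
      (if level a k n = lam then
        ((areaΓ a : ℂ)⁻¹ * (planeWave a k n (-y) * ((lam : ℂ) - z)⁻¹)) • planeWaveL2 a k n else 0) =
      ((areaΓ a : ℂ)⁻¹ * (planeWave a k n (-y) * (resCoeff a k z n - resCoeff a k lam n -
          (if level a k n = lam then ((lam : ℂ) - z)⁻¹ else 0)))) • planeWaveL2 a k n := by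
    split_ifs <;> module
  rw [this, norm_smul, norm_mul, norm_mul, norm_planeWave, one_mul, norm_planeWaveL2 a ha, norm_inv,
    Complex.norm_real, Real.norm_of_nonneg (areaΓ_pos a ha).le]
  have h2 := mul_le_mul_of_nonneg_left (hz n)
    (show 0 ≤ (areaΓ a)⁻¹ * √(areaΓ a) by have := areaΓ_pos a ha; positivity)
  linarith

end

section

variable {a : ℝ} {k : Plane} {μ : ℕ}

/-! ### Resonant levels at which all phases coincide -/

/-- The limit of `g̃₂` at a resonant level with common phase `θ`. -/
def gLimit (a : ℝ) (k : Plane) (lam : ℝ) (m : Fin μ → ℤ × ℤ) (θ : ℂ) : L2 a :=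
  ((√2 : ℂ))⁻¹ • (greenL2 a k lam (x₀ a) - conj θ • greenL2 a k lam 0 +
    (conj θ * (Complex.I * ((conj θ * green a k lam (x₀ a)).im : ℂ)) * (μ : ℂ)⁻¹) •
      ∑ l, planeWaveL2 a k (m l))

/-- The critical coupling `lim (g_z(0) - |g_z(x₀)|)` at a resonant level with common phase `θ`. -/
def criticalCoupling (a : ℝ) (k : Plane) (lam : ℝ) (θ : ℂ) : ℝ :=
  (green a k lam 0).re - (conj θ * green a k lam (x₀ a)).re

theorem green_zero_eq_ofReal (ha : 0 < a) (lam : ℝ) :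
    green a k lam 0 = ((green a k lam 0).re : ℂ) := by
  have h := green_conj a ha k 0 0 lam
  rw [Complex.conj_ofReal, sub_self] at h
  exact (Complex.conj_eq_iff_re.1 h.symm).symm

theorem green_neg (ha : 0 < a) (lam : ℝ) :
    green a k lam (-x₀ a) = conj (green a k lam (x₀ a)) := by
  have h := green_conj a ha k 1 0 lam
  rw [Complex.conj_ofReal] at h
  simpa [scatterer] using h

theorem conj_mul_self_of_norm {θ : ℂ} (hθ : ‖θ‖ = 1) : conj θ * θ = 1 := by
  rw [Complex.conj_mul', hθ]
  norm_num

theorem tendsto_div_sub_atTop {c : ℝ} (hc : 0 < c) (lam : ℝ) :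
    Tendsto (fun z : ℝ => c * (lam - z)⁻¹) (𝓝[<] lam) atTop := by
  refine Tendsto.const_mul_atTop hc (tendsto_inv_nhdsGT_zero.comp ?_)
  refine tendsto_nhdsWithin_iff.2 ⟨?_, ?_⟩
  · simpa using tendsto_sub_nhdsLT lam 1
  · filter_upwards [self_mem_nhdsWithin] with z hz
    exact sub_pos.2 (Set.mem_Iio.1 hz)

section CommonPhase

variable {lam : ℝ} {m : Fin μ → ℤ × ℤ} {θ : ℂ}

/-- Rotation by θ̄ makes the pole real and positive, as the asymptotics of T + s require. -/
theorem tendsto_conj_phase_mul_green_sub (ha : 0 < a) (hm : Function.Injective m)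
    (hlev : ∀ n, level a k n = lam ↔ ∃ j, m j = n) (hθ1 : ‖θ‖ = 1)
    (hθ : ∀ j, planeWave a k (m j) (x₀ a) = θ) :
    Tendsto (fun z : ℝ => conj θ * green a k z (x₀ a) -
      ((μ * (areaΓ a)⁻¹ * (lam - z)⁻¹ : ℝ) : ℂ)) (𝓝[<] lam)
      (𝓝 (conj θ * green a k lam (x₀ a))) := by
  have h := tendsto_green_sub ha hm hlev (k := k) 1 0
  simp only [scatterer, Matrix.cons_val_one, Matrix.cons_val_zero, sub_zero, hθ, Finset.sum_const,
    Finset.card_univ, Fintype.card_fin, nsmul_eq_mul] at h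
  have h2 := (h.const_mul (conj θ)).add_const (conj θ * green a k lam (x₀ a))
  rw [mul_zero, zero_add] at h2
  refine h2.congr fun z => ?_
  have e := conj_mul_self_of_norm hθ1
  push_cast
  linear_combination -((μ : ℂ) * (areaΓ a : ℂ)⁻¹ * ((lam : ℂ) - z)⁻¹) * e

theorem norm_green_eq (hθ1 : ‖θ‖ = 1) (z : ℂ) (s : ℝ) :
    ‖(conj θ * green a k z (x₀ a) - s) + s‖ = ‖green a k z (x₀ a)‖ := by
  rw [sub_add_cancel, norm_mul, RCLike.norm_conj, hθ1, one_mul]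

/-- Both terms diverge like μ/(area Γ (λ' - z)); the constants left over are g_{λ'}(0) and Re(θ̄
g_{λ'}(x₀)). -/
theorem tendsto_green_zero_sub_norm (ha : 0 < a) (hμ : 0 < μ) (hm : Function.Injective m)
    (hlev : ∀ n, level a k n = lam ↔ ∃ j, m j = n) (hθ1 : ‖θ‖ = 1)
    (hθ : ∀ j, planeWave a k (m j) (x₀ a) = θ) :
    Tendsto (fun z : ℝ => green a k (z : ℂ) 0 - (‖green a k (z : ℂ) (x₀ a)‖ : ℂ))
      (𝓝[<] lam) (𝓝 (criticalCoupling a k lam θ : ℂ)) := by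
  have hs := tendsto_div_sub_atTop
    (show 0 < (μ : ℝ) * (areaΓ a)⁻¹ by have := areaΓ_pos a ha; positivity) lam
  have hT := tendsto_conj_phase_mul_green_sub ha hm hlev hθ1 hθ
  have h1 := (tendsto_norm_add_ofReal_sub hT hs).ofReal
  have h0 := tendsto_green_sub ha hm hlev (k := k) 0 0
  simp only [sub_self, planeWave_zero, Finset.sum_const, Finset.card_univ, Fintype.card_fin,
    nsmul_eq_mul, mul_one] at h0
  have h2 := (h0.add_const (green a k lam 0)).sub h1
  rw [zero_add, green_zero_eq_ofReal ha, ← Complex.ofReal_sub] at h2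
  refine h2.congr fun z => ?_
  rw [norm_green_eq hθ1, ← green_zero_eq_ofReal ha]
  push_cast
  ring

theorem gTilde₂_eq {z : ℂ} (hz : green a k z (x₀ a) ≠ 0) :
    gTilde₂ a k z = ((√2 : ℂ))⁻¹ • (greenL2 a k z (x₀ a) -
      (conj (green a k z (x₀ a)) / (‖green a k z (x₀ a)‖ : ℂ)) • greenL2 a k z 0) := by
  rw [gTilde₂, unitaryU, if_neg hz]
  simp only [Fin.sum_univ_two, scatterer, Matrix.conjTranspose_apply, Matrix.smul_apply]
  simp
  module

/-- Writing the phase of the conjugate of g_z(x₀) as θ̄v with v → 1, the resonant parts of the two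
Green functions combine to θ̄(1 - v)(s/μ) Σ_l e^{i(ξ_{m_l}+k)·x}, and (1 - v)s has a finite limit.
-/
theorem WavesTotal.tendsto_gTilde₂ (hT : WavesTotal a k) (ha : 0 < a) (hμ : 0 < μ)
    (hm : Function.Injective m) (hlev : ∀ n, level a k n = lam ↔ ∃ j, m j = n) (hθ1 : ‖θ‖ = 1)
    (hθ : ∀ j, planeWave a k (m j) (x₀ a) = θ) :
    Tendsto (fun z : ℝ => gTilde₂ a k (z : ℂ)) (𝓝[<] lam) (𝓝 (gLimit a k lam m θ)) := by
  have hs := tendsto_div_sub_atTop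
    (show 0 < (μ : ℝ) * (areaΓ a)⁻¹ by have := areaΓ_pos a ha; positivity) lam
  have hTT := tendsto_conj_phase_mul_green_sub ha hm hlev hθ1 hθ
  have hθ' : ∀ j, planeWave a k (m j) (-x₀ a) = conj θ := fun j => by rw [planeWave_neg, hθ]
  have hP1 := hT.tendsto_greenL2_sub ha hm hlev (x₀ a)
  have hP0 := hT.tendsto_greenL2_sub ha hm hlev 0
  simp only [hθ', neg_zero, planeWave_zero, one_mul, ← Finset.smul_sum] at hP1 hP0
  have hv := tendsto_conj_phase hTT hs
  have hvs := tendsto_one_sub_phase_mul hTT hs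
  have h1 := (hP1.add_const (greenL2 a k lam (x₀ a))).sub
    ((hv.const_mul (conj θ)).smul (hP0.add_const (greenL2 a k lam 0)))
  have h2 := (((hvs.const_mul (conj θ)).mul_const (μ : ℂ)⁻¹).smul_const
    (∑ l, planeWaveL2 a k (m l)))
  have h := (h1.add h2).const_smul ((√2 : ℂ))⁻¹
  rw [zero_add, zero_add, mul_one] at h
  refine h.congr' ?_
  filter_upwards [eventually_add_ofReal_ne_zero hTT hs] with z hz
  have hg : green a k z (x₀ a) ≠ 0 := by
    rintro h0
    rw [sub_add_cancel, h0, mul_zero] at hz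
    exact hz rfl
  rw [gTilde₂_eq hg, norm_green_eq hθ1]
  have hμ' : (μ : ℂ) ≠ 0 := by exact_mod_cast hμ.ne'
  have e := conj_mul_self_of_norm hθ1
  set n : ℂ := (‖green a k z (x₀ a)‖ : ℂ)
  have hc : conj (conj θ * green a k z (x₀ a) - ((μ * (areaΓ a)⁻¹ * (lam - z)⁻¹ : ℝ) : ℂ) +
      ((μ * (areaΓ a)⁻¹ * (lam - z)⁻¹ : ℝ) : ℂ)) = θ * conj (green a k z (x₀ a)) := by
    rw [sub_add_cancel, map_mul, Complex.conj_conj]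
  rw [hc]
  have hd : conj θ * (θ * conj (green a k z (x₀ a)) / n) = conj (green a k z (x₀ a)) / n := by
    rw [← mul_div_assoc, ← mul_assoc, e, one_mul]
  have hd2 : conj θ * ((1 - θ * conj (green a k z (x₀ a)) / n) *
      ((μ * (areaΓ a)⁻¹ * (lam - z)⁻¹ : ℝ) : ℂ)) * (μ : ℂ)⁻¹ =
      (areaΓ a : ℂ)⁻¹ * (conj θ * ((lam : ℂ) - z)⁻¹) -
        (conj (green a k z (x₀ a)) / n) * ((areaΓ a : ℂ)⁻¹ * ((lam : ℂ) - z)⁻¹) := by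
    rw [← hd]
    push_cast
    generalize ((lam : ℂ) - z)⁻¹ = w
    generalize θ * conj (green a k z (x₀ a)) / n = v
    generalize (areaΓ a : ℂ)⁻¹ = A
    field_simp
  rw [hd, hd2]
  congr 1
  module

theorem WavesTotal.waveCoeff_gLimit (hT : WavesTotal a k) (ha : 0 < a) {n : ℤ × ℤ}
    (hn : ∀ j, m j ≠ n) : waveCoeff a k (gLimit a k lam m θ) n =
      ((√2 : ℂ))⁻¹ * ((planeWave a k n (-x₀ a) - conj θ) * resCoeff a k lam n) := by
  rw [gLimit, waveCoeff_smul, waveCoeff_add, waveCoeff_sub, waveCoeff_smul, waveCoeff_smul,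
    waveCoeff_sum, hT.waveCoeff_greenL2 ha, hT.waveCoeff_greenL2 ha]
  have : ∑ l, waveCoeff a k (planeWaveL2 a k (m l)) n = 0 :=
    Finset.sum_eq_zero fun l _ => by rw [waveCoeff_planeWaveL2 a ha, if_neg (hn l).symm]
  rw [this, neg_zero, planeWave_zero]
  ring

theorem WavesTotal.resonantValue_gLimit (hT : WavesTotal a k) (ha : 0 < a) (hμ : 0 < μ)
    (hm : Function.Injective m) (hlev : ∀ n, level a k n = lam ↔ ∃ j, m j = n) :
    resonantValue a k m (gLimit a k lam m θ) 0 = ((√2 : ℂ))⁻¹ * (areaΓ a * (conj θ *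
      (Complex.I * ((conj θ * green a k lam (x₀ a)).im : ℂ)))) := by
  classical
  have h1 : ∀ j, waveCoeff a k (gLimit a k lam m θ) (m j) = ((√2 : ℂ))⁻¹ * ((conj θ *
      (Complex.I * ((conj θ * green a k lam (x₀ a)).im : ℂ))) * (μ : ℂ)⁻¹ * areaΓ a) := by
    intro j
    have hr : resCoeff a k lam (m j) = 0 := by
      simp [resCoeff, (hlev _).2 ⟨j, rfl⟩]
    rw [gLimit, waveCoeff_smul, waveCoeff_add, waveCoeff_sub, waveCoeff_smul, waveCoeff_smul,
      waveCoeff_sum, hT.waveCoeff_greenL2 ha, hT.waveCoeff_greenL2 ha, hr]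
    simp [waveCoeff_planeWaveL2 a ha, hm.eq_iff]
  have hμ' : (μ : ℂ) ≠ 0 := by exact_mod_cast hμ.ne'
  simp only [resonantValue, planeWave_zero, h1, one_mul, Finset.sum_const, Finset.card_univ,
    Fintype.card_fin, nsmul_eq_mul]
  field_simp

theorem resonantValue_x₀ (hθ : ∀ j, planeWave a k (m j) (x₀ a) = θ) (ψ : L2 a) :
    resonantValue a k m ψ (x₀ a) = θ * resonantValue a k m ψ 0 := by
  simp only [resonantValue, hθ, planeWave_zero, Finset.mul_sum, one_mul]

/-- The eigenvalue equation at a resonant level at which all phases coincide. -/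
theorem WavesTotal.mem_eigenspace_iff_of_phase (hT : WavesTotal a k) (ha : 0 < a) (hμ : 0 < μ)
    (α : ℝ) (hm : Function.Injective m) (hlev : ∀ n, level a k n = lam ↔ ∃ j, m j = n)
    (hθ1 : ‖θ‖ = 1) (hθ : ∀ j, planeWave a k (m j) (x₀ a) = θ) (ψ : L2 a) :
    ψ ∈ eigenspace (honeycombOperator a α k) (lam : ℂ) ↔
      ∃ c : ℂ, c * ((α : ℂ) - criticalCoupling a k lam θ) = 0 ∧
        (∀ n, (∀ j, m j ≠ n) → waveCoeff a k ψ n =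
          c * ((planeWave a k n (-x₀ a) - conj θ) * resCoeff a k lam n)) ∧
        resonantValue a k m ψ 0 = c * (areaΓ a * (conj θ *
          (Complex.I * ((conj θ * green a k lam (x₀ a)).im : ℂ)))) := by
  have hA : (areaΓ a : ℂ) ≠ 0 := by exact_mod_cast (areaΓ_pos a ha).ne'
  have e := conj_mul_self_of_norm hθ1
  have hl : ∀ i, (level a k (m i) : ℂ) - lam = 0 := fun i => by
    rw [(hlev _).2 ⟨i, rfl⟩, sub_self]
  have hne : ∀ n, (∀ j, m j ≠ n) → (level a k n : ℂ) - lam ≠ 0 := by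
    intro n hn
    refine sub_ne_zero.2 ?_
    have : level a k n ≠ lam := by rw [Ne, hlev]; push Not; exact hn
    exact_mod_cast this
  set t := conj θ * green a k lam (x₀ a) with ht
  have hg1 : green a k lam (x₀ a) = θ * t := by rw [ht, ← mul_assoc, mul_comm θ, e, one_mul]
  have hg2 : green a k lam (-x₀ a) = conj θ * conj t := by rw [green_neg ha, hg1, map_mul]
  have hg0 := green_zero_eq_ofReal (k := k) ha lam
  set g₀ := (green a k lam 0).re with hg₀
  have hC : (criticalCoupling a k lam θ : ℂ) = g₀ - t.re := by
    rw [criticalCoupling, ← ht, ← hg₀, Complex.ofReal_sub]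
  have hre : t + conj t = 2 * t.re := by rw [Complex.add_conj]; push_cast; ring
  have him : t - conj t = 2 * (Complex.I * t.im) := by rw [Complex.sub_conj]; push_cast; ring
  rw [hT.mem_eigenspace_iff ha α hm hlev, hC]
  clear_value t g₀
  -- The resonant part of ψ takes the values r at 0 and θr at x₀. The second boundary equation minus
  -- θ times the first eliminates r and leaves 2 area(Γ) c(α - C) = 0; either equation then
  -- determines r.
  have hbc : ∀ (c : ℂ) (q : Fin 2 → ℂ), q 0 = -(c * conj θ) → q 1 = c →
      ((∀ j, areaΓ a * (α * q j - ∑ j', green a k lam (scatterer a j - scatterer a j') * q j') =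
          resonantValue a k m ψ (scatterer a j)) ↔
        c * ((α : ℂ) - (g₀ - t.re)) = 0 ∧
        resonantValue a k m ψ 0 = c * (areaΓ a * (conj θ * (Complex.I * t.im)))) := by
    intro c q hq0 hq1
    rw [Fin.forall_fin_two]
    simp only [Fin.sum_univ_two, scatterer, Matrix.cons_val_zero, Matrix.cons_val_one, sub_self,
      zero_sub, sub_zero, neg_zero, hq0, hq1, hg0, hg1, hg2, resonantValue_x₀ hθ]
    set r := resonantValue a k m ψ 0
    constructor
    · rintro ⟨h0, h1⟩
      have hmain : c * ((α : ℂ) - (g₀ - t.re)) = 0 := by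
        refine (mul_eq_zero.1 (?_ : (2 * (areaΓ a : ℂ)) * (c * ((α : ℂ) - (g₀ - t.re))) = 0)).resolve_left
          (mul_ne_zero two_ne_zero hA)
        linear_combination h1 - θ * h0 - areaΓ a * c * hre -
          areaΓ a * c * (α - g₀ + t + conj t) * e
      refine ⟨hmain, ?_⟩
      linear_combination -h0 - areaΓ a * conj θ * hmain - areaΓ a * c * conj θ / 2 * hre +
        areaΓ a * c * conj θ / 2 * him
    · rintro ⟨h0, h1⟩
      constructor
      · linear_combination -h1 - areaΓ a * conj θ * h0 - areaΓ a * c * conj θ / 2 * hre +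
          areaΓ a * c * conj θ / 2 * him
      · linear_combination -θ * h1 + areaΓ a * h0 + areaΓ a * c / 2 * (hre + him) +
          areaΓ a * c * (t - Complex.I * t.im) * e
  constructor
  · rintro ⟨q, hq, hb⟩
    have hq0 : q 0 = -(q 1 * conj θ) := by
      have h := hq (m ⟨0, hμ⟩)
      rw [hl, zero_mul, sourceCoeff_eq, planeWave_neg, hθ] at h
      linear_combination -h
    obtain ⟨h1, h2⟩ := (hbc (q 1) q hq0 rfl).1 hb
    refine ⟨q 1, h1, fun n hn => ?_, h2⟩
    have h := hq n
    rw [sourceCoeff_eq, hq0] at h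
    have hn' := hne n hn
    rw [resCoeff]
    field_simp
    linear_combination h
  · rintro ⟨c, h1, h2, h3⟩
    refine ⟨![-(c * conj θ), c], fun n => ?_, (hbc c _ (by simp) (by simp)).2 ⟨h1, h3⟩⟩
    rw [sourceCoeff_eq]
    simp only [Matrix.cons_val_zero, Matrix.cons_val_one]
    by_cases hn : ∃ j, m j = n
    · obtain ⟨j, rfl⟩ := hn
      rw [hl, planeWave_neg, hθ]
      ring
    · push Not at hn
      have hn' := hne n hn
      rw [h2 n hn, resCoeff]
      field_simp
      ring

theorem WavesTotal.eigenspace_eq_of_ne_critical (hT : WavesTotal a k) (ha : 0 < a) (hμ : 0 < μ)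
    {α : ℝ} (hm : Function.Injective m) (hlev : ∀ n, level a k n = lam ↔ ∃ j, m j = n)
    (hθ1 : ‖θ‖ = 1) (hθ : ∀ j, planeWave a k (m j) (x₀ a) = θ)
    (hα : α ≠ criticalCoupling a k lam θ) :
    eigenspace (honeycombOperator a α k) (lam : ℂ) = trigSpace a k m {0} := by
  ext ψ
  rw [hT.mem_eigenspace_iff_of_phase ha hμ α hm hlev hθ1 hθ, hT.mem_trigSpace_iff ha hm]
  have hα' : (α : ℂ) - criticalCoupling a k lam θ ≠ 0 := sub_ne_zero.2 (by exact_mod_cast hα)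
  constructor
  · rintro ⟨c, hc, h1, h2⟩
    obtain rfl := (mul_eq_zero.1 hc).resolve_right hα'
    exact ⟨fun n hn => by rw [h1 n hn, zero_mul], by simpa using h2⟩
  · rintro ⟨h1, h2⟩
    exact ⟨0, by simp, fun n hn => by rw [h1 n hn, zero_mul], by simpa using h2⟩

theorem resonantValue_sub_smul (c : ℂ) (ψ χ : L2 a) (y : Plane) :
    resonantValue a k m (ψ - c • χ) y =
      resonantValue a k m ψ y - c * resonantValue a k m χ y := by
  simp only [resonantValue, waveCoeff_sub, waveCoeff_smul, Finset.mul_sum,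
    ← Finset.sum_sub_distrib]
  exact Finset.sum_congr rfl fun j _ => by ring

/-- At the critical coupling c is free. `gLimit` solves the equations with c = 1/√2, and two
solutions with the same c differ by one with c = 0. -/
theorem WavesTotal.eigenspace_eq_of_eq_critical (hT : WavesTotal a k) (ha : 0 < a) (hμ : 0 < μ)
    {α : ℝ} (hm : Function.Injective m) (hlev : ∀ n, level a k n = lam ↔ ∃ j, m j = n)
    (hθ1 : ‖θ‖ = 1) (hθ : ∀ j, planeWave a k (m j) (x₀ a) = θ)
    (hα : α = criticalCoupling a k lam θ) :
    eigenspace (honeycombOperator a α k) (lam : ℂ) =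
      trigSpace a k m {0} ⊔ Submodule.span ℂ {gLimit a k lam m θ} := by
  have h2 : (√2 : ℂ) ≠ 0 := by
    exact_mod_cast (Real.sqrt_pos.2 (by norm_num : (0 : ℝ) < 2)).ne'
  ext ψ
  have key : ∀ d : ℂ, ψ - d • gLimit a k lam m θ ∈ trigSpace a k m {0} ↔
      (∀ n, (∀ j, m j ≠ n) → waveCoeff a k ψ n =
          (d * (√2 : ℂ)⁻¹) * ((planeWave a k n (-x₀ a) - conj θ) * resCoeff a k lam n)) ∧
        resonantValue a k m ψ 0 = (d * (√2 : ℂ)⁻¹) * (areaΓ a * (conj θ *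
          (Complex.I * ((conj θ * green a k lam (x₀ a)).im : ℂ)))) := by
    intro d
    rw [hT.mem_trigSpace_iff ha hm]
    simp only [Set.mem_singleton_iff, forall_eq, resonantValue_sub_smul,
      hT.resonantValue_gLimit ha hμ hm hlev, waveCoeff_sub, waveCoeff_smul, sub_eq_zero]
    refine and_congr (forall₂_congr fun n hn => ?_) ?_
    · rw [hT.waveCoeff_gLimit ha hn, ← mul_assoc]
    · rw [← mul_assoc]
  rw [hT.mem_eigenspace_iff_of_phase ha hμ α hm hlev hθ1 hθ, Submodule.mem_sup]
  constructor
  · rintro ⟨c, -, h⟩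
    refine ⟨ψ - (c * √2) • gLimit a k lam m θ, (key _).2 ?_, (c * √2) • gLimit a k lam m θ,
      Submodule.smul_mem _ _ (Submodule.mem_span_singleton_self _), sub_add_cancel _ _⟩
    rwa [mul_inv_cancel_right₀ h2]
  · rintro ⟨u, hu, w, hw, rfl⟩
    obtain ⟨d, rfl⟩ := Submodule.mem_span_singleton.1 hw
    exact ⟨d * (√2 : ℂ)⁻¹, by rw [hα, sub_self, mul_zero], (key d).1 (by rwa [add_sub_cancel_right])⟩

/-- Not all waves share the phase θ at x₀. One with another phase is nonresonant, and `gLimit` has a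
nonzero coefficient there, so it lies outside the wave sums. -/
theorem exists_nonresonant_phase (ha : 0 < a) (hθ : ∀ j, planeWave a k (m j) (x₀ a) = θ) :
    ∃ n, (∀ j, m j ≠ n) ∧ planeWave a k n (-x₀ a) - conj θ ≠ 0 := by
  have h : ∃ n, planeWave a k n (x₀ a) ≠ θ := by
    by_contra! h
    exact planeWave_zero_ne_shift ha k ((h _).trans (h _).symm)
  obtain ⟨n, hn⟩ := h
  refine ⟨n, fun j hj => hn (hj ▸ hθ j), sub_ne_zero.2 fun h' => hn ?_⟩
  rw [planeWave_neg] at h'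
  exact (starRingEnd ℂ).injective h'

theorem WavesTotal.smul_gLimit_notMem (hT : WavesTotal a k) (ha : 0 < a)
    (hm : Function.Injective m) (hlev : ∀ n, level a k n = lam ↔ ∃ j, m j = n)
    (hθ : ∀ j, planeWave a k (m j) (x₀ a) = θ) {d : ℂ}
    (hd : d • gLimit a k lam m θ ∈ trigSpace a k m {0}) : d = 0 := by
  have h2 : (√2 : ℂ) ≠ 0 := by
    exact_mod_cast (Real.sqrt_pos.2 (by norm_num : (0 : ℝ) < 2)).ne'
  obtain ⟨n, hn, hp⟩ := exists_nonresonant_phase ha hθ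
  have h := ((hT.mem_trigSpace_iff ha hm).1 hd).1 n hn
  rw [waveCoeff_smul, hT.waveCoeff_gLimit ha hn] at h
  have hl : (level a k n : ℂ) - lam ≠ 0 := by
    refine sub_ne_zero.2 ?_
    have : level a k n ≠ lam := by rw [Ne, hlev]; push Not; exact hn
    exact_mod_cast this
  exact (mul_eq_zero.1 h).resolve_right
    (mul_ne_zero (inv_ne_zero h2) (mul_ne_zero hp (inv_ne_zero hl)))

theorem WavesTotal.disjoint_trigSpace_gLimit (hT : WavesTotal a k) (ha : 0 < a)
    (hm : Function.Injective m) (hlev : ∀ n, level a k n = lam ↔ ∃ j, m j = n)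
    (hθ : ∀ j, planeWave a k (m j) (x₀ a) = θ) :
    Disjoint (trigSpace a k m {0}) (Submodule.span ℂ {gLimit a k lam m θ}) := by
  rw [Submodule.disjoint_def]
  intro u hu hu'
  obtain ⟨d, rfl⟩ := Submodule.mem_span_singleton.1 hu'
  rw [hT.smul_gLimit_notMem ha hm hlev hθ hu, zero_smul]

theorem WavesTotal.finrank_sup_gLimit (hT : WavesTotal a k) (ha : 0 < a) (hμ : 0 < μ)
    (hm : Function.Injective m) (hlev : ∀ n, level a k n = lam ↔ ∃ j, m j = n)
    (hθ : ∀ j, planeWave a k (m j) (x₀ a) = θ) :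
    Module.finrank ℂ ↥(trigSpace a k m {0} ⊔ Submodule.span ℂ {gLimit a k lam m θ}) = μ := by
  have hdis := hT.disjoint_trigSpace_gLimit ha hm hlev hθ
  have hne : gLimit a k lam m θ ≠ 0 := by
    intro h0
    refine one_ne_zero (α := ℂ) (hT.smul_gLimit_notMem ha hm hlev hθ (d := 1) ?_)
    rw [h0, smul_zero]
    exact Submodule.zero_mem _
  have h1 := Submodule.finrank_sup_add_finrank_inf_eq (trigSpace a k m {0})
    (Submodule.span ℂ {gLimit a k lam m θ})
  rw [hdis.eq_bot, finrank_bot, finrank_span_singleton hne, add_zero,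
    finrank_trigSpace_zero ha hμ hm] at h1
  exact h1

end CommonPhase

end

section

variable {a : ℝ} {k : Plane}

/-! ### The resolvent of the honeycomb operator -/

/-- The free resolvent at i is diagonal with coefficients tending to 0, and Krein's correction has
finite rank. -/
theorem WavesTotal.exists_compact_resolvent (hT : WavesTotal a k) (ha : 0 < a) (α : ℝ) :
    ∃ R : L2 a →L[ℂ] L2 a, IsCompactOperator R ∧
      ∀ ψ η, (ψ, η) ∈ honeycombOperator a α k ↔ R (η - Complex.I • ψ) = ψ := by
  obtain ⟨C, hC, hb⟩ := exists_norm_resCoeff_le a ha k Complex.I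
  have hb' : ∀ m, ‖resCoeff a k Complex.I m‖ ≤ C := by
    intro m
    refine (hb m).trans ?_
    have h1 := level_nonneg a k m
    have : (1 + level a k m)⁻¹ ≤ 1 := inv_le_one_of_one_le₀ (by linarith)
    nlinarith
  obtain ⟨R₀, hR₀, -⟩ := hT.exists_diagonal ha hb'
  have hR₀c := hT.isCompactOperator_of_diagonal ha (tendsto_resCoeff a ha k Complex.I) R₀ hR₀
  let K : L2 a →L[ℂ] L2 a := ∑ j : Fin 2, ∑ j' : Fin 2,
    (innerSL ℂ (greenL2 a k (conj Complex.I) (scatterer a j))).smulRight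
      ((gammaMatrix a α k Complex.I)⁻¹ j j' • greenL2 a k Complex.I (scatterer a j'))
  have hK : ∀ f, K f = resolventCorrection a α k Complex.I f := by
    intro f
    simp only [K, resolventCorrection, sum_apply, ContinuousLinearMap.smulRight_apply,
      innerSL_apply_apply, smul_smul]
    exact Finset.sum_congr rfl fun j _ => Finset.sum_congr rfl fun j' _ => by rw [mul_comm]
  have hKc : IsCompactOperator K :=
    isCompactOperator_finset_sum _ _ fun j _ => isCompactOperator_finset_sum _ _ fun j' _ =>
      isCompactOperator_smulRight _ _
  have hΓ := isUnit_det_gammaMatrix ha α k (z := Complex.I) (by simp)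
  refine ⟨R₀ + K, hR₀c.add hKc, fun ψ η => ?_⟩
  rw [hT.mem_honeycombOperator_iff ha α Complex.I, ← hT.isResolventAt_iff ha α level_ne_I hΓ]
  set f := η - Complex.I • ψ
  have hφ : ∀ φ : L2 a, (φ, Complex.I • φ + f) ∈ floquetLaplacian a k ↔ φ = R₀ f := by
    intro φ
    have hz : ∀ m, (level a k m : ℂ) - Complex.I ≠ 0 := fun m => sub_ne_zero.2 (level_ne_I m)
    rw [mem_floquetLaplacian]
    constructor
    · intro h
      refine hT.ext fun m => ?_
      have h1 := h m
      have h2 := hz m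
      rw [waveCoeff_add, waveCoeff_smul] at h1
      rw [hR₀, resCoeff]
      field_simp
      linear_combination -h1
    · rintro rfl m
      have h2 := hz m
      rw [waveCoeff_add, waveCoeff_smul, hR₀, resCoeff]
      field_simp
      ring
  rw [add_apply, hK]
  constructor
  · rintro ⟨φ, h1, h2⟩
    rw [← (hφ φ).1 h1, ← h2]
  · intro h
    exact ⟨R₀ f, (hφ _).2 rfl, h.symm⟩

/-- Fredholm alternative: Tψ = zψ means Rψ = (z - w)⁻¹ψ, and the nonzero number (z - w)⁻¹ is an
eigenvalue of the compact R or lies in its resolvent set. -/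
theorem notMem_spectrumOf_iff {H : Type*} [NormedAddCommGroup H] [NormedSpace ℂ H]
    [CompleteSpace H] {S : Submodule ℂ (H × H)} {R : H →L[ℂ] H} (hR : IsCompactOperator R)
    {w z : ℂ} (hzw : z ≠ w) (hS : ∀ ψ η, (ψ, η) ∈ S ↔ R (η - w • ψ) = ψ) :
    z ∉ spectrumOf S ↔ eigenspace S z = ⊥ := by
  have hd : z - w ≠ 0 := sub_ne_zero.2 hzw
  rw [spectrumOf, Set.mem_ofPred_eq, not_not, Submodule.eq_bot_iff]
  constructor
  · rintro ⟨B, hB⟩ ψ hψ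
    have := (hB ψ (z • ψ)).1 hψ
    rw [sub_self, map_zero] at this
    exact this.symm
  · intro hker
    have hres : (z - w)⁻¹ ∈ resolventSet ℂ R := by
      refine (hR.hasEigenvalue_or_mem_resolventSet (inv_ne_zero hd)).resolve_left fun hev => ?_
      obtain ⟨ψ, hψ⟩ := hev.exists_hasEigenvector
      refine hψ.2 (hker ψ ((hS ψ (z • ψ)).2 ?_))
      have h1 : R ψ = (z - w)⁻¹ • ψ := hψ.apply_eq_smul
      rw [← sub_smul, map_smul, h1, smul_inv_smul₀ hd]
    obtain ⟨N, hN⟩ := hres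
    have hN1 : ∀ f, (N : H →L[ℂ] H) f = (z - w)⁻¹ • f - R f := by
      intro f
      rw [hN, sub_apply, Algebra.algebraMap_eq_smul_one]
      rfl
    have hN2 : ∀ f g, (↑N⁻¹ : H →L[ℂ] H) f = g ↔ f = (N : H →L[ℂ] H) g := by
      intro f g
      constructor
      · rintro rfl
        rw [← mul_apply_eq_comp, Units.mul_inv, one_apply_eq_self]
      · rintro rfl
        rw [← mul_apply_eq_comp, Units.inv_mul, one_apply_eq_self]
    -- With N = (z - w)⁻¹ - R, the first resolvent identity gives (T - z)⁻¹ = N⁻¹(z - w)⁻¹R.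
    refine ⟨(↑N⁻¹ : H →L[ℂ] H) ∘L ((z - w)⁻¹ • R), fun ψ η => ?_⟩
    rw [hS, ContinuousLinearMap.comp_apply, hN2, hN1]
    have e : η - w • ψ = (η - z • ψ) + (z - w) • ψ := by module
    rw [e, map_add, map_smul, smul_apply]
    constructor
    · intro h
      nth_rewrite 2 [← h]
      rw [smul_add, inv_smul_smul₀ hd, add_sub_cancel_right]
    · intro h
      have h2 := congrArg (fun v => (z - w) • v) h
      simp only [smul_sub, smul_inv_smul₀ hd] at h2
      rw [h2, sub_add_cancel]

end

end Honeycomb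

end

/-! ### Assembly of the proposition -/

theorem mainTheorem7 (a : ℝ) (ha : 0 < a) (α : ℝ) (k : Plane) (lam : ℝ) (μ : ℕ) (hμ : 0 < μ)
    (hmult : mult (lam : ℂ) (floquetLaplacian a k) = μ)
    (m : Fin μ → ℤ × ℤ) (hm : Function.Injective m)
    (hlam : ∀ j, ‖ξ a (m j) + k‖ ^ 2 = lam) :
    -- Case 1
    ((μ : ℝ) ≠ ‖∑ j, Complex.exp (Complex.I * ((inner ℝ (ξ a (m j)) (x₀ a) : ℝ) : ℂ))‖ →
      mult (lam : ℂ) (honeycombOperator a α k) + 2 = μ ∧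
      eigenspace (honeycombOperator a α k) (lam : ℂ) = trigSpace a k m {0, x₀ a}) ∧
    -- Cases 2 and 3, according to the limit `C` of `g_z(0, k) - |g_z(x₀, k)|` as `z ↗ lam`
    ((μ : ℝ) = ‖∑ j, Complex.exp (Complex.I * ((inner ℝ (ξ a (m j)) (x₀ a) : ℝ) : ℂ))‖ →
      ∃ C : ℝ,
        Tendsto (fun z : ℝ => green a k (z : ℂ) 0 - (‖green a k (z : ℂ) (x₀ a)‖ : ℂ))
          (𝓝[<] lam) (𝓝 (C : ℂ)) ∧
        (α ≠ C →
          mult (lam : ℂ) (honeycombOperator a α k) + 1 = μ ∧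
          eigenspace (honeycombOperator a α k) (lam : ℂ) = trigSpace a k m {0}) ∧
        (α = C →
          mult (lam : ℂ) (honeycombOperator a α k) = μ ∧
          ∃ g : L2 a,
            Tendsto (fun z : ℝ => gTilde₂ a k (z : ℂ)) (𝓝[<] lam) (𝓝 g) ∧
            Disjoint (trigSpace a k m {0}) (Submodule.span ℂ {g}) ∧
            eigenspace (honeycombOperator a α k) (lam : ℂ) =
              trigSpace a k m {0} ⊔ Submodule.span ℂ {g})) ∧
    -- multiplicity zero means not in the spectrum
    (mult (lam : ℂ) (honeycombOperator a α k) = 0 ↔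
      (lam : ℂ) ∉ spectrumOf (honeycombOperator a α k)) := by
  have hlev' : ∀ j, level a k (m j) = lam := hlam
  have hlev := level_eq_iff_of_mult ha hμ hmult hm hlev'
  have hT := wavesTotal_of_mult ha hμ hmult hm hlev'
  have hcase1 : (μ : ℝ) ≠
      ‖∑ j, Complex.exp (Complex.I * ((inner ℝ (ξ a (m j)) (x₀ a) : ℝ) : ℂ))‖ →
      mult (lam : ℂ) (honeycombOperator a α k) + 2 = μ ∧
      eigenspace (honeycombOperator a α k) (lam : ℂ) = trigSpace a k m {0, x₀ a} := by
    intro h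
    rw [Ne, card_eq_norm_sum_exp_iff (k := k)] at h
    push Not at h
    obtain ⟨i, j, hij⟩ := h
    have he := hT.eigenspace_eq_of_ne ha α hm hlev hij
    exact ⟨by rw [mult, he, finrank_trigSpace_pair ha hm hij], he⟩
  have hcase2 : (μ : ℝ) =
      ‖∑ j, Complex.exp (Complex.I * ((inner ℝ (ξ a (m j)) (x₀ a) : ℝ) : ℂ))‖ →
      ∃ θ : ℂ, ‖θ‖ = 1 ∧ ∀ j, planeWave a k (m j) (x₀ a) = θ := fun h =>
    ⟨planeWave a k (m ⟨0, hμ⟩) (x₀ a), norm_planeWave _ _ _ _,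
      fun j => (card_eq_norm_sum_exp_iff m).1 h j _⟩
  refine ⟨hcase1, fun h => ?_, ?_⟩
  · obtain ⟨θ, hθ1, hθ⟩ := hcase2 h
    refine ⟨criticalCoupling a k lam θ, tendsto_green_zero_sub_norm ha hμ hm hlev hθ1 hθ,
      fun hα => ?_, fun hα => ?_⟩
    · have he := hT.eigenspace_eq_of_ne_critical ha hμ hm hlev hθ1 hθ hα
      exact ⟨by rw [mult, he, finrank_trigSpace_zero ha hμ hm], he⟩
    · have he := hT.eigenspace_eq_of_eq_critical ha hμ hm hlev hθ1 hθ hα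
      exact ⟨by rw [mult, he, hT.finrank_sup_gLimit ha hμ hm hlev hθ], gLimit a k lam m θ,
        hT.tendsto_gTilde₂ ha hμ hm hlev hθ1 hθ, hT.disjoint_trigSpace_gLimit ha hm hlev hθ, he⟩
  -- Needed because `finrank` is also 0 on an infinite-dimensional space; only with finiteness does
  -- multiplicity 0 mean a trivial eigenspace.
  · have hfin : Module.Finite ℂ (eigenspace (honeycombOperator a α k) (lam : ℂ)) := by
      by_cases h : (μ : ℝ) =
          ‖∑ j, Complex.exp (Complex.I * ((inner ℝ (ξ a (m j)) (x₀ a) : ℝ) : ℂ))‖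
      · obtain ⟨θ, hθ1, hθ⟩ := hcase2 h
        by_cases hα : α = criticalCoupling a k lam θ
        · rw [hT.eigenspace_eq_of_eq_critical ha hμ hm hlev hθ1 hθ hα]
          infer_instance
        · rw [hT.eigenspace_eq_of_ne_critical ha hμ hm hlev hθ1 hθ hα]
          infer_instance
      · rw [(hcase1 h).2]
        infer_instance
    obtain ⟨R, hR, hS⟩ := hT.exists_compact_resolvent ha α
    have hI : (lam : ℂ) ≠ Complex.I := by
      intro h
      have := congrArg Complex.im h
      simp at this
    rw [notMem_spectrumOf_iff hR hI hS, mult, Submodule.finrank_eq_zero]
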